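/- Write $\mathbb{P}^1(\mathbb{Q})=\mathbb{Q}\cup\{\infty\}$, with $SL_2(\mathbb{Z})$ acting by fractional linear transformations, and let $SL_2(\mathbb{Z})$ act on $\mathrm{Sym}^{m}\mathbb{Z}^2$ (homogeneous polynomials of degree $m$ in $x,y$ over $\mathbb{Z}$) by $gP=P\circ g^{-1}$. Let $\mathbb{M}_2$ be the abelian group generated by symbols $\{a,b\}$, $a,b\in\mathbb{P}^1(\mathbb{Q})$, modulo the relations $\{a,b\}+\{b,c\}+\{c,a\}=0$ and modulo torsion, and let $\mathbb{B}_2$ be the free abelian group on the symbols $\{a\}$, $a\in\mathbb{P}^1(\mathbb{Q})$. For $k\ge 2$ put $\mathbb{M}_k=\mathrm{Sym}^{k-2}\mathbb{Z}^2\otimes\mathbb{M}_2$ and $\mathbb{B}_k=\mathrm{Sym}^{k-2}\mathbb{Z}^2\otimes\mathbb{B}_2$ with the diagonal actions of $SL_2(\mathbb{Z})$. Let $\Gamma\subseteq\Gamma'\subseteq SL_2(\mathbb{Z})$ be subgroups of finite index with $\Gamma$ normal in $\Gamma'$, let $\varepsilon:\Gamma'/\Gamma\to\mathbb{Q}(\zeta)^{\times}$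 be a character of order $n$, where $\zeta$ is a primitive $n$-th root of unity, and write $\varepsilon$ also for the induced character of $\Gamma'$. Let $\mathbb{M}_k(\Gamma)$ and $\mathbb{B}_k(\Gamma)$ be the $\Gamma$-coinvariants of $\mathbb{M}_k$ and $\mathbb{B}_k$, and let $\mathbb{M}_k(\Gamma,\varepsilon)$ be the quotient of $\mathbb{Z}[\zeta]\otimes\mathbb{M}_k(\Gamma)$ by the relations $\gamma' x=\varepsilon(\gamma')x$ ($\gamma'\in\Gamma'$) and by all $\mathbb{Z}$-torsion; define $\mathbb{B}_k(\Gamma,\varepsilon)$ in the same way from $\mathbb{B}_k(\Gamma)$. The map $P\otimes\{a,b\}\mapsto P\otimes\{a\}-P\otimes\{b\}$ induces the boundary map $\partial:\mathbb{M}_k(\Gamma,\varepsilon)\to\mathbb{B}_k(\Gamma,\varepsilon)$. Its kernel is the $\mathbb{Z}[\zeta]$-module $\mathbb{S}_k(\Gamma,\varepsilon)$ of cuspidal modular symbols. Let $c_\varepsilon(\Gamma)=\dim_{\mathbb{Q}(\zeta)}\mathbb{Q}(\zeta)\otimes_{\mathbb{Z}[\zeta]}\mathbb{B}_2(\Gamma,\varepsilon)$.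 For $P\in\mathrm{Sym}^{k-2}\mathbb{Z}^2$ and $g\in SL_2(\mathbb{Z})$, the Manin symbol $[P,g]$ is the class of $g(P\otimes\{0,\infty\})$. For a list $R$ of representatives of $\Gamma\backslash SL_2(\mathbb{Z})$ and $x\in SL_2(\mathbb{Z})$, let $\mathrm{CosetIndex}(x,R,\Gamma)$ be the unique index $i$ with $x\in\Gamma R[i]$; likewise for $\Gamma'$ and a list $R'$ of representatives of $\Gamma'\backslash SL_2(\mathbb{Z})$. **Theorem.** There are an algorithm and an absolute constant $C$ such that the following holds for all $\Gamma,\Gamma',\varepsilon$ as above and all $k\ge 2$. The algorithm is given $k$, $n$, lists $R$, $R'$ of representatives of $\Gamma\backslash SL_2(\mathbb{Z})$ and $\Gamma'\backslash SL_2(\mathbb{Z})$, and the character $\varepsilon$ as a table of pairs $(\gamma',e)$ with $\varepsilon(\gamma')=\zeta^{e}$, where $\gamma'\in\Gamma'$ runs through representatives of $\Gamma'/\Gamma$. It has access to the groups only by evaluating $\mathrm{CosetIndex}(\cdot,R,\Gamma)$ and $\mathrm{CosetIndex}(\cdot,R',\Gamma')$. It halts, after at most $$C\cdot\bigl([SL_2(\mathbb{Z}):\Gamma']\cdot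 c_\varepsilon(\Gamma)+[SL_2(\mathbb{Z}):\Gamma]\bigr)$$ $\mathrm{CosetIndex}$ operations, with a list of elements of $\mathbb{S}_k(\Gamma,\varepsilon)$, each written as an explicit $\mathbb{Z}[\zeta]$-linear combination of Manin symbols $[x^{w}y^{k-2-w},r']$ with $r'\in R'$, and these elements form a basis of the $\mathbb{Q}(\zeta)$-vector space $\mathbb{Q}(\zeta)\otimes_{\mathbb{Z}[\zeta]}\mathbb{S}_k(\Gamma,\varepsilon)$. Here an algorithm is a partial recursive procedure which computes, from its input and the answers to its previous $\mathrm{CosetIndex}$ evaluations, either the next evaluation to be made or the output. -/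

import Mathlib

open scoped MatrixGroups TensorProduct

noncomputable section

namespace ModSym

/-! ### Torsion-free quotients -/

/-- The elements of `M` some nonzero integer multiple of which lies in `S`. The quotient of `M` by
`zSaturation S` is the quotient of `M` by `S` and then by all `ℤ`-torsion. -/
def zSaturation {A M : Type*} [CommRing A] [AddCommGroup M] [Module A M] (S : Submodule A M) :
    Submodule A M where
  carrier := {x | ∃ N : ℤ, N ≠ 0 ∧ N • x ∈ S}
  zero_mem' := ⟨1, one_ne_zero, by simp⟩
  add_mem' := by
    rintro x y ⟨N, hN, hx⟩ ⟨N', hN', hy⟩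
    refine ⟨N * N', mul_ne_zero hN hN', ?_⟩
    rw [smul_add, mul_comm N N', mul_smul, mul_comm N' N, mul_smul]
    exact S.add_mem (zsmul_mem hx N') (zsmul_mem hy N)
  smul_mem' := by
    rintro c x ⟨N, hN, hx⟩
    exact ⟨N, hN, by rw [smul_comm]; exact S.smul_mem c hx⟩

theorem zSaturation_le_comap {A M M' : Type*} [CommRing A] [AddCommGroup M] [Module A M]
    [AddCommGroup M'] [Module A M'] {S : Submodule A M} {S' : Submodule A M'} (f : M →ₗ[A] M')
    (h : S ≤ S'.comap f) : zSaturation S ≤ (zSaturation S').comap f := by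
  rintro x ⟨N, hN, hx⟩
  refine ⟨N, hN, ?_⟩
  rw [← map_zsmul]
  exact h hx

/-! ### Symmetric powers -/

/-- `Sym^m ℤ²`, as the homogeneous polynomials of degree `m` in two variables over `ℤ`. -/
abbrev Sym (m : ℕ) : Type := MvPolynomial.homogeneousSubmodule (Fin 2) ℤ m

/-- The substitution `P ↦ P ∘ g⁻¹` on integral polynomials in two variables. -/
def polyAct (g : SL(2, ℤ)) : MvPolynomial (Fin 2) ℤ →ₐ[ℤ] MvPolynomial (Fin 2) ℤ :=
  MvPolynomial.aeval fun i => ∑ j, MvPolynomial.C ((g⁻¹ : SL(2, ℤ)) i j) * MvPolynomial.X j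

theorem polyAct_one : polyAct 1 = AlgHom.id ℤ _ := by
  apply MvPolynomial.algHom_ext
  intro i
  fin_cases i <;> simp [polyAct]

theorem polyAct_mul (g h : SL(2, ℤ)) : polyAct (g * h) = (polyAct g).comp (polyAct h) := by
  apply MvPolynomial.algHom_ext
  intro i
  simp only [polyAct, mul_inv_rev, Matrix.SpecialLinearGroup.coe_mul, Matrix.mul_apply,
    Fin.sum_univ_two, MvPolynomial.aeval_X, AlgHom.comp_apply, map_add, map_mul,
    MvPolynomial.algHom_C, MvPolynomial.algebraMap_eq]
  ring

theorem polyAct_mem (m : ℕ) (g : SL(2, ℤ)) (P : MvPolynomial (Fin 2) ℤ)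
    (hP : P ∈ MvPolynomial.homogeneousSubmodule (Fin 2) ℤ m) :
    polyAct g P ∈ MvPolynomial.homogeneousSubmodule (Fin 2) ℤ m := by
  rw [MvPolynomial.mem_homogeneousSubmodule] at hP ⊢
  have := hP.aeval (fun i => ∑ j, MvPolynomial.C ((g⁻¹ : SL(2, ℤ)) i j) * MvPolynomial.X j)
    (n := 1) (fun i => MvPolynomial.IsHomogeneous.sum _ _ _
      fun j _ => MvPolynomial.isHomogeneous_C_mul_X _ _)
  simpa [polyAct] using this

/-- The left action `g P = P ∘ g⁻¹` of `SL₂(ℤ)` on `Sym^m ℤ²`. -/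
def symRep (m : ℕ) : Representation ℤ SL(2, ℤ) (Sym m) where
  toFun g := (polyAct g).toLinearMap.restrict (polyAct_mem m g)
  map_one' := by
    ext P
    simp [polyAct_one, LinearMap.restrict_apply]
  map_mul' g h := by
    apply LinearMap.ext
    intro P
    apply Subtype.ext
    exact DFunLike.congr_fun (polyAct_mul g h) (P : MvPolynomial (Fin 2) ℤ)

/-- The monomial `x^w y^(m-w)` of `Sym^m ℤ²` (and `0` if `w > m`). -/
def monomial (m w : ℕ) : Sym m :=
  if h : w ≤ m then
    ⟨MvPolynomial.X 0 ^ w * MvPolynomial.X 1 ^ (m - w), by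
      rw [MvPolynomial.mem_homogeneousSubmodule]
      have := ((MvPolynomial.isHomogeneous_X ℤ (0 : Fin 2)).pow w).mul
        ((MvPolynomial.isHomogeneous_X ℤ (1 : Fin 2)).pow (m - w))
      simpa [Nat.add_sub_cancel' h] using this⟩
  else 0

/-! ### The modules `𝔹_k` and `𝕄_k` before taking coinvariants -/

/-- `ℙ¹(ℚ)`. -/
abbrev Cusp : Type := OnePoint ℚ

/-- The action of `SL₂(ℤ)` on `ℙ¹(ℚ)` by fractional linear transformations. -/
def cuspAct (g : SL(2, ℤ)) (a : Cusp) : Cusp :=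
  (Matrix.SpecialLinearGroup.mapGL ℚ g : GL (Fin 2) ℚ) • a

theorem cuspAct_one : cuspAct 1 = id := by
  funext a
  simp [cuspAct]

theorem cuspAct_mul (g h : SL(2, ℤ)) : cuspAct (g * h) = cuspAct g ∘ cuspAct h := by
  funext a
  simp [cuspAct, mul_smul]

/-- `𝔹₂`: the free abelian group on the symbols `{a}`, `a ∈ ℙ¹(ℚ)`. -/
abbrev B2 : Type := Cusp →₀ ℤ

/-- The action `g {a} = {g a}` on `𝔹₂`. -/
def b2Rep : Representation ℤ SL(2, ℤ) B2 where
  toFun g := Finsupp.lmapDomain ℤ ℤ (cuspAct g)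
  map_one' := by
    rw [cuspAct_one]; exact Finsupp.lmapDomain_id ℤ ℤ
  map_mul' g h := by
    rw [cuspAct_mul]; exact Finsupp.lmapDomain_comp ℤ ℤ _ _

/-- The free abelian group on the symbols `{a, b}`. -/
abbrev FreeSymbols : Type := Cusp × Cusp →₀ ℤ

/-- The subgroup generated by all `{a,b} + {b,c} + {c,a}`. -/
def triangleRel : Submodule ℤ FreeSymbols :=
  Submodule.span ℤ (Set.range fun t : Cusp × Cusp × Cusp =>
    Finsupp.single (t.1, t.2.1) (1 : ℤ) + Finsupp.single (t.2.1, t.2.2) (1 : ℤ) +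
      Finsupp.single (t.2.2, t.1) (1 : ℤ))

/-- `𝕄₂`: the symbols `{a, b}` modulo the three-term relations and modulo torsion. -/
abbrev M2 : Type := FreeSymbols ⧸ zSaturation triangleRel

/-- The class `{a, b}` in `𝕄₂`. -/
def symbol (a b : Cusp) : M2 := Submodule.Quotient.mk (Finsupp.single (a, b) (1 : ℤ))

/-- The action on the free group on the symbols `{a, b}`. -/
def freeAct (g : SL(2, ℤ)) : FreeSymbols →ₗ[ℤ] FreeSymbols :=
  Finsupp.lmapDomain ℤ ℤ (Prod.map (cuspAct g) (cuspAct g))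

theorem triangleRel_le (g : SL(2, ℤ)) : triangleRel ≤ triangleRel.comap (freeAct g) := by
  rw [triangleRel, Submodule.span_le]
  rintro _ ⟨⟨a, b, c⟩, rfl⟩
  refine Submodule.subset_span ⟨(cuspAct g a, cuspAct g b, cuspAct g c), ?_⟩
  simp [freeAct, Finsupp.mapDomain_add, Finsupp.mapDomain_single]

/-- The action `g {a, b} = {g a, g b}` on `𝕄₂`. -/
def m2Rep : Representation ℤ SL(2, ℤ) M2 where
  toFun g := Submodule.mapQ _ _ (freeAct g) (zSaturation_le_comap _ (triangleRel_le g))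
  map_one' := by
    apply Submodule.linearMap_qext
    ext p
    simp [freeAct, cuspAct_one]
  map_mul' g h := by
    apply Submodule.linearMap_qext
    ext p
    simp [freeAct, cuspAct_mul, Prod.map]

theorem m2Rep_symbol (g : SL(2, ℤ)) (a b : Cusp) :
    m2Rep g (symbol a b) = symbol (cuspAct g a) (cuspAct g b) := by
  simp [m2Rep, symbol, freeAct, Finsupp.mapDomain_single]

/-- `𝔹_k = Sym^(k-2) ℤ² ⊗ 𝔹₂`. -/
abbrev Bk (k : ℕ) : Type := Sym (k - 2) ⊗[ℤ] B2

/-- `𝕄_k = Sym^(k-2) ℤ² ⊗ 𝕄₂`. -/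
abbrev Mk (k : ℕ) : Type := Sym (k - 2) ⊗[ℤ] M2

/-- The action `g (v ⊗ {a}) = g v ⊗ {g a}` on `𝔹_k`. -/
def bkRep (k : ℕ) : Representation ℤ SL(2, ℤ) (Bk k) := (symRep (k - 2)).tprod b2Rep

/-- The action `g (v ⊗ {a, b}) = g v ⊗ {g a, g b}` on `𝕄_k`. -/
def mkRep (k : ℕ) : Representation ℤ SL(2, ℤ) (Mk k) := (symRep (k - 2)).tprod m2Rep

/-- `{a, b} ↦ {a} - {b}` on the free group on the symbols. -/
def freeBoundary : FreeSymbols →ₗ[ℤ] B2 :=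
  Finsupp.lmapDomain ℤ ℤ Prod.fst - Finsupp.lmapDomain ℤ ℤ Prod.snd

theorem zSaturation_le_ker : zSaturation triangleRel ≤ LinearMap.ker freeBoundary := by
  have h : triangleRel ≤ LinearMap.ker freeBoundary := by
    rw [triangleRel, Submodule.span_le]
    rintro _ ⟨⟨a, b, c⟩, rfl⟩
    simp only [SetLike.mem_coe, LinearMap.mem_ker, freeBoundary, LinearMap.sub_apply,
      Finsupp.lmapDomain_apply, Finsupp.mapDomain_add, Finsupp.mapDomain_single]
    abel
  rintro x ⟨N, hN, hx⟩
  have h0 := h hx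
  rw [LinearMap.mem_ker, map_zsmul] at h0
  exact (smul_eq_zero.mp h0).resolve_left hN

/-- `∂ : 𝕄₂ → 𝔹₂`, `{a, b} ↦ {a} - {b}`. -/
def boundary2 : M2 →ₗ[ℤ] B2 := Submodule.liftQ _ freeBoundary zSaturation_le_ker

theorem boundary2_symbol (a b : Cusp) :
    boundary2 (symbol a b) = Finsupp.single a 1 - Finsupp.single b 1 := by
  simp [boundary2, symbol, freeBoundary, Finsupp.mapDomain_single]

theorem boundary2_equivariant (g : SL(2, ℤ)) : boundary2 ∘ₗ m2Rep g = b2Rep g ∘ₗ boundary2 := by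
  apply Submodule.linearMap_qext
  apply Finsupp.lhom_ext'
  rintro ⟨a, b⟩
  apply LinearMap.ext_ring
  change boundary2 (m2Rep g (symbol a b)) = b2Rep g (boundary2 (symbol a b))
  rw [m2Rep_symbol, boundary2_symbol, boundary2_symbol, map_sub]
  simp [b2Rep, Finsupp.mapDomain_single]

/-- `∂ : 𝕄_k → 𝔹_k`, `v ⊗ {a, b} ↦ v ⊗ {a} - v ⊗ {b}`. -/
def boundaryK (k : ℕ) : Mk k →ₗ[ℤ] Bk k := LinearMap.lTensor (Sym (k - 2)) boundary2

theorem boundaryK_equivariant (k : ℕ) (g : SL(2, ℤ)) :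
    boundaryK k ∘ₗ mkRep k g = bkRep k g ∘ₗ boundaryK k := by
  apply TensorProduct.ext'
  intro P x
  have h : boundary2 (m2Rep g x) = b2Rep g (boundary2 x) :=
    LinearMap.congr_fun (boundary2_equivariant g) x
  change symRep (k - 2) g P ⊗ₜ[ℤ] boundary2 (m2Rep g x) =
    symRep (k - 2) g P ⊗ₜ[ℤ] b2Rep g (boundary2 x)
  rw [h]

/-! ### Coinvariants and characters -/

section Coinvariants

variable {V W : Type} [AddCommGroup V] [AddCommGroup W]

/-- The restriction of a representation of `SL₂(ℤ)` to a subgroup. -/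
abbrev res (ρ : Representation ℤ SL(2, ℤ) V) (Γ : Subgroup SL(2, ℤ)) : Representation ℤ Γ V :=
  MonoidHom.comp ρ Γ.subtype

/-- The `Γ`-coinvariants `V_Γ = V / ⟨γ x - x⟩` of a representation of `SL₂(ℤ)`. -/
abbrev Coinv (ρ : Representation ℤ SL(2, ℤ) V) (Γ : Subgroup SL(2, ℤ)) : Type :=
  Representation.Coinvariants (res ρ Γ)

/-- The class of an element of `V` in `V_Γ`. -/
def coinvMk (ρ : Representation ℤ SL(2, ℤ) V) (Γ : Subgroup SL(2, ℤ)) : V →ₗ[ℤ] Coinv ρ Γ :=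
  Representation.Coinvariants.mk (res ρ Γ)

/-- The map `V_Γ → W_Γ` induced by an equivariant map. -/
def coinvMap {ρ : Representation ℤ SL(2, ℤ) V} {ρ' : Representation ℤ SL(2, ℤ) W}
    (Γ : Subgroup SL(2, ℤ)) (f : V →ₗ[ℤ] W) (hf : ∀ g, f ∘ₗ ρ g = ρ' g ∘ₗ f) :
    Coinv ρ Γ →ₗ[ℤ] Coinv ρ' Γ :=
  Representation.Coinvariants.lift (res ρ Γ) (coinvMk ρ' Γ ∘ₗ f) (by
    intro γ
    apply LinearMap.ext
    intro x
    have h1 : f (ρ γ x) = ρ' γ (f x) := LinearMap.congr_fun (hf γ) x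
    have h2 := Representation.Coinvariants.mk_self_apply (res ρ' Γ) γ (f x)
    change Representation.Coinvariants.mk (res ρ' Γ) (f (ρ γ x)) = _
    rw [h1]
    exact h2)

theorem coinvMap_mk {ρ : Representation ℤ SL(2, ℤ) V} {ρ' : Representation ℤ SL(2, ℤ) W}
    (Γ : Subgroup SL(2, ℤ)) (f : V →ₗ[ℤ] W) (hf : ∀ g, f ∘ₗ ρ g = ρ' g ∘ₗ f) (x : V) :
    coinvMap Γ f hf (coinvMk ρ Γ x) = coinvMk ρ' Γ (f x) := by
  rfl

variable {K : Type} [Field K] (O : Subalgebra ℤ K) {Γ Γ' : Subgroup SL(2, ℤ)}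
  [(Γ.subgroupOf Γ').Normal] (ε : Γ' ⧸ Γ.subgroupOf Γ' →* Kˣ)

/-- The `O`-submodule of `O ⊗ V_Γ` generated by all `γ' x - ε(γ') x`, for `γ' ∈ Γ'`. Here `c` is the
element `ε(γ')` of `K`, regarded as an element of the subring `O` in which it lies. -/
def epsRel (ρ : Representation ℤ SL(2, ℤ) V) : Submodule O (O ⊗[ℤ] Coinv ρ Γ) :=
  Submodule.span O {z | ∃ (γ' : Γ') (x : V) (c : O), (c : K) = (ε (γ' : Γ' ⧸ Γ.subgroupOf Γ') : K) ∧
    z = (1 : O) ⊗ₜ[ℤ] coinvMk ρ Γ (ρ γ' x) - c ⊗ₜ[ℤ] coinvMk ρ Γ x}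

/-- The quotient of `O ⊗ V_Γ` by the relations `γ' x = ε(γ') x` and by all `ℤ`-torsion. -/
abbrev EpsCoinv (ρ : Representation ℤ SL(2, ℤ) V) : Type :=
  (O ⊗[ℤ] Coinv ρ Γ) ⧸ zSaturation (epsRel O ε ρ)

/-- The class of `1 ⊗ x` for `x ∈ V`. -/
def epsMk (ρ : Representation ℤ SL(2, ℤ) V) (x : V) : EpsCoinv O ε ρ :=
  Submodule.Quotient.mk ((1 : O) ⊗ₜ[ℤ] coinvMk ρ Γ x)

theorem epsRel_le {ρ : Representation ℤ SL(2, ℤ) V} {ρ' : Representation ℤ SL(2, ℤ) W}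
    (f : V →ₗ[ℤ] W) (hf : ∀ g, f ∘ₗ ρ g = ρ' g ∘ₗ f) :
    epsRel O ε ρ ≤ (epsRel O ε ρ').comap ((coinvMap Γ f hf).baseChange O) := by
  rw [epsRel, Submodule.span_le]
  rintro _ ⟨γ', x, c, hc, rfl⟩
  have h1 : f (ρ γ' x) = ρ' γ' (f x) := LinearMap.congr_fun (hf γ') x
  refine Submodule.subset_span ⟨γ', f x, c, hc, ?_⟩
  simp [coinvMap_mk, h1]

/-- The map induced by an equivariant map on the quotients above. -/
def epsMap {ρ : Representation ℤ SL(2, ℤ) V} {ρ' : Representation ℤ SL(2, ℤ) W}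
    (f : V →ₗ[ℤ] W) (hf : ∀ g, f ∘ₗ ρ g = ρ' g ∘ₗ f) : EpsCoinv O ε ρ →ₗ[O] EpsCoinv O ε ρ' :=
  Submodule.mapQ _ _ ((coinvMap Γ f hf).baseChange O) (zSaturation_le_comap _ (epsRel_le O ε f hf))

theorem epsMap_mk {ρ : Representation ℤ SL(2, ℤ) V} {ρ' : Representation ℤ SL(2, ℤ) W}
    (f : V →ₗ[ℤ] W) (hf : ∀ g, f ∘ₗ ρ g = ρ' g ∘ₗ f) (x : V) :
    epsMap O ε f hf (epsMk O ε ρ x) = epsMk O ε ρ' (f x) := by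
  simp [epsMap, epsMk, coinvMap_mk]

end Coinvariants

section Spaces

variable {K : Type} [Field K]

/-- The ring `ℤ[ζ]`. -/
abbrev ZAdjoin (ζ : K) : Subalgebra ℤ K := Algebra.adjoin ℤ {ζ}

variable (ζ : K) {Γ Γ' : Subgroup SL(2, ℤ)} [(Γ.subgroupOf Γ').Normal]
  (ε : Γ' ⧸ Γ.subgroupOf Γ' →* Kˣ) (k : ℕ)

/-- `𝕄_k(Γ, ε)`, a `ℤ[ζ]`-module. -/
abbrev ModularSymbols : Type := EpsCoinv (ZAdjoin ζ) ε (mkRep k)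

/-- `𝔹_k(Γ, ε)`, a `ℤ[ζ]`-module. -/
abbrev BoundarySymbols : Type := EpsCoinv (ZAdjoin ζ) ε (bkRep k)

/-- The boundary map `∂ : 𝕄_k(Γ, ε) → 𝔹_k(Γ, ε)`. -/
def boundary : ModularSymbols ζ ε k →ₗ[ZAdjoin ζ] BoundarySymbols ζ ε k :=
  epsMap (ZAdjoin ζ) ε (boundaryK k) (boundaryK_equivariant k)

/-- The cuspidal modular symbols `𝕊_k(Γ, ε)`, the kernel of the boundary map. -/
def cuspidal : Submodule (ZAdjoin ζ) (ModularSymbols ζ ε k) := LinearMap.ker (boundary ζ ε k)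

/-- `c_ε(Γ)`, the dimension of `𝔹₂(Γ, ε)` (after extending scalars from `ℤ[ζ]` to the field). -/
def epsCuspCount : ℕ := Module.finrank K (K ⊗[ZAdjoin ζ] BoundarySymbols ζ ε 2)

/-- The Manin symbol `[P, g] = g (P ⊗ {0, ∞})` in `𝕄_k(Γ, ε)`. -/
def maninSymbol (P : Sym (k - 2)) (g : SL(2, ℤ)) : ModularSymbols ζ ε k :=
  epsMk (ZAdjoin ζ) ε (mkRep k) (mkRep k g (P ⊗ₜ[ℤ] symbol ((0 : ℚ) : Cusp) OnePoint.infty))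

end Spaces

/-! ### Coset representatives and `CosetIndex` -/

/-- `R` is a list of representatives for the right cosets `Γ \ SL₂(ℤ)`. -/
def IsCosetReps (Γ : Subgroup SL(2, ℤ)) (R : List SL(2, ℤ)) : Prop :=
  ∀ x : SL(2, ℤ), ∃! i : Fin R.length, x * (R.get i)⁻¹ ∈ Γ

open Classical in
/-- `CosetIndex(x, R, Γ)`: the index `i`, counted from `0`, with `x ∈ Γ · R[i]`. -/
def cosetIndex (Γ : Subgroup SL(2, ℤ)) (R : List SL(2, ℤ)) (x : SL(2, ℤ)) : ℕ :=
  R.findIdx fun r => decide (x * r⁻¹ ∈ Γ)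

/-! ### Algorithms that use `CosetIndex` -/

/-- The four entries `(a, b, c, d)` of a matrix. -/
abbrev Mat : Type := ℤ × ℤ × ℤ × ℤ

/-- The matrix of `g` as a finite datum. -/
def entries (g : SL(2, ℤ)) : Mat := (g 0 0, g 0 1, g 1 0, g 1 1)

/-- The input `(k, n, R, R', s)` of an algorithm: the weight, the order of the character, coset
representatives for `Γ` and for `Γ'`, and a table of pairs `(γ', e)`, with `γ'` running
through representatives of `Γ' / Γ` and `ε(γ') = ζ^e`. -/
abbrev Input : Type := ℕ × ℕ × List Mat × List Mat × List (Mat × ℕ)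

/-- A request to evaluate `CosetIndex(x, R, Γ)` (tag `false`) or `CosetIndex(x, R', Γ')`
(tag `true`). -/
abbrev Query : Type := Bool × Mat

/-- The output of an algorithm: a list of formal linear combinations; a term `(c, w, j)` stands for
`(c₀ + c₁ ζ + c₂ ζ² + ⋯) · [x^w y^(k-2-w), R'[j]]`. -/
abbrev Output : Type := List (List (List ℤ × ℕ × ℕ))

/-- An algorithm with access to `CosetIndex`: a partial recursive procedure which computes, from the
input and the list of the answers to all earlier `CosetIndex` calls, either the next call or the
output. -/
structure CosetAlgorithm where
  step : Input × List ℕ →. Query ⊕ Output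
  partrec : Partrec step

/-- `i` is the correct answer to the query `q`. -/
def IsAnswer (Γ Γ' : Subgroup SL(2, ℤ)) (R R' : List SL(2, ℤ)) (q : Query) (i : ℕ) : Prop :=
  ∃ x : SL(2, ℤ), entries x = q.2 ∧ i = if q.1 then cosetIndex Γ' R' x else cosetIndex Γ R x

/-- On the input `inp`, with `CosetIndex` calls answered according to `answer`, the algorithm halts
with output `out` after exactly `t` calls of `CosetIndex`. -/
def CosetAlgorithm.HaltsWith (A : CosetAlgorithm) (answer : Query → ℕ → Prop) (inp : Input)
    (out : Output) (t : ℕ) : Prop :=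
  ∃ h : List ℕ, h.length = t ∧
    (∀ i : Fin h.length, ∃ q : Query,
      Sum.inl q ∈ A.step (inp, h.take i) ∧ answer q (h.get i)) ∧
    Sum.inr out ∈ A.step (inp, h)

/-- The finite datum given to an algorithm. -/
def encodeInput {Γ' : Subgroup SL(2, ℤ)} (k n : ℕ) (R R' : List SL(2, ℤ)) (s : List (Γ' × ℕ)) :
    Input :=
  (k, n, R.map entries, R'.map entries, s.map fun p => (entries p.1, p.2))

section Output

variable {K : Type} [Field K] (ζ : K) {Γ Γ' : Subgroup SL(2, ℤ)} [(Γ.subgroupOf Γ').Normal]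
  (ε : Γ' ⧸ Γ.subgroupOf Γ' →* Kˣ) (k : ℕ)

/-- `s` lists exactly one representative `γ'` of each element of `Γ' / Γ`, each together with an
exponent `e` such that `ε(γ') = ζ^e`. -/
def IsCharTable (s : List (Γ' × ℕ)) : Prop :=
  (∀ q : Γ' ⧸ Γ.subgroupOf Γ', ∃! i : Fin s.length,
    ((s.get i).1 : Γ' ⧸ Γ.subgroupOf Γ') = q) ∧
  ∀ p ∈ s, (ε (p.1 : Γ' ⧸ Γ.subgroupOf Γ') : K) = ζ ^ p.2

/-- The element `c₀ + c₁ ζ + c₂ ζ² + ⋯` of `ℤ[ζ]`. -/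
def evalCoeff (c : List ℤ) : ZAdjoin ζ :=
  c.foldr (fun a z => (a : ZAdjoin ζ) + ⟨ζ, Algebra.self_mem_adjoin_singleton ℤ ζ⟩ * z) 0

/-- The element of `𝕄_k(Γ, ε)` that a formal linear combination stands for. -/
def evalCombination (R' : List SL(2, ℤ)) (l : List (List ℤ × ℕ × ℕ)) : ModularSymbols ζ ε k :=
  (l.map fun t => evalCoeff ζ t.1 •
    maninSymbol ζ ε k (monomial (k - 2) t.2.1) (R'.getD t.2.2 1)).sum

/-- The elements listed in `out` lie in `𝕊_k(Γ, ε)` and they form, in this order, a basis of the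
vector space `K ⊗ 𝕊_k(Γ, ε)`. -/
def IsCuspidalBasis (R' : List SL(2, ℤ)) (out : Output) : Prop :=
  ∃ b : Module.Basis (Fin out.length) K (K ⊗[ZAdjoin ζ] cuspidal ζ ε k),
    ∀ i, ∃ x : cuspidal ζ ε k, b i = (1 : K) ⊗ₜ[ZAdjoin ζ] x ∧
      (x : ModularSymbols ζ ε k) = evalCombination ζ ε k R' (out.get i)

end Output

end ModSym

end

/-! The groups enter the computation only through the right action of `S` and `T` on the cosets `Γ'
\ SL₂(ℤ)` and the character values that this action produces. For each representative `r` and `X =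
S, T`, one call gives the index `l` of the `Γ'`-coset of `r X`, and a second call gives the
`Γ`-coset of `r X R'[l]⁻¹ ∈ Γ'`, whose exponent is read off by comparison with the `Γ`-indices of
the table. Together with the calls for the table these are at most `5 [SL₂(ℤ) : Γ]` calls
(`query_count_le`), so the other term of the bound is not needed. The remaining work is linear
algebra without calls and without a time limit. It is done by searching for a certificate, which
requires that correct certificates exist, that they imply the claim, and that correctness is a
primitive recursive test.

Let `N` be the length of `R'`, `M = N (k - 1)`, and let `s`, `t` be the `M × M` matrices (`actMat`)
of right translation by `S`, `T` on families that are `ε`-equivariant under `Γ'`. Such families are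
freely determined by their values at pairs of a monomial and a representative (`exists_family`,
`IsEquivariant.eq_zero`). Over the field, `𝕄_k(Γ, ε)` is the space of vectors of length `M` modulo
the images of `1 + s` and `1 + ts + (ts)²`, `𝔹_k(Γ, ε)` is the same space modulo the images of `1 -
t` and `1 - s²`, and `∂` is induced by `s - 1`. What is used of these presentations is that the
relations hold, that Manin symbols generate, and that every functional on vectors which kills the
relations comes from the module. For `𝔹_k` the last point holds because the stabilizer of `∞` is `±
T^n` (`exists_hom_of_cusp_relations`). For `𝕄_k` it is Manin's theorem
(`exists_hom_of_manin_relations`), which rests on `potential_mul_S`: a function with the two-term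
and three-term relations is the difference of a function of cusps, constructed by the Euclidean
algorithm.

A certificate consists of the columns `o` of the proposed basis, dual functionals `φ`, and witnesses
that the columns are cycles and that they span modulo relations (`exists_certificate`,
`exists_basis_of_certificate`). Its entries are integral polynomials, to be evaluated at `ζ`.
Vanishing at `ζ` is divisibility by `X^n - 1` after multiplication by `imprimitivePoly n`
(`aeval_eq_zero_iff`). The quotients belong to the certificate, and the resulting polynomial
identities are tested at sufficiently many integers (`isPolyCertificate_iff`). -/

namespace ModSym

/-! ### Primitive recursive functions with integer values -/

section Primrec

variable {α : Type*} [Primcodable α]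

/-- In the encoding of `ℤ`, the integer `n ≥ 0` has code `2n` and `-(n + 1)` has code `2n + 1`; so
the parity of the code gives the sign. -/
theorem primrec_int_ofNat : Primrec (fun n : ℕ => (n : ℤ)) := by
  refine Primrec.encode_iff.mp (Primrec.nat_double.of_eq fun n => ?_)
  rfl

theorem primrec_int_negSucc : Primrec Int.negSucc := by
  refine Primrec.encode_iff.mp (Primrec.nat_double_succ.of_eq fun n => ?_)
  rfl

theorem primrec_int_toNat : Primrec Int.toNat := by
  have h : Primrec fun x : ℤ => cond (Nat.bodd (Encodable.encode x)) 0
      (Nat.div2 (Encodable.encode x)) :=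
    Primrec.cond (Primrec.nat_bodd.comp Primrec.encode) (Primrec.const 0)
      (Primrec.nat_div2.comp Primrec.encode)
  refine h.of_eq fun x => ?_
  cases x with
  | ofNat n =>
    rw [Int.ofNat_eq_natCast]
    have : Encodable.encode (n : ℤ) = 2 * n := rfl
    simp [this, Nat.div2_val]
  | negSucc n =>
    have : Encodable.encode (Int.negSucc n) = 2 * n + 1 := rfl
    simp [this]

theorem primrec_int_toNat_neg : Primrec fun x : ℤ => (-x).toNat := by
  have h : Primrec fun x : ℤ => cond (Nat.bodd (Encodable.encode x))
      (Nat.succ (Nat.div2 (Encodable.encode x))) 0 :=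
    Primrec.cond (Primrec.nat_bodd.comp Primrec.encode)
      (Primrec.succ.comp (Primrec.nat_div2.comp Primrec.encode)) (Primrec.const 0)
  refine h.of_eq fun x => ?_
  cases x with
  | ofNat n =>
    rw [Int.ofNat_eq_natCast]
    have : Encodable.encode (n : ℤ) = 2 * n := rfl
    simp [this]
  | negSucc n =>
    have : Encodable.encode (Int.negSucc n) = 2 * n + 1 := rfl
    simp [this, Nat.div2_val]

theorem primrec_int_subNat : Primrec₂ fun a b : ℕ => (a : ℤ) - b := by
  have h : Primrec fun p : ℕ × ℕ => if p.2 ≤ p.1 then ((p.1 - p.2 : ℕ) : ℤ)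
      else Int.negSucc (p.2 - p.1 - 1) :=
    Primrec.ite (Primrec.nat_le.comp Primrec.snd Primrec.fst)
      (primrec_int_ofNat.comp (Primrec.nat_sub.comp Primrec.fst Primrec.snd))
      (primrec_int_negSucc.comp (Primrec.nat_sub.comp
        (Primrec.nat_sub.comp Primrec.snd Primrec.fst) (Primrec.const 1)))
  refine h.of_eq fun p => ?_
  split_ifs with hp
  · push_cast [hp]; ring
  · change Int.negSucc _ = (p.1 : ℤ) - p.2
    rw [Int.negSucc_eq]; omega

/-- Writing integers as differences of their positive and negative parts reduces ring operations to
operations on `ℕ` and a single subtraction. -/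
theorem primrec_int_add : Primrec₂ fun a b : ℤ => a + b := by
  have h : Primrec fun p : ℤ × ℤ =>
      ((p.1.toNat + p.2.toNat : ℕ) : ℤ) - ((-p.1).toNat + (-p.2).toNat : ℕ) :=
    primrec_int_subNat.comp
      (Primrec.nat_add.comp (primrec_int_toNat.comp Primrec.fst)
        (primrec_int_toNat.comp Primrec.snd))
      (Primrec.nat_add.comp (primrec_int_toNat_neg.comp Primrec.fst)
        (primrec_int_toNat_neg.comp Primrec.snd))
  exact h.of_eq fun p => by push_cast; omega

theorem primrec_int_neg : Primrec fun a : ℤ => -a := by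
  have h : Primrec fun p : ℤ => (((-p).toNat : ℕ) : ℤ) - (p.toNat : ℕ) :=
    primrec_int_subNat.comp primrec_int_toNat_neg primrec_int_toNat
  exact h.of_eq fun p => by omega

theorem primrec_int_mul : Primrec₂ fun a b : ℤ => a * b := by
  have h : Primrec fun p : ℤ × ℤ =>
      ((p.1.toNat * p.2.toNat + (-p.1).toNat * (-p.2).toNat : ℕ) : ℤ) -
        (p.1.toNat * (-p.2).toNat + (-p.1).toNat * p.2.toNat : ℕ) :=
    have h1 : Primrec fun p : ℤ × ℤ => p.1.toNat := primrec_int_toNat.comp Primrec.fst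
    have h2 : Primrec fun p : ℤ × ℤ => p.2.toNat := primrec_int_toNat.comp Primrec.snd
    have h3 : Primrec fun p : ℤ × ℤ => (-p.1).toNat := primrec_int_toNat_neg.comp Primrec.fst
    have h4 : Primrec fun p : ℤ × ℤ => (-p.2).toNat := primrec_int_toNat_neg.comp Primrec.snd
    primrec_int_subNat.comp
      (Primrec.nat_add.comp (Primrec.nat_mul.comp h1 h2) (Primrec.nat_mul.comp h3 h4))
      (Primrec.nat_add.comp (Primrec.nat_mul.comp h1 h4) (Primrec.nat_mul.comp h3 h2))
  refine h.of_eq fun p => ?_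
  have e1 : p.1 = (p.1.toNat : ℤ) - (-p.1).toNat := by omega
  have e2 : p.2 = (p.2.toNat : ℤ) - (-p.2).toNat := by omega
  conv_rhs => rw [e1, e2]
  push_cast
  generalize (p.1.toNat : ℤ) = a, (p.2.toNat : ℤ) = b
  generalize ((-p.1).toNat : ℤ) = c, ((-p.2).toNat : ℤ) = d
  ring

theorem primrec_int_sub : Primrec₂ fun a b : ℤ => a - b :=
  (primrec_int_add.comp Primrec.fst (primrec_int_neg.comp Primrec.snd)).of_eq fun p => by
    simp [sub_eq_add_neg]

theorem Primrec.int_sum {f : α → ℕ → ℤ} {n : α → ℕ} (hf : Primrec₂ f) (hn : Primrec n) :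
    Primrec fun a => ∑ i ∈ Finset.range (n a), f a i := by
  have h : Primrec fun a => Nat.rec (motive := fun _ => ℤ) 0 (fun i s => s + f a i) (n a) :=
    Primrec.nat_rec' hn (Primrec.const 0) (h := fun a p => p.2 + f a p.1)
      (primrec_int_add.comp (Primrec.snd.comp Primrec.snd)
        (hf.comp Primrec.fst (Primrec.fst.comp Primrec.snd)))
  refine h.of_eq fun a => ?_
  induction n a with
  | zero => simp
  | succ k ih => rw [Finset.sum_range_succ, ← ih]

theorem Primrec.int_prod {f : α → ℕ → ℤ} {n : α → ℕ} (hf : Primrec₂ f) (hn : Primrec n) :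
    Primrec fun a => ∏ i ∈ Finset.range (n a), f a i := by
  have h : Primrec fun a => Nat.rec (motive := fun _ => ℤ) 1 (fun i s => s * f a i) (n a) :=
    Primrec.nat_rec' hn (Primrec.const 1) (h := fun a p => p.2 * f a p.1)
      (primrec_int_mul.comp (Primrec.snd.comp Primrec.snd)
        (hf.comp Primrec.fst (Primrec.fst.comp Primrec.snd)))
  refine h.of_eq fun a => ?_
  induction n a with
  | zero => simp
  | succ k ih => rw [Finset.prod_range_succ, ← ih]

theorem Primrec.int_pow {f : α → ℤ} {n : α → ℕ} (hf : Primrec f) (hn : Primrec n) :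
    Primrec fun a => f a ^ n a :=
  (Primrec.int_prod (f := fun a _ => f a) (hf.comp Primrec.fst) hn).of_eq fun a => by simp

theorem primrec_factorial : Primrec Nat.factorial := by
  have h : Primrec fun n : ℕ => Nat.rec (motive := fun _ => ℕ) 1 (fun i s => (i + 1) * s) n :=
    Primrec.nat_rec' Primrec.id (Primrec.const 1) (h := fun _ p => (p.1 + 1) * p.2)
      (Primrec.nat_mul.comp (Primrec.succ.comp (Primrec.fst.comp Primrec.snd))
        (Primrec.snd.comp Primrec.snd))
  refine h.of_eq fun n => ?_
  induction n with
  | zero => rfl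
  | succ k ih => rw [Nat.factorial_succ, ← ih]

theorem primrec_choose : Primrec₂ Nat.choose := by
  have h : Primrec fun p : ℕ × ℕ => if p.2 ≤ p.1 then
      p.1.factorial / (p.2.factorial * (p.1 - p.2).factorial) else 0 :=
    Primrec.ite (Primrec.nat_le.comp Primrec.snd Primrec.fst)
      (Primrec.nat_div.comp (primrec_factorial.comp Primrec.fst)
        (Primrec.nat_mul.comp (primrec_factorial.comp Primrec.snd)
          (primrec_factorial.comp (Primrec.nat_sub.comp Primrec.fst Primrec.snd))))
      (Primrec.const 0)
  refine h.of_eq fun p => ?_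
  split_ifs with hp
  · exact (Nat.choose_eq_factorial_div_factorial hp).symm
  · exact (Nat.choose_eq_zero_of_lt (by omega)).symm

/-! ### Square matrices indexed by initial segments of `ℕ` -/

/-- The product of two matrices of size `M` given by functions on `ℕ × ℕ`. -/
def matMul (M : ℕ) (f g : ℕ → ℕ → ℤ) (i j : ℕ) : ℤ := ∑ l ∈ Finset.range M, f i l * g l j

/-- The matrix `f` depends primitive recursively on its entry and on the parameter. -/
def PrimrecMat (f : α → ℕ → ℕ → ℤ) : Prop := Primrec fun p : α × ℕ × ℕ => f p.1 p.2.1 p.2.2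

theorem PrimrecMat.add {f g : α → ℕ → ℕ → ℤ} (hf : PrimrecMat f) (hg : PrimrecMat g) :
    PrimrecMat fun a => f a + g a := primrec_int_add.comp hf hg

theorem PrimrecMat.sub {f g : α → ℕ → ℕ → ℤ} (hf : PrimrecMat f) (hg : PrimrecMat g) :
    PrimrecMat fun a => f a - g a := primrec_int_sub.comp hf hg

theorem PrimrecMat.matMul {M : α → ℕ} {f g : α → ℕ → ℕ → ℤ} (hM : Primrec M)
    (hf : PrimrecMat f) (hg : PrimrecMat g) : PrimrecMat fun a => matMul (M a) (f a) (g a) := by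
  refine Primrec.int_sum (f := fun (p : α × ℕ × ℕ) l => f p.1 p.2.1 l * g p.1 l p.2.2) ?_
    (hM.comp Primrec.fst)
  have ha : Primrec fun q : (α × ℕ × ℕ) × ℕ => q.1.1 := Primrec.fst.comp Primrec.fst
  have hi : Primrec fun q : (α × ℕ × ℕ) × ℕ => q.1.2.1 :=
    Primrec.fst.comp (Primrec.snd.comp Primrec.fst)
  have hj : Primrec fun q : (α × ℕ × ℕ) × ℕ => q.1.2.2 :=
    Primrec.snd.comp (Primrec.snd.comp Primrec.fst)
  exact primrec_int_mul.comp (Primrec.comp hf (ha.pair (hi.pair Primrec.snd)))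
    (Primrec.comp hg (ha.pair (Primrec.snd.pair hj)))

theorem PrimrecMat.diagonal {c : α → ℤ} {d : α → ℕ} (hc : Primrec c) (hd : Primrec d) :
    PrimrecMat fun a i j => if i = j ∧ i < d a then c a else 0 := by
  have hi : Primrec fun q : α × ℕ × ℕ => q.2.1 := Primrec.fst.comp Primrec.snd
  have hj : Primrec fun q : α × ℕ × ℕ => q.2.2 := Primrec.snd.comp Primrec.snd
  exact Primrec.ite ((Primrec.eq.comp hi hj).and (Primrec.nat_lt.comp hi (hd.comp Primrec.fst)))
    (hc.comp Primrec.fst) (Primrec.const 0)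

end Primrec

end ModSym

namespace ModSym

open ModularGroup Matrix Matrix.SpecialLinearGroup

/-! ### Right-invariant functions and potentials on `SL₂(ℤ)` -/

section Potential

variable {A : Type*} [AddCommGroup A]

theorem S_mul_S : S * S = -1 := by decide

theorem TSTS : T * S * T * S = S * T⁻¹ := by
  ext i j; fin_cases i <;> fin_cases j <;> simp [coe_S, coe_T, coe_inv, adjugate_fin_two]

theorem ST_cubed : S * T * (S * T) * (S * T) = -1 := by
  ext i j; fin_cases i <;> fin_cases j <;> simp [coe_S, coe_T]

/-- `S` and `T` generate `SL₂(ℤ)`. For functions of cusps this becomes the connectedness of the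
Farey graph. -/
theorem right_invariant_const {X : Type*} (f : SL(2, ℤ) → X) (hT : ∀ g, f (g * T) = f g)
    (hS : ∀ g, f (g * S) = f g) (g : SL(2, ℤ)) : f g = f 1 := by
  have h : ∀ x ∈ Subgroup.closure ({S, T} : Set SL(2, ℤ)), ∀ g, f (g * x) = f g := by
    intro x hx
    induction hx using Subgroup.closure_induction with
    | mem x hx =>
      rcases hx with rfl | rfl
      · exact hS
      · exact hT
    | one => simp
    | mul x y _ _ hx hy => intro g; rw [← mul_assoc, hy, hx]
    | inv x _ hx => intro g; rw [← hx (g * x⁻¹), inv_mul_cancel_right]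
  have := h g (by rw [SpecialLinearGroup.SL2Z_generators]; trivial) 1
  rwa [one_mul] at this

/-- The matrix `± g T^n` whose lower row `(c, d)` satisfies `0 ≤ d < c`, if `g` has a nonzero
lower left entry. -/
def euclidReduce (g : SL(2, ℤ)) : SL(2, ℤ) :=
  let g₀ := if g 1 0 < 0 then -g else g
  g₀ * T ^ (-(g₀ 1 1 / g₀ 1 0))

theorem mul_T_zpow_apply (g : SL(2, ℤ)) (n : ℤ) :
    (g * T ^ n) 1 0 = g 1 0 ∧ (g * T ^ n) 1 1 = g 1 0 * n + g 1 1 := by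
  constructor <;> simp [coe_mul, coe_T_zpow, Matrix.mul_apply, Fin.sum_univ_two]

theorem mul_S_apply (g : SL(2, ℤ)) : (g * S) 1 0 = g 1 1 ∧ (g * S) 1 1 = -g 1 0 := by
  constructor <;> simp [coe_mul, coe_S, Matrix.mul_apply, Fin.sum_univ_two]

theorem mul_T_apply (g : SL(2, ℤ)) : (g * T) 1 0 = g 1 0 ∧ (g * T) 1 1 = g 1 0 + g 1 1 := by
  simpa using mul_T_zpow_apply g 1

theorem neg_apply' (g : SL(2, ℤ)) (i j : Fin 2) : (-g) i j = -g i j := by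
  simp [coe_neg]

/-- One division step: the reduced matrix has lower row `(|c|, r)` with `r` a remainder modulo
`|c|`, and `S` moves `r` to the lower left. This is what makes the recursion of `potential`
terminate. -/
theorem euclidReduce_lt {g : SL(2, ℤ)} (h : g 1 0 ≠ 0) :
    ((euclidReduce g * S) 1 0).natAbs < (g 1 0).natAbs := by
  rw [(mul_S_apply _).1, euclidReduce]
  set g₀ := if g 1 0 < 0 then -g else g with hg₀
  have h0 : 0 < g₀ 1 0 ∧ (g₀ 1 0).natAbs = (g 1 0).natAbs := by
    rw [hg₀]; split_ifs with hlt
    · rw [neg_apply']; omega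
    · omega
  have h2 : (g₀ * T ^ (-(g₀ 1 1 / g₀ 1 0))) 1 1 = g₀ 1 1 % g₀ 1 0 := by
    rw [(mul_T_zpow_apply _ _).2, Int.emod_def]; ring
  simp only [h2]
  have := Int.emod_nonneg (g₀ 1 1) h0.1.ne'
  have := Int.emod_lt_of_pos (g₀ 1 1) h0.1
  omega

/-- The potential of `v`, a function of the cusp `g ∞`. -/
def potential (v : SL(2, ℤ) → A) (g : SL(2, ℤ)) : A :=
  if h : g 1 0 = 0 then 0 else
    have := euclidReduce_lt h
    potential v (euclidReduce g * S) - v (euclidReduce g)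
termination_by (g 1 0).natAbs

/-- The recursion sees `g` only through `euclidReduce g` and the vanishing of its lower left entry.
Hence invariance under `-1` and `T` need only be checked on the normal form. -/
theorem potential_congr (v : SL(2, ℤ) → A) {g h : SL(2, ℤ)} (h0 : g 1 0 = 0 ↔ h 1 0 = 0)
    (he : g 1 0 ≠ 0 → euclidReduce g = euclidReduce h) : potential v g = potential v h := by
  rw [potential.eq_def v g, potential.eq_def v h]
  by_cases hg : g 1 0 = 0
  · rw [dif_pos hg, dif_pos (h0.mp hg)]
  · rw [dif_neg hg, dif_neg (fun h' => hg (h0.mpr h'))]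
    simp only [he hg]

theorem potential_neg (v : SL(2, ℤ) → A) (g : SL(2, ℤ)) : potential v (-g) = potential v g := by
  refine potential_congr v (by simp [neg_apply']) fun h => ?_
  have h' : g 1 0 ≠ 0 := fun h0 => h (by simp [h0])
  unfold euclidReduce
  rcases lt_or_gt_of_ne h' with h1 | h1
  · rw [if_pos h1, if_neg]; rw [neg_apply']; omega
  · rw [if_neg (not_lt.mpr h1.le), if_pos, neg_neg]; rw [neg_apply']; omega

theorem potential_mul_T (v : SL(2, ℤ) → A) (g : SL(2, ℤ)) :
    potential v (g * T) = potential v g := by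
  refine potential_congr v (by rw [(mul_T_apply g).1]) fun h => ?_
  rw [(mul_T_apply g).1] at h
  have key : ∀ g : SL(2, ℤ), g 1 0 ≠ 0 → (g * T) * T ^ (-((g * T) 1 1 / (g * T) 1 0)) =
      g * T ^ (-(g 1 1 / g 1 0)) := by
    intro g h
    rw [(mul_T_apply g).1, (mul_T_apply g).2, Int.add_ediv_of_dvd_left dvd_rfl, Int.ediv_self h,
      mul_assoc, ← _root_.zpow_one_add]
    congr 2; ring
  unfold euclidReduce
  simp only [(mul_T_apply g).1]
  split_ifs with h1
  · rw [← neg_mul]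
    exact key (-g) (by rw [neg_apply']; omega)
  · exact key g h

/-- A matrix with `0 ≤ d < c` is its own normal form, so the coboundary equation is the defining
recursion. -/
theorem potential_of_reduced (v : SL(2, ℤ) → A) {g : SL(2, ℤ)} (h0 : 0 ≤ g 1 1)
    (h1 : g 1 1 < g 1 0) : potential v (g * S) - potential v g = v g := by
  have hg : g 1 0 ≠ 0 := by omega
  have he : euclidReduce g = g := by
    unfold euclidReduce
    simp only [if_neg (show ¬ g 1 0 < 0 by omega), Int.ediv_eq_zero_of_lt h0 h1, neg_zero,
      zpow_zero, mul_one]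
  rw [potential.eq_def v g, dif_neg hg]
  simp only [he]
  abel

/-- **Manin's presentation.** A function on `SL₂(ℤ)` satisfying the two-term and the three-term
relation is the coboundary of its potential. -/
theorem potential_mul_S (v : SL(2, ℤ) → A) (hS : ∀ g, v g + v (g * S) = 0)
    (hU : ∀ g, v g + v (g * (S * T)) + v (g * (S * T) * (S * T)) = 0) (g : SL(2, ℤ)) :
    potential v (g * S) - potential v g = v g := by
  -- Two applications of the two-term relation, since `S² = -1`.
  have hneg : ∀ g, v (-g) = v g := fun g => by
    have h1 := hS g
    have h2 := hS (g * S)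
    rw [mul_assoc, S_mul_S, mul_neg_one] at h2
    rw [eq_neg_of_add_eq_zero_right h2, ← eq_neg_of_add_eq_zero_left h1]
  have swapS : ∀ g, potential v (g * S * S) - potential v (g * S) = v (g * S) →
      potential v (g * S) - potential v g = v g := fun g h => by
    rw [mul_assoc, S_mul_S, mul_neg_one, potential_neg] at h
    rw [eq_neg_of_add_eq_zero_left (hS g), ← h]; abel
  have swapN : ∀ g, potential v (-g * S) - potential v (-g) = v (-g) →
      potential v (g * S) - potential v g = v g := fun g h => by
    rwa [neg_mul, potential_neg, potential_neg, hneg] at h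
  induction hn : (g 1 0).natAbs + (g 1 1).natAbs using Nat.strong_induction_on generalizing g with
  | _ n ih =>
    -- For a lower row `(c, d)` with `d < 0`, consider the triangle with vertices `g∞`, `gTS∞`,
    -- `gS∞`. The three-term relation splits `v g` as `v (gT) + v (gTST)`. Here `gT` is reduced, and
    -- `gTST` has lower row `(c + d, d)`, with sum of absolute values `c < c + |d|`, so the
    -- induction hypothesis applies to it.
    have main : ∀ g : SL(2, ℤ), (g 1 0).natAbs + (g 1 1).natAbs = n → 0 < g 1 0 →
        -g 1 0 ≤ g 1 1 → g 1 1 < g 1 0 →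
        potential v (g * S) - potential v g = v g := by
      intro g hn hc hd hd'
      by_cases hd0 : 0 ≤ g 1 1
      · exact potential_of_reduced v hd0 hd'
      have h3 := hU (g * S)
      have e1 : g * S * (S * T) = -(g * T) := by
        rw [mul_assoc, ← mul_assoc S S T, S_mul_S]; simp
      have e2 : g * S * (S * T) * (S * T) = -(g * T * S * T) := by
        rw [e1]; simp [mul_assoc]
      rw [e2, e1, hneg, hneg, eq_neg_of_add_eq_zero_right (hS g)] at h3
      have h4 := potential_of_reduced v (g := g * T) (by rw [(mul_T_apply g).2]; omega)
        (by rw [(mul_T_apply g).1, (mul_T_apply g).2]; omega)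
      have h5 := ih _ (by
        simp only [(mul_T_apply _).1, (mul_T_apply _).2, (mul_S_apply _).1, (mul_S_apply _).2]
        omega) (g * T * S * T) rfl
      rw [potential_mul_T, show g * T * S * T * S = g * S * T⁻¹ by
        rw [mul_assoc g S, ← TSTS]; simp [mul_assoc]] at h5
      rw [potential_mul_T] at h4
      have h6 := potential_mul_T v (g * S * T⁻¹)
      rw [inv_mul_cancel_right] at h6
      rw [← h6] at h5
      have h7 : v g = v (g * T) + v (g * T * S * T) := by
        rw [← sub_eq_zero, ← neg_eq_zero, ← h3]; abel
      rw [h7, ← h4, ← h5]; abel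
    have hdet := g.det_coe
    rw [det_fin_two] at hdet
    have hnz : g 1 0 ≠ 0 ∨ g 1 1 ≠ 0 := by
      by_contra! h
      simp [h.1, h.2] at hdet
    have s1 := mul_S_apply g
    have n1 := neg_apply' g
    have s2 := mul_S_apply (-g)
    -- Right multiplication by `S` rotates the lower row by a right angle. The four rotates of the
    -- half-open sector `-c ≤ d < c` cover all nonzero rows.
    by_cases h1 : -(g 1 0) ≤ g 1 1 ∧ g 1 1 < g 1 0
    · exact main g hn (by omega) h1.1 h1.2
    by_cases h2 : g 1 0 ≤ - g 1 1 ∧ - g 1 1 < - g 1 0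
    · exact swapN g (main _ (by rw [n1, n1]; omega) (by rw [n1]; omega)
        (by rw [n1, n1]; omega) (by rw [n1, n1]; omega))
    by_cases h3 : -(g 1 1) ≤ - g 1 0 ∧ - g 1 0 < g 1 1
    · exact swapS g (main _ (by rw [s1.1, s1.2]; omega) (by rw [s1.1]; omega)
        (by rw [s1.1, s1.2]; omega) (by rw [s1.1, s1.2]; omega))
    · exact swapN g (swapS _ (main _ (by rw [s2.1, s2.2, n1, n1]; omega)
        (by rw [s2.1, n1]; omega) (by rw [s2.1, s2.2, n1, n1]; omega)
        (by rw [s2.1, s2.2, n1, n1]; omega)))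

end Potential

end ModSym

namespace ModSym

open ModularGroup Matrix Matrix.SpecialLinearGroup

/-! ### Cusps as cosets of the stabilizer of `∞` -/

section Cusps

theorem cuspAct_mul_apply (g h : SL(2, ℤ)) (a : Cusp) :
    cuspAct (g * h) a = cuspAct g (cuspAct h a) := by
  rw [cuspAct_mul]; rfl

theorem cuspAct_one_apply (a : Cusp) : cuspAct 1 a = a := by
  rw [cuspAct_one]; rfl

theorem cuspAct_infty (g : SL(2, ℤ)) :
    cuspAct g OnePoint.infty = if g 1 0 = 0 then OnePoint.infty else
      (((g 0 0 : ℚ) / (g 1 0 : ℚ) : ℚ) : Cusp) := by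
  rw [cuspAct, OnePoint.smul_infty_eq_ite]
  simp

theorem cuspAct_infty_eq_iff (g : SL(2, ℤ)) :
    cuspAct g OnePoint.infty = OnePoint.infty ↔ g 1 0 = 0 := by
  rw [cuspAct_infty]
  split_ifs with h <;> simp [h]

theorem cuspAct_S_infty : cuspAct S OnePoint.infty = ((0 : ℚ) : Cusp) := by
  rw [cuspAct_infty]
  simp [coe_S]

theorem exists_cuspAct_infty (a : Cusp) : ∃ g : SL(2, ℤ), cuspAct g OnePoint.infty = a := by
  induction a using OnePoint.rec with
  | infty => exact ⟨1, cuspAct_one_apply _⟩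
  | coe q =>
    obtain ⟨g, hg⟩ := IsCoprime.exists_SL2_col (R := ℤ) (a := q.num) (b := q.den)
      (Int.isCoprime_iff_gcd_eq_one.mpr q.reduced) 0
    refine ⟨g, ?_⟩
    have h0 : g 0 0 = q.num := hg.1
    have h1 : g 1 0 = q.den := hg.2
    rw [cuspAct_infty, h0, h1, if_neg (by exact_mod_cast q.den_nz)]
    congr 1
    exact_mod_cast q.num_div_den

/-- The matrix `g⁻¹ h` fixes `∞`, so it is upper triangular with both diagonal entries `1` or both
`-1`. -/
theorem cuspAct_infty_inj {g h : SL(2, ℤ)}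
    (e : cuspAct g OnePoint.infty = cuspAct h OnePoint.infty) :
    ∃ n : ℤ, h = g * T ^ n ∨ h = -(g * T ^ n) := by
  have h1 : (g⁻¹ * h) 1 0 = 0 := by
    rw [← cuspAct_infty_eq_iff, cuspAct_mul_apply, ← e, ← cuspAct_mul_apply, inv_mul_cancel,
      cuspAct_one_apply]
  have had := (g⁻¹ * h).det_coe
  replace had : (g⁻¹ * h) 0 0 * (g⁻¹ * h) 1 1 = 1 := by
    rw [det_fin_two] at had
    simpa [h1] using had
  rcases Int.eq_one_or_neg_one_of_mul_eq_one' had with (⟨ha, hd⟩ | ⟨ha, hd⟩)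
  · refine ⟨(g⁻¹ * h) 0 1, Or.inl (inv_mul_eq_iff_eq_mul.mp ?_)⟩
    generalize g⁻¹ * h = x at *
    ext i j; fin_cases i <;> fin_cases j <;> simp [ha, h1, hd, coe_T_zpow]
  · refine ⟨-(g⁻¹ * h) 0 1, Or.inr ?_⟩
    rw [← mul_neg]
    refine inv_mul_eq_iff_eq_mul.mp ?_
    generalize g⁻¹ * h = x at *
    ext i j; fin_cases i <;> fin_cases j <;> simp [ha, h1, hd, coe_T_zpow]

/-- Cusps are the left cosets of the stabilizer `± T^n` of `∞`. -/
theorem exists_cusp_function {X : Type*} (f : SL(2, ℤ) → X) (hT : ∀ g, f (g * T) = f g)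
    (hN : ∀ g, f (-g) = f g) : ∃ ψ : Cusp → X, ∀ g, ψ (cuspAct g OnePoint.infty) = f g := by
  choose s hs using exists_cuspAct_infty
  refine ⟨fun a => f (s a), fun g => ?_⟩
  have hTn : ∀ (n : ℤ) g, f (g * T ^ n) = f g := by
    intro n
    induction n using Int.induction_on with
    | zero => simp
    | succ n ih => intro g; rw [_root_.zpow_add_one, ← mul_assoc, hT, ih]
    | pred n ih => intro g; rw [_root_.zpow_sub_one, ← mul_assoc, ← hT, inv_mul_cancel_right, ih]
  obtain ⟨n, hn | hn⟩ := cuspAct_infty_inj (hs (cuspAct g OnePoint.infty)).symm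
  · exact (congrArg f hn).trans (hTn n g)
  · exact (congrArg f hn).trans ((hN _).trans (hTn n g))

theorem cuspAct_neg (g : SL(2, ℤ)) (a : Cusp) : cuspAct (-g) a = cuspAct g a := by
  obtain ⟨h, rfl⟩ := exists_cuspAct_infty a
  rw [← cuspAct_mul_apply, ← cuspAct_mul_apply, cuspAct_infty, cuspAct_infty, neg_mul]
  simp

theorem cuspAct_T_infty : cuspAct T OnePoint.infty = OnePoint.infty := by
  rw [cuspAct_infty_eq_iff]; simp [coe_T]

/-- Since `g0 = gS∞`, the hypothesis makes `g ↦ ψ(g∞)` right invariant under both generators. -/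
theorem cusp_function_const {X : Type*} (ψ : Cusp → X)
    (h : ∀ g, ψ (cuspAct g ((0 : ℚ) : Cusp)) = ψ (cuspAct g OnePoint.infty)) (a : Cusp) :
    ψ a = ψ OnePoint.infty := by
  obtain ⟨g, rfl⟩ := exists_cuspAct_infty a
  have := right_invariant_const (fun g => ψ (cuspAct g OnePoint.infty))
    (fun g => by rw [cuspAct_mul_apply, cuspAct_T_infty])
    (fun g => by rw [cuspAct_mul_apply, cuspAct_S_infty, h]) g
  rwa [cuspAct_one_apply] at this

end Cusps

/-! ### Homomorphisms from `𝕄₂` -/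

section M2

variable {A : Type*} [AddCommGroup A]

theorem symbol_add (a b c : Cusp) : symbol a b + symbol b c + symbol c a = 0 := by
  rw [symbol, symbol, symbol, ← Submodule.Quotient.mk_add, ← Submodule.Quotient.mk_add,
    Submodule.Quotient.mk_eq_zero]
  exact ⟨1, one_ne_zero, by rw [one_smul]; exact Submodule.subset_span ⟨(a, b, c), rfl⟩⟩

/-- The three-term relation at `(a, a, a)` only gives `3 {a, a} = 0`; the division by torsion does
the rest. -/
theorem symbol_self (a : Cusp) : symbol a a = 0 := by
  rw [symbol, Submodule.Quotient.mk_eq_zero]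
  refine ⟨3, by norm_num, Submodule.subset_span ⟨(a, a, a), ?_⟩⟩
  simp only [← Finsupp.single_add, Finsupp.smul_single]
  norm_num

theorem symbol_swap (a b : Cusp) : symbol b a = -symbol a b := by
  have := symbol_add a b a
  rw [symbol_self, add_zero] at this
  exact eq_neg_of_add_eq_zero_right this

theorem M2_hom_ext {f g : M2 →ₗ[ℤ] A} (h : ∀ a b, f (symbol a b) = g (symbol a b)) : f = g := by
  apply Submodule.linearMap_qext
  apply Finsupp.lhom_ext'
  rintro ⟨a, b⟩
  apply LinearMap.ext_ring
  exact h a b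

/-- Manin's trick: the difference of the two maps at `{a, ∞}`, as a function of `a`, is constant
along Farey edges and vanishes at `∞`. -/
theorem M2_hom_ext_manin {f g : M2 →ₗ[ℤ] A}
    (h : ∀ x : SL(2, ℤ), f (symbol (cuspAct x ((0 : ℚ) : Cusp)) (cuspAct x OnePoint.infty)) =
      g (symbol (cuspAct x ((0 : ℚ) : Cusp)) (cuspAct x OnePoint.infty))) : f = g := by
  have e : ∀ a b c, symbol a c = symbol a b + symbol b c := fun a b c => by
    rw [eq_comm, ← sub_eq_zero, sub_eq_add_neg, ← symbol_swap, symbol_add]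
  have key : ∀ a, (f - g) (symbol a OnePoint.infty) = 0 := by
    intro a
    rw [cusp_function_const (fun a => (f - g) (symbol a OnePoint.infty)) _ a, symbol_self, map_zero]
    intro x
    have := h x
    rw [← sub_eq_zero, ← LinearMap.sub_apply] at this
    rw [e _ (cuspAct x OnePoint.infty), map_add, this, zero_add]
  apply M2_hom_ext
  intro a b
  rw [← sub_eq_zero, ← LinearMap.sub_apply, e a OnePoint.infty b, map_add, key, symbol_swap b,
    map_neg, key, neg_zero, add_zero]

/-- Differences satisfy the three-term relation, and a torsion-free target does not see the
saturation. -/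
theorem exists_M2_hom [IsAddTorsionFree A] (ψ : Cusp → A) :
    ∃ f : M2 →ₗ[ℤ] A, ∀ a b, f (symbol a b) = ψ a - ψ b := by
  let F : FreeSymbols →ₗ[ℤ] A := Finsupp.linearCombination ℤ fun p => ψ p.1 - ψ p.2
  have hF : zSaturation triangleRel ≤ LinearMap.ker F := by
    have h : triangleRel ≤ LinearMap.ker F := by
      rw [triangleRel, Submodule.span_le]
      rintro _ ⟨⟨a, b, c⟩, rfl⟩
      simp [F]
    rintro x ⟨N, hN, hx⟩
    have h0 := h hx
    rw [LinearMap.mem_ker, map_zsmul] at h0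
    exact (smul_eq_zero.mp h0).resolve_left hN
  exact ⟨Submodule.liftQ _ F hF, fun a b => by simp [symbol, F]⟩

end M2

/-! ### Homomorphisms from the quotients of coinvariants -/

section EpsLift

variable {V : Type} [AddCommGroup V] {K : Type} [Field K] (O : Subalgebra ℤ K)
  {Γ Γ' : Subgroup SL(2, ℤ)} [(Γ.subgroupOf Γ').Normal] (ε : Γ' ⧸ Γ.subgroupOf Γ' →* Kˣ)
  (ρ : Representation ℤ SL(2, ℤ) V)

/-- `epsMk` as a linear map. -/
def epsMkₗ : V →ₗ[ℤ] EpsCoinv O ε ρ where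
  toFun := epsMk O ε ρ
  map_add' x y := by simp [epsMk, TensorProduct.tmul_add]
  map_smul' c x := by
    simp only [epsMk, map_smul, TensorProduct.tmul_smul, RingHom.id_apply]
    rfl

variable {O ε ρ}

theorem epsMk_smul {γ : Γ'} {c : O} (hc : (c : K) = (ε (γ : Γ' ⧸ Γ.subgroupOf Γ') : K)) (x : V) :
    epsMk O ε ρ (ρ γ x) = c • epsMk O ε ρ x := by
  rw [epsMk, epsMk, ← Submodule.Quotient.mk_smul, Submodule.Quotient.eq]
  refine ⟨1, one_ne_zero, ?_⟩
  rw [one_smul]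
  refine Submodule.subset_span ⟨γ, x, c, hc, ?_⟩
  rw [TensorProduct.smul_tmul', smul_eq_mul, mul_one]

theorem span_range_epsMk : Submodule.span O (Set.range (epsMk O ε ρ)) = ⊤ := by
  rw [eq_top_iff]
  rintro z -
  obtain ⟨y, rfl⟩ := Submodule.Quotient.mk_surjective _ z
  induction y using TensorProduct.induction_on with
  | zero => exact Submodule.zero_mem _
  | add a b ha hb => rw [Submodule.Quotient.mk_add]; exact Submodule.add_mem _ ha hb
  | tmul c v =>
    obtain ⟨x, rfl⟩ : ∃ x, coinvMk ρ Γ x = v := Submodule.Quotient.mk_surjective _ v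
    have : c ⊗ₜ[ℤ] coinvMk ρ Γ x = c • ((1 : O) ⊗ₜ[ℤ] coinvMk ρ Γ x) := by
      rw [TensorProduct.smul_tmul', smul_eq_mul, mul_one]
    rw [this, Submodule.Quotient.mk_smul]
    exact Submodule.smul_mem _ _ (Submodule.subset_span ⟨x, rfl⟩)

/-- `ε` is trivial on `Γ`, so `f` descends to the coinvariants; extending scalars to `O`, it kills
the `ε`-relations, and it kills torsion because `K` has characteristic zero. -/
theorem exists_eps_hom [CharZero K] (hΓ : Γ ≤ Γ') (f : V →ₗ[ℤ] K)
    (hf : ∀ (γ : Γ') (x : V), f (ρ γ x) = ε (γ : Γ' ⧸ Γ.subgroupOf Γ') * f x) :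
    ∃ L : EpsCoinv O ε ρ →ₗ[O] K, ∀ x, L (epsMk O ε ρ x) = f x := by
  let f₁ : Coinv ρ Γ →ₗ[ℤ] K := Representation.Coinvariants.lift (res ρ Γ) f (by
    intro γ
    apply LinearMap.ext
    intro x
    have h := hf ⟨γ, hΓ γ.2⟩ x
    have h1 : ((⟨γ, hΓ γ.2⟩ : Γ') : Γ' ⧸ Γ.subgroupOf Γ') = 1 := by
      rw [QuotientGroup.eq_one_iff]
      exact γ.2
    rw [h1, map_one, Units.val_one, one_mul] at h
    exact h)
  have hf₁ : ∀ x, f₁ (coinvMk ρ Γ x) = f x := fun x => rfl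
  let f₂ : O ⊗[ℤ] Coinv ρ Γ →ₗ[O] K := f₁.liftBaseChange O
  have hf₂ : ∀ (c : O) x, f₂ (c ⊗ₜ x) = c * f₁ x := fun c x => by
    simp [f₂, Algebra.smul_def]
  have hker : zSaturation (epsRel O ε ρ) ≤ LinearMap.ker f₂ := by
    have h : epsRel O ε ρ ≤ LinearMap.ker f₂ := by
      rw [epsRel, Submodule.span_le]
      rintro _ ⟨γ, x, c, hc, rfl⟩
      simp only [SetLike.mem_coe, LinearMap.mem_ker, map_sub, hf₂, hf₁, hf, hc]
      simp
    rintro x ⟨N, hN, hx⟩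
    have h0 := h hx
    rw [LinearMap.mem_ker, map_zsmul] at h0
    exact (smul_eq_zero.mp h0).resolve_left hN
  refine ⟨Submodule.liftQ _ f₂ hker, fun x => ?_⟩
  rw [epsMk, Submodule.liftQ_apply, hf₂, hf₁]
  simp

end EpsLift

end ModSym

namespace ModSym

open ModularGroup Matrix Matrix.SpecialLinearGroup

/-! ### Monomials -/

section Monomials

/-- The exponent vector of `x^w y^(m-w)`. -/
noncomputable def expVec (m w : ℕ) : Fin 2 →₀ ℕ := Finsupp.single 0 w + Finsupp.single 1 (m - w)

theorem coe_monomial {m w : ℕ} (h : w ≤ m) :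
    (monomial m w : MvPolynomial (Fin 2) ℤ) = MvPolynomial.X 0 ^ w * MvPolynomial.X 1 ^ (m - w) := by
  rw [monomial, dif_pos h]

theorem coe_monomial_eq {m w : ℕ} (h : w ≤ m) :
    (monomial m w : MvPolynomial (Fin 2) ℤ) = MvPolynomial.monomial (expVec m w) 1 := by
  rw [coe_monomial h, MvPolynomial.X_pow_eq_monomial, MvPolynomial.X_pow_eq_monomial,
    MvPolynomial.monomial_mul, one_mul, expVec]

theorem expVec_inj {m w w' : ℕ} : expVec m w = expVec m w' ↔ w = w' := by
  refine ⟨fun h => ?_, fun h => h ▸ rfl⟩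
  simpa [expVec] using DFunLike.congr_fun h 0

theorem coeff_coe_monomial {m w w' : ℕ} (h : w ≤ m) :
    MvPolynomial.coeff (expVec m w') (monomial m w : MvPolynomial (Fin 2) ℤ) =
      if w = w' then 1 else 0 := by
  rw [coe_monomial_eq h, MvPolynomial.coeff_monomial]
  simp only [expVec_inj]

theorem sym_eq_sum (m : ℕ) (P : Sym m) : P = ∑ w ∈ Finset.range (m + 1),
    MvPolynomial.coeff (expVec m w) (P : MvPolynomial (Fin 2) ℤ) • monomial m w := by
  apply Subtype.ext
  ext s
  rw [Submodule.coe_sum, MvPolynomial.coeff_sum]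
  simp only [Submodule.coe_smul, MvPolynomial.coeff_smul]
  by_cases hs : s.degree = m
  · have hs' : s 0 + s 1 = m := by
      rw [← hs, Finsupp.degree_eq_sum, Fin.sum_univ_two]
    have h0 : s = expVec m (s 0) := by
      ext i; fin_cases i
      · simp [expVec]
      · simp [expVec, ← hs']
    rw [Finset.sum_eq_single (s 0)]
    · nth_rw 3 [h0]
      rw [coeff_coe_monomial (by omega), if_pos rfl, smul_eq_mul, mul_one, ← h0]
    · intro w hw hne
      rw [h0, coeff_coe_monomial (by simpa [Nat.lt_succ_iff] using hw), if_neg (by simpa [expVec] using hne), smul_zero]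
    · intro h; exact absurd (Finset.mem_range.mpr (by omega)) h
  · have hP : ∀ Q : Sym m, MvPolynomial.coeff s (Q : MvPolynomial (Fin 2) ℤ) = 0 := fun Q =>
      ((MvPolynomial.mem_homogeneousSubmodule m _).mp Q.2).coeff_eq_zero hs
    simp [hP]

theorem coe_symRep (m : ℕ) (g : SL(2, ℤ)) (P : Sym m) :
    (symRep m g P : MvPolynomial (Fin 2) ℤ) = polyAct g P := rfl

/-- The coefficients of the action of `S⁻¹` on monomials. -/
def coefS (m w w' : ℕ) : ℤ := if w' = m - w then (-1) ^ w else 0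

/-- The coefficients of the action of `T⁻¹` on monomials. -/
def coefT (w w' : ℕ) : ℤ := w.choose w'

/-- The inverse appears because `translate` acts on polynomials by `X⁻¹`. Here `P ∘ S` is the
substitution `x ↦ -y`, `y ↦ x`. -/
theorem symRep_S_inv {m w : ℕ} (h : w ≤ m) : symRep m S⁻¹ (monomial m w) =
    ∑ w' ∈ Finset.range (m + 1), coefS m w w' • monomial m w' := by
  rw [Finset.sum_eq_single (m - w)]
  · apply Subtype.ext
    rw [coe_symRep, Submodule.coe_smul, coe_monomial h, coe_monomial (Nat.sub_le m w), coefS,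
      if_pos rfl]
    have h2 : m - (m - w) = w := by omega
    simp [polyAct, coe_S, h2, zsmul_eq_mul]
    rw [neg_pow]
    ring
  · intro w' _ hw'
    rw [coefS, if_neg hw', zero_smul]
  · intro h'; exact absurd (Finset.mem_range.mpr (by omega)) h'

/-- The substitution `x ↦ x + y`, `y ↦ y` and the binomial theorem. -/
theorem symRep_T_inv {m w : ℕ} (h : w ≤ m) : symRep m T⁻¹ (monomial m w) =
    ∑ w' ∈ Finset.range (m + 1), coefT w w' • monomial m w' := by
  apply Subtype.ext
  rw [coe_symRep, Submodule.coe_sum, coe_monomial h]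
  simp only [polyAct, inv_inv, coe_T, map_mul, map_pow, MvPolynomial.aeval_X, Fin.sum_univ_two]
  simp only [of_apply, cons_val', cons_val_zero, cons_val_one, cons_val_fin_one, map_one, map_zero,
    one_mul, zero_mul, zero_add]
  rw [add_pow, Finset.sum_mul]
  rw [← Finset.sum_subset (Finset.range_subset_range.mpr (Nat.succ_le_succ h))]
  · refine Finset.sum_congr rfl fun u hu => ?_
    have hu' : u ≤ w := by simpa [Nat.lt_succ_iff] using hu
    rw [Submodule.coe_smul, coe_monomial (hu'.trans h), coefT, zsmul_eq_mul,
      show m - u = (w - u) + (m - w) by omega, pow_add]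
    push_cast
    ring
  · intro u _ hu
    rw [coefT, Nat.choose_eq_zero_of_lt (by simpa using hu)]
    simp

end Monomials

/-! ### Rows with entries in a module -/

section Rows

variable {A B 𝓜 𝓝 : Type*} [CommRing A] [AddCommGroup 𝓜] [Module A 𝓜] [AddCommGroup 𝓝] [Module A 𝓝]
  {M : ℕ}

/-- The product of a row with entries in a module and a matrix. -/
def rowMul (x : Fin M → 𝓜) (a : Matrix (Fin M) (Fin M) A) : Fin M → 𝓜 :=
  fun p => ∑ q, a q p • x q

theorem rowMul_mul (x : Fin M → 𝓜) (a b : Matrix (Fin M) (Fin M) A) :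
    rowMul x (a * b) = rowMul (rowMul x a) b := by
  funext p
  simp only [rowMul, Matrix.mul_apply, Finset.sum_smul, Finset.smul_sum, ← mul_smul]
  rw [Finset.sum_comm]
  simp only [mul_comm]

theorem rowMul_add (x : Fin M → 𝓜) (a b : Matrix (Fin M) (Fin M) A) :
    rowMul x (a + b) = rowMul x a + rowMul x b := by
  funext p
  simp [rowMul, add_smul, Finset.sum_add_distrib]

theorem rowMul_sub (x : Fin M → 𝓜) (a b : Matrix (Fin M) (Fin M) A) :
    rowMul x (a - b) = rowMul x a - rowMul x b := by
  funext p
  simp [rowMul, sub_smul, Finset.sum_sub_distrib]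

theorem rowMul_one (x : Fin M → 𝓜) : rowMul x (1 : Matrix (Fin M) (Fin M) A) = x := by
  funext p
  simp [rowMul, Matrix.one_apply, ite_smul]

theorem zero_rowMul (a : Matrix (Fin M) (Fin M) A) : rowMul (0 : Fin M → 𝓜) a = 0 := by
  funext p
  simp [rowMul]

theorem map_rowMul (f : 𝓜 →ₗ[A] 𝓝) (x : Fin M → 𝓜) (a : Matrix (Fin M) (Fin M) A) (p : Fin M) :
    f (rowMul x a p) = rowMul (fun q => f (x q)) a p := by
  simp [rowMul]

/-- Position `p` in a row stands for the monomial with exponent `p % (d + 1)` and the representative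
number `p / (d + 1)`; the sum is over the block of one representative. -/
theorem sum_fin_block {N d j : ℕ} (hj : j < N) (f : ℕ → 𝓜) :
    (∑ p : Fin (N * (d + 1)), if (p : ℕ) / (d + 1) = j then f (p % (d + 1)) else 0) =
      ∑ w ∈ Finset.range (d + 1), f w := by
  rw [← Equiv.sum_comp finProdFinEquiv, Fintype.sum_prod_type, Finset.sum_eq_single ⟨j, hj⟩]
  · rw [Finset.sum_range]
    refine Finset.sum_congr rfl fun w _ => ?_
    have h1 : ((finProdFinEquiv ((⟨j, hj⟩ : Fin N), w) : Fin _) : ℕ) = w + (d + 1) * j := rfl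
    rw [h1, if_pos, Nat.add_mul_mod_self_left, Nat.mod_eq_of_lt w.2]
    rw [Nat.add_mul_div_left _ _ (Nat.succ_pos d), Nat.div_eq_of_lt w.2, zero_add]
  · intro i _ hi
    refine Finset.sum_eq_zero fun w _ => if_neg ?_
    have h1 : ((finProdFinEquiv (i, w) : Fin _) : ℕ) = w + (d + 1) * i := rfl
    rw [h1, Nat.add_mul_div_left _ _ (Nat.succ_pos d), Nat.div_eq_of_lt w.2, zero_add]
    exact fun h => hi (Fin.ext h)
  · intro h; exact absurd (Finset.mem_univ _) h

end Rows

/-! ### Equivariant families -/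

section Families

variable {K : Type} [Field K] (O : Subalgebra ℤ K)
  {Γ Γ' : Subgroup SL(2, ℤ)} [(Γ.subgroupOf Γ').Normal] (ε : Γ' ⧸ Γ.subgroupOf Γ' →* Kˣ) {d : ℕ}
  {𝓜 𝓝 : Type} [AddCommGroup 𝓜] [Module O 𝓜] [AddCommGroup 𝓝] [Module O 𝓝]

/-- A family of additive maps on `Sym^d ℤ²`, indexed by `SL₂(ℤ)`, on which `Γ'` acts from the left
through `ε`. -/
def IsEquivariant (m : SL(2, ℤ) → Sym d →ₗ[ℤ] 𝓜) : Prop :=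
  ∀ (γ : Γ') (c : O), (c : K) = (ε (γ : Γ' ⧸ Γ.subgroupOf Γ') : K) →
    ∀ g P, m (γ * g) P = c • m g P

/-- The right translate `(P, g) ↦ m(X⁻¹ P, g X)`. -/
noncomputable def translate (X : SL(2, ℤ)) (m : SL(2, ℤ) → Sym d →ₗ[ℤ] 𝓜) : SL(2, ℤ) → Sym d →ₗ[ℤ] 𝓜 :=
  fun g => m (g * X) ∘ₗ symRep d X⁻¹

theorem translate_apply (X : SL(2, ℤ)) (m : SL(2, ℤ) → Sym d →ₗ[ℤ] 𝓜) (g : SL(2, ℤ)) (P : Sym d) :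
    translate X m g P = m (g * X) (symRep d X⁻¹ P) := rfl

/-- Translation is a left action on families, whereas matrices act on rows from the right. Therefore
the matrix of translation by `S * T` is `t * s`, in the opposite order. -/
theorem translate_translate (X Y : SL(2, ℤ)) (m : SL(2, ℤ) → Sym d →ₗ[ℤ] 𝓜) :
    translate X (translate Y m) = translate (X * Y) m := by
  funext g
  apply LinearMap.ext
  intro P
  rw [translate_apply, translate_apply, translate_apply, mul_assoc, _root_.mul_inv_rev, map_mul]
  rfl

/-- The values of a family on the pairs `(x^w y^(d-w), r i)`. -/
noncomputable def row (N : ℕ) (r : ℕ → SL(2, ℤ)) (m : SL(2, ℤ) → Sym d →ₗ[ℤ] 𝓜) : Fin (N * (d + 1)) → 𝓜 :=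
  fun p => m (r (p / (d + 1))) (monomial d (p % (d + 1)))

/-- The matrix of the right translation by an element which maps the representative `i` to the
representative `j i` with factor `z ^ e i`, and monomials according to `coef`. -/
def actMat {A : Type*} [CommRing A] (N d : ℕ) (coef : ℕ → ℕ → ℤ) (j e : ℕ → ℕ) (z : A) :
    Matrix (Fin (N * (d + 1))) (Fin (N * (d + 1))) A :=
  Matrix.of fun q p => if (q : ℕ) / (d + 1) = j (p / (d + 1)) then
    (coef (p % (d + 1)) (q % (d + 1)) : A) * z ^ e (p / (d + 1)) else 0

variable {O ε}

theorem IsEquivariant.translate {m : SL(2, ℤ) → Sym d →ₗ[ℤ] 𝓜} (hm : IsEquivariant O ε m)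
    (X : SL(2, ℤ)) : IsEquivariant O ε (translate X m) := by
  intro γ c hc g P
  rw [translate_apply, translate_apply, mul_assoc, hm γ c hc]

theorem div_lt_of_fin {N d : ℕ} (p : Fin (N * (d + 1))) : (p : ℕ) / (d + 1) < N :=
  Nat.div_lt_of_lt_mul (p.2.trans_eq (mul_comm _ _))

theorem mod_le_of_fin {N d : ℕ} (p : Fin (N * (d + 1))) : (p : ℕ) % (d + 1) ≤ d :=
  Nat.lt_succ_iff.mp (Nat.mod_lt _ (Nat.succ_pos d))

/-- Write `r i X = γ r_j`: equivariance turns `γ` into the scalar `z ^ e i`, and `X⁻¹ P` is expanded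
in monomials. So the columns of representative `i` meet only the block of `j i`. -/
theorem rowMul_row {m : SL(2, ℤ) → Sym d →ₗ[ℤ] 𝓜} (hm : IsEquivariant O ε m) {X : SL(2, ℤ)}
    {coef : ℕ → ℕ → ℤ} (hcoef : ∀ w ≤ d, symRep d X⁻¹ (monomial d w) =
      ∑ w' ∈ Finset.range (d + 1), coef w w' • monomial d w')
    {N : ℕ} {r : ℕ → SL(2, ℤ)} {j e : ℕ → ℕ} {z : O}
    (hj : ∀ i < N, j i < N ∧ ∃ γ : Γ', r i * X = γ * r (j i) ∧
      (ε (γ : Γ' ⧸ Γ.subgroupOf Γ') : K) = (z : K) ^ e i) :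
    rowMul (row N r m) (actMat N d coef j e z) = row N r (translate X m) := by
  funext p
  obtain ⟨hlt, γ, hγ, hz⟩ := hj _ (div_lt_of_fin p)
  rw [row, translate_apply, hγ, hm γ (z ^ e (p / (d + 1))) (by rw [hz]; rfl),
    hcoef _ (mod_le_of_fin p), map_sum, Finset.smul_sum, rowMul]
  simp only [actMat, of_apply, ite_smul, zero_smul, row]
  rw [← sum_fin_block hlt (fun w' => z ^ e (p / (d + 1)) • m (r (j (p / (d + 1))))
    (coef (p % (d + 1)) w' • monomial d w'))]
  refine Finset.sum_congr rfl fun q _ => ?_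
  split_ifs with h
  · rw [h, map_smul, mul_comm, mul_smul, Int.cast_smul_eq_zsmul]
  · rfl

/-- Every `g` is `γ r_i` with `γ ∈ Γ'`, and the monomials span. -/
theorem IsEquivariant.eq_zero {m : SL(2, ℤ) → Sym d →ₗ[ℤ] 𝓜} (hm : IsEquivariant O ε m)
    (hε : ∀ γ : Γ', ∃ c : O, (c : K) = (ε (γ : Γ' ⧸ Γ.subgroupOf Γ') : K))
    {N : ℕ} {r : ℕ → SL(2, ℤ)} (hr : ∀ g, ∃! i, i < N ∧ g * (r i)⁻¹ ∈ Γ')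
    (h : row N r m = 0) (g : SL(2, ℤ)) (P : Sym d) : m g P = 0 := by
  obtain ⟨i, ⟨hi, hg⟩, -⟩ := hr g
  obtain ⟨c, hc⟩ := hε ⟨_, hg⟩
  have h1 := hm ⟨_, hg⟩ c hc (r i) P
  simp only [inv_mul_cancel_right] at h1
  rw [h1, sym_eq_sum d P, map_sum, Finset.sum_eq_zero, smul_zero]
  intro w hw
  have hw' : w < d + 1 := Finset.mem_range.mp hw
  have hlt : w + (d + 1) * i < N * (d + 1) := by nlinarith
  have h2 := congrFun h ⟨_, hlt⟩
  simp only [row, Nat.add_mul_div_left _ _ (Nat.succ_pos d), Nat.div_eq_of_lt hw', zero_add,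
    Nat.add_mul_mod_self_left, Nat.mod_eq_of_lt hw'] at h2
  rw [map_smul, h2]; simp

/-- `Γ'` acts freely on `SL₂(ℤ)` from the left, with the `r i` as orbit representatives, so the
values there can be prescribed at will. -/
theorem exists_family {N : ℕ} {r : ℕ → SL(2, ℤ)} (hr : ∀ g, ∃! i, i < N ∧ g * (r i)⁻¹ ∈ Γ')
    (φ : Fin (N * (d + 1)) → K) :
    ∃ m : SL(2, ℤ) → Sym d →ₗ[ℤ] K, IsEquivariant O ε m ∧ row N r m = φ := by
  choose idx hidx huniq using hr
  let φ' : ℕ → K := fun n => if h : n < N * (d + 1) then φ ⟨n, h⟩ else 0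
  let L : ℕ → Sym d →ₗ[ℤ] K := fun i => ∑ w ∈ Finset.range (d + 1),
    (LinearMap.toSpanSingleton ℤ K (φ' (w + (d + 1) * i))) ∘ₗ
      (MvPolynomial.lcoeff ℤ (expVec d w)) ∘ₗ (MvPolynomial.homogeneousSubmodule (Fin 2) ℤ d).subtype
  have hL : ∀ i, ∀ w ≤ d, L i (monomial d w) = φ' (w + (d + 1) * i) := by
    intro i w hw
    simp only [L, LinearMap.sum_apply, LinearMap.comp_apply, Submodule.subtype_apply,
      MvPolynomial.lcoeff_apply, coeff_coe_monomial hw, LinearMap.toSpanSingleton_apply, ite_smul,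
      one_smul, zero_smul]
    rw [Finset.sum_ite_eq, if_pos (Finset.mem_range.mpr (by omega))]
  let c : SL(2, ℤ) → K := fun g =>
    (ε ((⟨g * (r (idx g))⁻¹, (hidx g).2⟩ : Γ') : Γ' ⧸ Γ.subgroupOf Γ') : K)
  refine ⟨fun g => LinearMap.mulLeft ℤ (c g) ∘ₗ L (idx g), ?_, ?_⟩
  · intro γ a ha g P
    have hi : idx (γ * g) = idx g := (huniq (γ * g) (idx g) ⟨(hidx g).1, by
      rw [mul_assoc]; exact Γ'.mul_mem γ.2 (hidx g).2⟩).symm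
    have hc : c (γ * g) = a * c g := by
      rw [ha]
      simp only [c, hi]
      rw [← Units.val_mul, ← map_mul, ← QuotientGroup.mk_mul]
      congr 3
      apply Subtype.ext
      simp [mul_assoc]
    simp only [LinearMap.comp_apply, LinearMap.mulLeft_apply, hi, hc, mul_assoc]
    rfl
  · funext p
    have hi : idx (r (p / (d + 1))) = p / (d + 1) :=
      (huniq _ _ ⟨div_lt_of_fin p, by rw [mul_inv_cancel]; exact Γ'.one_mem⟩).symm
    have hc : c (r (p / (d + 1))) = 1 := by
      simp only [c, hi, mul_inv_cancel]
      rw [show (⟨1, _⟩ : Γ') = 1 from rfl, QuotientGroup.mk_one, map_one, Units.val_one]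
    simp only [row, LinearMap.comp_apply, LinearMap.mulLeft_apply, hc, one_mul, hi,
      hL _ _ (mod_le_of_fin p), Nat.mod_add_div]
    simp [φ']

end Families

end ModSym

namespace ModSym

open ModularGroup Matrix Matrix.SpecialLinearGroup

/-! ### The families of Manin symbols and of boundary symbols -/

section Symbols

variable {K : Type} [Field K] (O : Subalgebra ℤ K)
  {Γ Γ' : Subgroup SL(2, ℤ)} [(Γ.subgroupOf Γ').Normal] (ε : Γ' ⧸ Γ.subgroupOf Γ' →* Kˣ) (k : ℕ)

/-- The family of Manin symbols `[P, g]`. -/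
noncomputable def maninFamily (g : SL(2, ℤ)) : Sym (k - 2) →ₗ[ℤ] EpsCoinv O ε (mkRep k) :=
  epsMkₗ O ε (mkRep k) ∘ₗ mkRep k g ∘ₗ
    (TensorProduct.mk ℤ (Sym (k - 2)) M2).flip (symbol ((0 : ℚ) : Cusp) OnePoint.infty)

/-- The family of the classes of `g (P ⊗ {∞})`. -/
noncomputable def cuspFamily (g : SL(2, ℤ)) : Sym (k - 2) →ₗ[ℤ] EpsCoinv O ε (bkRep k) :=
  epsMkₗ O ε (bkRep k) ∘ₗ bkRep k g ∘ₗ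
    (TensorProduct.mk ℤ (Sym (k - 2)) B2).flip (Finsupp.single OnePoint.infty 1)

variable {O ε k}

theorem mkRep_tmul (g : SL(2, ℤ)) (P : Sym (k - 2)) (x : M2) :
    mkRep k g (P ⊗ₜ x) = symRep (k - 2) g P ⊗ₜ m2Rep g x := rfl

theorem bkRep_tmul (g : SL(2, ℤ)) (P : Sym (k - 2)) (x : B2) :
    bkRep k g (P ⊗ₜ x) = symRep (k - 2) g P ⊗ₜ b2Rep g x := rfl

theorem b2Rep_single (g : SL(2, ℤ)) (a : Cusp) :
    b2Rep g (Finsupp.single a 1) = Finsupp.single (cuspAct g a) 1 := by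
  simp [b2Rep, Finsupp.mapDomain_single]

theorem maninFamily_apply (g : SL(2, ℤ)) (P : Sym (k - 2)) : maninFamily O ε k g P =
    epsMk O ε (mkRep k) (symRep (k - 2) g P ⊗ₜ
      symbol (cuspAct g ((0 : ℚ) : Cusp)) (cuspAct g OnePoint.infty)) := by
  rw [← m2Rep_symbol]; rfl

theorem cuspFamily_apply (g : SL(2, ℤ)) (P : Sym (k - 2)) : cuspFamily O ε k g P =
    epsMk O ε (bkRep k) (symRep (k - 2) g P ⊗ₜ Finsupp.single (cuspAct g OnePoint.infty) 1) := by
  rw [← b2Rep_single]; rfl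

theorem symRep_mul_inv (m : ℕ) (g X : SL(2, ℤ)) (P : Sym m) :
    symRep m (g * X) (symRep m X⁻¹ P) = symRep m g P := by
  rw [← Module.End.mul_apply, ← map_mul, mul_inv_cancel_right]

theorem translate_maninFamily (X g : SL(2, ℤ)) (P : Sym (k - 2)) :
    translate X (maninFamily O ε k) g P = epsMk O ε (mkRep k) (symRep (k - 2) g P ⊗ₜ
      symbol (cuspAct g (cuspAct X ((0 : ℚ) : Cusp))) (cuspAct g (cuspAct X OnePoint.infty))) := by
  rw [translate_apply, maninFamily_apply, symRep_mul_inv, cuspAct_mul_apply, cuspAct_mul_apply]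

theorem translate_cuspFamily (X g : SL(2, ℤ)) (P : Sym (k - 2)) :
    translate X (cuspFamily O ε k) g P = epsMk O ε (bkRep k) (symRep (k - 2) g P ⊗ₜ
      Finsupp.single (cuspAct g (cuspAct X OnePoint.infty)) 1) := by
  rw [translate_apply, cuspFamily_apply, symRep_mul_inv, cuspAct_mul_apply]

theorem maninFamily_equivariant : IsEquivariant O ε (maninFamily O ε k) := by
  intro γ c hc g P
  rw [maninFamily_apply, maninFamily_apply, ← epsMk_smul hc, mkRep_tmul, m2Rep_symbol,
    ← cuspAct_mul_apply, ← cuspAct_mul_apply, map_mul]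
  rfl

theorem cuspFamily_equivariant : IsEquivariant O ε (cuspFamily O ε k) := by
  intro γ c hc g P
  rw [cuspFamily_apply, cuspFamily_apply, ← epsMk_smul hc, bkRep_tmul, b2Rep_single,
    ← cuspAct_mul_apply, map_mul]
  rfl

theorem epsMk_add {V : Type} [AddCommGroup V] (ρ : Representation ℤ SL(2, ℤ) V) (x y : V) :
    epsMk O ε ρ (x + y) = epsMk O ε ρ x + epsMk O ε ρ y := map_add (epsMkₗ O ε ρ) x y

theorem epsMk_sub {V : Type} [AddCommGroup V] (ρ : Representation ℤ SL(2, ℤ) V) (x y : V) :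
    epsMk O ε ρ (x - y) = epsMk O ε ρ x - epsMk O ε ρ y := map_sub (epsMkₗ O ε ρ) x y

theorem epsMk_zero {V : Type} [AddCommGroup V] (ρ : Representation ℤ SL(2, ℤ) V) :
    epsMk O ε ρ 0 = 0 := map_zero (epsMkₗ O ε ρ)

theorem cuspAct_S_zero : cuspAct S ((0 : ℚ) : Cusp) = OnePoint.infty := by
  rw [← cuspAct_S_infty, ← cuspAct_mul_apply, S_mul_S, cuspAct_neg, cuspAct_one_apply]

theorem maninFamily_S : maninFamily O ε k + translate S (maninFamily O ε k) = 0 := by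
  funext g
  apply LinearMap.ext
  intro P
  rw [Pi.add_apply, LinearMap.add_apply, translate_maninFamily, maninFamily_apply, cuspAct_S_zero,
    cuspAct_S_infty, symbol_swap, TensorProduct.tmul_neg, ← epsMk_add, neg_add_cancel, epsMk_zero]
  rfl

theorem cuspAct_ST_infty : cuspAct (S * T) OnePoint.infty = ((0 : ℚ) : Cusp) := by
  rw [cuspAct_mul_apply, cuspAct_T_infty, cuspAct_S_infty]

theorem cuspAct_ST_ST_zero : cuspAct (S * T) (cuspAct (S * T) ((0 : ℚ) : Cusp)) =
    OnePoint.infty := by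
  rw [← cuspAct_ST_infty, ← cuspAct_mul_apply, ← cuspAct_mul_apply, ST_cubed,
    cuspAct_neg, cuspAct_one_apply]

/-- `S T` has order three on cusps and takes `∞` to `0`, so the three symbols run around a triangle.
-/
theorem maninFamily_ST : maninFamily O ε k + translate (S * T) (maninFamily O ε k) +
    translate (S * T) (translate (S * T) (maninFamily O ε k)) = 0 := by
  funext g
  apply LinearMap.ext
  intro P
  rw [translate_translate]
  simp only [Pi.add_apply, LinearMap.add_apply, translate_maninFamily, maninFamily_apply]
  rw [cuspAct_mul_apply (S * T), cuspAct_mul_apply (S * T), cuspAct_ST_ST_zero,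
    cuspAct_ST_infty, ← epsMk_add, ← epsMk_add, ← TensorProduct.tmul_add, ← TensorProduct.tmul_add]
  set a := cuspAct g ((0 : ℚ) : Cusp)
  set b := cuspAct g OnePoint.infty
  set c := cuspAct g (cuspAct (S * T) ((0 : ℚ) : Cusp))
  rw [show symbol a b + symbol c a + symbol b c = symbol a b + symbol b c + symbol c a by abel,
    symbol_add, TensorProduct.tmul_zero, epsMk_zero]
  rfl

theorem cuspFamily_T : translate T (cuspFamily O ε k) = cuspFamily O ε k := by
  funext g
  apply LinearMap.ext
  intro P
  rw [translate_cuspFamily, cuspFamily_apply, cuspAct_T_infty]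

theorem cuspFamily_S_S : translate S (translate S (cuspFamily O ε k)) = cuspFamily O ε k := by
  funext g
  apply LinearMap.ext
  intro P
  rw [translate_translate, translate_cuspFamily, cuspFamily_apply, S_mul_S, cuspAct_neg,
    cuspAct_one_apply]

/-- Since `0 = S∞`, the boundary map becomes the matrix `s - 1` on rows. -/
theorem boundary_maninFamily (g : SL(2, ℤ)) (P : Sym (k - 2)) :
    epsMap O ε (boundaryK k) (boundaryK_equivariant k) (maninFamily O ε k g P) =
      translate S (cuspFamily O ε k) g P - cuspFamily O ε k g P := by
  rw [maninFamily_apply, epsMap_mk, translate_cuspFamily, cuspFamily_apply, cuspAct_S_infty,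
    ← epsMk_sub, ← TensorProduct.tmul_sub, ← boundary2_symbol]
  rfl


end Symbols

end ModSym

/-! ### Generation by Manin symbols -/

namespace ModSym

open ModularGroup Matrix Matrix.SpecialLinearGroup

/-! ### The families of Manin symbols and of boundary symbols -/

section Symbols

variable {K : Type} [Field K] {O : Subalgebra ℤ K}
  {Γ Γ' : Subgroup SL(2, ℤ)} [(Γ.subgroupOf Γ').Normal] {ε : Γ' ⧸ Γ.subgroupOf Γ' →* Kˣ} {k : ℕ}


theorem epsMk_tmul_induction (W : Submodule O (EpsCoinv O ε (mkRep k)))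
    (h : ∀ P a b, epsMk O ε (mkRep k) (P ⊗ₜ symbol a b) ∈ W) : W = ⊤ := by
  rw [eq_top_iff, ← span_range_epsMk, Submodule.span_le]
  rintro _ ⟨x, rfl⟩
  induction x using TensorProduct.induction_on with
  | zero => rw [epsMk_zero]; exact W.zero_mem
  | add x y hx hy => rw [epsMk_add]; exact W.add_mem hx hy
  | tmul P y =>
    obtain ⟨y, rfl⟩ := Submodule.Quotient.mk_surjective _ y
    induction y using Finsupp.induction_linear with
    | zero => rw [Submodule.Quotient.mk_zero, TensorProduct.tmul_zero, epsMk_zero]; exact W.zero_mem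
    | add x y hx hy =>
      rw [Submodule.Quotient.mk_add, TensorProduct.tmul_add, epsMk_add]; exact W.add_mem hx hy
    | single p n =>
      obtain ⟨a, b⟩ := p
      have := h (n • P) a b
      rwa [TensorProduct.smul_tmul, symbol, ← Submodule.Quotient.mk_smul, Finsupp.smul_single,
        smul_eq_mul, mul_one] at this

/-- Manin's trick modulo the span `W`: the class of `P ⊗ {a, ∞}` does not change along Farey edges
and vanishes at `a = ∞`. -/
theorem span_maninFamily : Submodule.span O
    {y | ∃ g P, y = maninFamily O ε k g P} = ⊤ := by
  set W := Submodule.span O {y | ∃ g P, y = maninFamily O ε k g P} with hW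
  have e : ∀ a b c, symbol a c = symbol a b + symbol b c := fun a b c => by
    rw [eq_comm, ← sub_eq_zero, sub_eq_add_neg, ← symbol_swap, symbol_add]
  have h0 : ∀ g P, epsMk O ε (mkRep k) (P ⊗ₜ symbol (cuspAct g ((0 : ℚ) : Cusp))
      (cuspAct g OnePoint.infty)) ∈ W := by
    intro g P
    refine Submodule.subset_span ⟨g, symRep (k - 2) g⁻¹ P, ?_⟩
    rw [maninFamily_apply, ← Module.End.mul_apply, ← map_mul, mul_inv_cancel, map_one]
    rfl
  have h1 : ∀ P a, epsMk O ε (mkRep k) (P ⊗ₜ symbol a OnePoint.infty) ∈ W := by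
    intro P a
    have := cusp_function_const
      (fun a => W.mkQ (epsMk O ε (mkRep k) (P ⊗ₜ symbol a OnePoint.infty))) (fun g => by
        rw [e _ (cuspAct g OnePoint.infty), TensorProduct.tmul_add, epsMk_add, map_add,
          show W.mkQ _ = 0 from (Submodule.Quotient.mk_eq_zero W).mpr (h0 g P), zero_add]) a
    simp only [symbol_self, TensorProduct.tmul_zero, epsMk_zero, map_zero] at this
    exact (Submodule.Quotient.mk_eq_zero W).mp this
  refine epsMk_tmul_induction W fun P a b => ?_
  rw [e a OnePoint.infty b, symbol_swap b, TensorProduct.tmul_add, epsMk_add,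
    TensorProduct.tmul_neg]
  refine W.add_mem (h1 P a) ?_
  have : epsMk O ε (mkRep k) (-(P ⊗ₜ symbol b OnePoint.infty)) =
    -epsMk O ε (mkRep k) (P ⊗ₜ symbol b OnePoint.infty) := map_neg (epsMkₗ O ε (mkRep k)) _
  rw [this]
  exact W.neg_mem (h1 P b)

/-- Modulo the span of the row, the Manin symbols still form an equivariant family; its row is zero,
hence so is the family. -/
theorem span_row_maninFamily
    (hε : ∀ γ : Γ', ∃ c : O, (c : K) = (ε (γ : Γ' ⧸ Γ.subgroupOf Γ') : K))
    {N : ℕ} {r : ℕ → SL(2, ℤ)} (hr : ∀ g, ∃! i, i < N ∧ g * (r i)⁻¹ ∈ Γ') :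
    Submodule.span O (Set.range (row N r (maninFamily O ε k))) = ⊤ := by
  set W := Submodule.span O (Set.range (row N r (maninFamily O ε k))) with hW
  rw [eq_top_iff, ← span_maninFamily, Submodule.span_le]
  rintro _ ⟨g, P, rfl⟩
  let m : SL(2, ℤ) → Sym (k - 2) →ₗ[ℤ] (EpsCoinv O ε (mkRep k) ⧸ W) := fun g =>
    (W.mkQ.restrictScalars ℤ) ∘ₗ maninFamily O ε k g
  have hm : IsEquivariant O ε m := by
    intro γ c hc g P
    simp only [m, LinearMap.comp_apply, maninFamily_equivariant γ c hc g P]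
    exact W.mkQ.map_smul c _
  have h0 := hm.eq_zero hε hr (by
    funext p
    exact (Submodule.Quotient.mk_eq_zero _).mpr (Submodule.subset_span ⟨p, rfl⟩)) g P
  exact (Submodule.Quotient.mk_eq_zero _).mp h0


end Symbols

end ModSym

/-! ### Functionals with prescribed values on Manin symbols and on boundary symbols -/

namespace ModSym

open ModularGroup Matrix Matrix.SpecialLinearGroup

/-! ### The families of Manin symbols and of boundary symbols -/

section Symbols

variable {K : Type} [Field K] {O : Subalgebra ℤ K}
  {Γ Γ' : Subgroup SL(2, ℤ)} [(Γ.subgroupOf Γ').Normal] {ε : Γ' ⧸ Γ.subgroupOf Γ' →* Kˣ} {k : ℕ}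

theorem exists_tensor_hom {V W A : Type*} [AddCommGroup V] [AddCommGroup W] [AddCommGroup A]
    [Module ℤ V] [Module ℤ W] (F : W →+ (V →ₗ[ℤ] A)) :
    ∃ f : V ⊗[ℤ] W →+ A, ∀ P x, f (P ⊗ₜ x) = F x P := by
  let G : V →+ W →+ A := AddMonoidHom.mk' (fun P => AddMonoidHom.mk' (fun x => F x P)
    fun x y => by rw [map_add]; rfl) fun P Q => by ext x; exact map_add (F x) P Q
  refine ⟨TensorProduct.liftAddHom G fun n P x => ?_, fun P x => rfl⟩
  simp only [G, AddMonoidHom.mk'_apply]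
  have h := map_intCast_smul F ℤ ℤ n x
  rw [Int.cast_id] at h
  exact ((F x).map_smul n P).trans (LinearMap.congr_fun h P).symm

theorem isAddTorsionFree_symDual [CharZero K] (m : ℕ) : IsAddTorsionFree (Sym m →ₗ[ℤ] K) := by
  refine ⟨fun n hn f g h => LinearMap.ext fun x => ?_⟩
  have := LinearMap.congr_fun h x
  simp only [LinearMap.smul_apply] at this
  exact nsmul_right_injective hn this

/-- Untwisting: passing from `m g` to `m g ∘ g⁻¹` turns the twisted translation into plain right
translation of functions with values in the dual of `Sym^d ℤ²`. -/
theorem translate_comp_symRep_inv {d : ℕ} (m : SL(2, ℤ) → Sym d →ₗ[ℤ] K) (X g : SL(2, ℤ)) :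
    m (g * X) ∘ₗ symRep d (g * X)⁻¹ = translate X m g ∘ₗ symRep d g⁻¹ := by
  rw [translate, LinearMap.comp_assoc, ← Module.End.mul_eq_comp, ← map_mul, _root_.mul_inv_rev]

theorem comp_symRep_inv_of_translate_eq {d : ℕ} {m : SL(2, ℤ) → Sym d →ₗ[ℤ] K} {X : SL(2, ℤ)}
    (h : translate X m = m) (g : SL(2, ℤ)) :
    m (g * X) ∘ₗ symRep d (g * X)⁻¹ = m g ∘ₗ symRep d g⁻¹ := by
  have h1 : translate X m g ∘ₗ symRep d g⁻¹ = m g ∘ₗ symRep d g⁻¹ := by rw [h]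
  rw [← h1, translate_comp_symRep_inv]

/-- Invariance under `T` and `S² = -1` makes the untwisted family a function `ψ` of the cusp `g∞`;
the functional is `P ⊗ {a} ↦ ψ(a)(P)`. -/
theorem exists_hom_of_cusp_relations [CharZero K] (hΓ : Γ ≤ Γ')
    (hε : ∀ γ : Γ', ∃ c : O, (c : K) = (ε (γ : Γ' ⧸ Γ.subgroupOf Γ') : K))
    {m : SL(2, ℤ) → Sym (k - 2) →ₗ[ℤ] K} (hm : IsEquivariant O ε m) (hT : translate T m = m)
    (hS : translate S (translate S m) = m) :
    ∃ L : EpsCoinv O ε (bkRep k) →ₗ[O] K, ∀ g P, L (cuspFamily O ε k g P) = m g P := by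
  rw [translate_translate, S_mul_S] at hS
  obtain ⟨ψ, hψ⟩ := exists_cusp_function (fun g => m g ∘ₗ symRep (k - 2) g⁻¹)
    (comp_symRep_inv_of_translate_eq hT)
    (fun g => by simpa using comp_symRep_inv_of_translate_eq hS g)
  obtain ⟨f, hf₀⟩ := exists_tensor_hom (Finsupp.linearCombination ℤ ψ).toAddMonoidHom
  have hf : ∀ P a n, f (P ⊗ₜ Finsupp.single a n) = n • ψ a P := fun P a n => by
    rw [hf₀, LinearMap.toAddMonoidHom_coe, Finsupp.linearCombination_single]
    rfl
  obtain ⟨L, hL⟩ := exists_eps_hom (O := O) (ρ := bkRep k) hΓ f.toIntLinearMap (by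
    intro γ x
    simp only [AddMonoidHom.coe_toIntLinearMap]
    induction x using TensorProduct.induction_on with
    | zero => simp
    | add x y hx hy => rw [map_add, map_add, hx, hy, map_add, mul_add]
    | tmul P y =>
      induction y using Finsupp.induction_linear with
      | zero => simp
      | add x y hx hy =>
        rw [TensorProduct.tmul_add, map_add, map_add, hx, hy, map_add, mul_add]
      | single a n =>
        have hb : b2Rep (γ : SL(2, ℤ)) (Finsupp.single a n) =
            Finsupp.single (cuspAct γ a) n := Finsupp.mapDomain_single
        rw [bkRep_tmul, hb, hf, hf, mul_smul_comm]
        obtain ⟨g, rfl⟩ := exists_cuspAct_infty a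
        obtain ⟨c, hc⟩ := hε γ
        rw [← cuspAct_mul_apply, hψ, hψ]
        simp only [LinearMap.comp_apply]
        rw [hm γ c hc, ← Module.End.mul_apply, ← map_mul, _root_.mul_inv_rev, inv_mul_cancel_right,
          ← hc]
        rfl)
  refine ⟨L, fun g P => ?_⟩
  rw [cuspFamily_apply, hL, AddMonoidHom.coe_toIntLinearMap, hf, one_smul, hψ,
    LinearMap.comp_apply, ← Module.End.mul_apply, ← map_mul, inv_mul_cancel, map_one]
  rfl

/-- The untwisted family `v` is the coboundary of its potential, which is a function `ψ` of cusps;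
the functional is `P ⊗ {a, b} ↦ (ψ(a) - ψ(b))(P)`. -/
theorem exists_hom_of_manin_relations [CharZero K] (hΓ : Γ ≤ Γ')
    (hε : ∀ γ : Γ', ∃ c : O, (c : K) = (ε (γ : Γ' ⧸ Γ.subgroupOf Γ') : K))
    {m : SL(2, ℤ) → Sym (k - 2) →ₗ[ℤ] K} (hm : IsEquivariant O ε m)
    (hS : m + translate S m = 0)
    (hU : m + translate (S * T) m + translate (S * T) (translate (S * T) m) = 0) :
    ∃ L : EpsCoinv O ε (mkRep k) →ₗ[O] K, ∀ g P, L (maninFamily O ε k g P) = m g P := by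
  rw [translate_translate (S * T)] at hU
  let v : SL(2, ℤ) → (Sym (k - 2) →ₗ[ℤ] K) := fun g => m g ∘ₗ symRep (k - 2) g⁻¹
  have hvX : ∀ g X, v (g * X) = translate X m g ∘ₗ symRep (k - 2) g⁻¹ := fun g X =>
    translate_comp_symRep_inv m X g
  have hpot := potential_mul_S v (fun g => by
    rw [hvX, ← LinearMap.add_comp, ← Pi.add_apply, hS]; rfl)
    (fun g => by
    rw [mul_assoc g, hvX, hvX, ← LinearMap.add_comp, ← LinearMap.add_comp,
      ← Pi.add_apply, ← Pi.add_apply, hU]; rfl)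
  obtain ⟨ψ, hψ⟩ := exists_cusp_function (potential v) (potential_mul_T v) (potential_neg v)
  have hψ0 : ∀ g, ψ (cuspAct g ((0 : ℚ) : Cusp)) - ψ (cuspAct g OnePoint.infty) = v g := fun g => by
    rw [← cuspAct_S_infty, ← cuspAct_mul_apply, hψ, hψ, hpot]
  have := isAddTorsionFree_symDual (K := K) (k - 2)
  obtain ⟨F, hF⟩ : ∃ F : M2 →+ (Sym (k - 2) →ₗ[ℤ] K), ∀ a b, F (symbol a b) = ψ a - ψ b :=
    let ⟨F, hF⟩ := exists_M2_hom ψ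
    ⟨F.toAddMonoidHom, hF⟩
  obtain ⟨f, hf⟩ := exists_tensor_hom F
  have hFv : ∀ g, F (symbol (cuspAct g ((0 : ℚ) : Cusp)) (cuspAct g OnePoint.infty)) = v g :=
    fun g => by rw [hF, hψ0]
  obtain ⟨L, hL⟩ := exists_eps_hom (O := O) (ρ := mkRep k) hΓ f.toIntLinearMap (by
    intro γ x
    simp only [AddMonoidHom.coe_toIntLinearMap]
    obtain ⟨c, hc⟩ := hε γ
    -- The potential `ψ` need not be equivariant, only its differences are. It suffices to compare
    -- on the symbols `{g0, g∞}`, where `F` is `v g` and the equivariance of `m` applies.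
    have key : ∀ P y, F (m2Rep (γ : SL(2, ℤ)) y) (symRep (k - 2) (γ : SL(2, ℤ)) P) =
        (c : K) * F y P := by
      intro P y
      let F₁ : M2 →+ K := AddMonoidHom.mk'
        (fun y => F (m2Rep (γ : SL(2, ℤ)) y) (symRep (k - 2) (γ : SL(2, ℤ)) P))
        fun x y => by rw [map_add, map_add]; rfl
      let F₂ : M2 →+ K := AddMonoidHom.mk' (fun y => (c : K) * F y P)
        fun x y => by rw [map_add, LinearMap.add_apply, mul_add]
      have h : F₁.toIntLinearMap = F₂.toIntLinearMap := by
        apply M2_hom_ext_manin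
        intro g
        simp only [AddMonoidHom.coe_toIntLinearMap, F₁, F₂, AddMonoidHom.mk'_apply]
        rw [m2Rep_symbol, ← cuspAct_mul_apply, ← cuspAct_mul_apply, hFv, hFv]
        simp only [v, LinearMap.comp_apply]
        rw [hm γ c hc, ← Module.End.mul_apply, ← map_mul, _root_.mul_inv_rev, inv_mul_cancel_right]
        rfl
      exact LinearMap.congr_fun h y
    induction x using TensorProduct.induction_on with
    | zero => simp
    | add x y hx hy => rw [map_add, map_add, hx, hy, map_add, mul_add]
    | tmul P y => rw [mkRep_tmul, hf, hf, ← hc, key])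
  refine ⟨L, fun g P => ?_⟩
  rw [maninFamily_apply, hL, AddMonoidHom.coe_toIntLinearMap, hf, hFv]
  simp only [v, LinearMap.comp_apply]
  rw [← Module.End.mul_apply, ← map_mul, inv_mul_cancel, map_one]
  rfl

end Symbols

end ModSym

namespace ModSym

/-! ### Certificates for a basis of the kernel of the boundary map -/

section Certificate

/-- The eight expressions which vanish if the columns of `o` selected by the projection `p` form a
basis of the kernel of `s - 1`, modulo the images of `1 - t` and `1 - s²` in the target and of
`1 + s` and `1 + t s + (t s)²` in the source; the scalar `c` is a common denominator. -/
def certDefect {A : Type*} [Ring A] (s t o φ e₁ e₂ u₁ u₂ w c p : A) : Fin 8 → A :=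
  ![(s - 1) * o - ((1 - t) * e₁ + (1 - s * s) * e₂),
    φ * (1 + s),
    φ * (1 + t * s + t * s * (t * s)),
    φ * o - c * p,
    c - (o * φ + (1 + s) * u₁ + (1 + t * s + t * s * (t * s)) * u₂ + w * (s - 1)),
    w * (1 - t),
    w * (1 - s * s),
    o * p - o]

theorem map_certDefect {A B F : Type*} [Ring A] [Ring B] [FunLike F A B] [RingHomClass F A B]
    (f : F) (s t o φ e₁ e₂ u₁ u₂ w c p : A) (i : Fin 8) :
    f (certDefect s t o φ e₁ e₂ u₁ u₂ w c p i) =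
      certDefect (f s) (f t) (f o) (f φ) (f e₁) (f e₂) (f u₁) (f u₂) (f w) (f c) (f p) i := by
  fin_cases i <;> simp [certDefect]

/-- This identity and the next say that `s - 1` maps the relations of the source into those of the
target. In the next one the sum telescopes up to `(ts)³`, which the hypothesis replaces by `s²`. -/
theorem sub_one_mul_two_term {A : Type*} [Ring A] (s : A) :
    (s - 1) * (1 + s) = (1 - s * s) * (-1) := by
  simp only [sub_mul, mul_add, mul_one, one_mul, mul_neg]; abel

theorem sub_one_mul_three_term {A : Type*} [Ring A] {s t : A}
    (h : t * s * (t * s) * (t * s) = s * s) :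
    (s - 1) * (1 + t * s + t * s * (t * s)) =
      (1 - t) * (s + s * (t * s) + s * (t * s) * (t * s)) + (1 - s * s) * (-1) := by
  rw [← h]
  simp only [sub_mul, mul_add, mul_one, one_mul, mul_neg, mul_assoc]; abel

theorem decomposition_sub {A : Type*} [Ring A] (a b : A) :
    1 - ((1 - a) * b + a * b + (1 - b)) = 0 := by
  simp only [sub_mul, one_mul]; abel

variable {K : Type*} [Field K]

theorem exists_lift_of_range_le {V V' W : Type*} [AddCommGroup V] [Module K V] [AddCommGroup V']
    [Module K V'] [AddCommGroup W] [Module K W] (a : V' →ₗ[K] W) (f : V →ₗ[K] W)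
    (h : LinearMap.range f ≤ LinearMap.range a) : ∃ g : V →ₗ[K] V', a ∘ₗ g = f := by
  let b := Module.Basis.ofVectorSpace K V
  choose g hg using fun i => h (LinearMap.mem_range_self f (b i))
  refine ⟨b.constr K g, b.ext fun i => ?_⟩
  rw [LinearMap.comp_apply, b.constr_basis, hg]

theorem exists_lift_of_range_le_sup {V W : Type*} [AddCommGroup V] [Module K V] [AddCommGroup W]
    [Module K W] (a₁ a₂ : W →ₗ[K] W) (f : V →ₗ[K] W)
    (h : LinearMap.range f ≤ LinearMap.range a₁ ⊔ LinearMap.range a₂) :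
    ∃ g₁ g₂ : V →ₗ[K] W, f = a₁ ∘ₗ g₁ + a₂ ∘ₗ g₂ := by
  obtain ⟨g, hg⟩ := exists_lift_of_range_le (a₁.coprod a₂) f (by rwa [LinearMap.range_coprod])
  refine ⟨LinearMap.fst K W W ∘ₗ g, LinearMap.snd K W W ∘ₗ g, ?_⟩
  rw [← hg]
  ext x
  simp

theorem exists_extend_of_ker_le {V V' W : Type*} [AddCommGroup V] [Module K V] [AddCommGroup V']
    [Module K V'] [AddCommGroup W] [Module K W] (f : V →ₗ[K] V') (g : V →ₗ[K] W)
    (h : LinearMap.ker f ≤ LinearMap.ker g) : ∃ l : V' →ₗ[K] W, l ∘ₗ f = g := by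
  obtain ⟨l, hl⟩ := LinearMap.exists_leftInverse_of_injective
    ((LinearMap.ker f).liftQ f le_rfl) (Submodule.ker_liftQ_eq_bot' _ f rfl)
  refine ⟨(LinearMap.ker f).liftQ g h ∘ₗ l, LinearMap.ext fun x => ?_⟩
  have := LinearMap.congr_fun hl (Submodule.Quotient.mk x)
  simp only [LinearMap.comp_apply, Submodule.liftQ_apply, LinearMap.id_apply] at this ⊢
  rw [this, Submodule.liftQ_apply]

/-- The projection onto the first `d` coordinates. -/
def firstProj (A : Type*) [Semiring A] (M d : ℕ) : Matrix (Fin M) (Fin M) A :=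
  Matrix.diagonal fun i => if (i : ℕ) < d then 1 else 0

/-- An idempotent of rank `d` factors through `K^d`. Here `K^d` is placed in the first `d`
coordinates of `K^M`, so that all matrices remain square of one size. -/
theorem exists_factorization {M : ℕ} (f : (Fin M → K) →ₗ[K] (Fin M → K)) (hf : f ∘ₗ f = f) :
    ∃ d ≤ M, ∃ o φ : (Fin M → K) →ₗ[K] (Fin M → K), o ∘ₗ φ = f ∧
      φ ∘ₗ o = Matrix.toLin' (firstProj K M d) ∧ o ∘ₗ Matrix.toLin' (firstProj K M d) = o ∧
      LinearMap.range o ≤ LinearMap.range f ∧ LinearMap.ker f ≤ LinearMap.ker φ := by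
  set C := LinearMap.range f
  set d := Module.finrank K C with hd
  have hdM : d ≤ M := by
    have := Submodule.finrank_le C
    rwa [Module.finrank_fin_fun] at this
  let ψ : C ≃ₗ[K] (Fin d → K) := LinearEquiv.ofFinrankEq _ _ (by rw [Module.finrank_fin_fun])
  let res : (Fin M → K) →ₗ[K] (Fin d → K) := LinearMap.funLeft K K (Fin.castLE hdM)
  let ext : (Fin d → K) →ₗ[K] (Fin M → K) := LinearMap.pi fun i =>
    if h : (i : ℕ) < d then LinearMap.proj ⟨i, h⟩ else 0
  have hext : ∀ v i, ext v i = if h : (i : ℕ) < d then v ⟨i, h⟩ else 0 := fun v i => by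
    simp only [ext, LinearMap.pi_apply]
    split_ifs <;> rfl
  have hre : res ∘ₗ ext = LinearMap.id := by
    apply LinearMap.ext; intro v; funext i
    simp [res, hext, LinearMap.funLeft_apply]
  have her : ext ∘ₗ res = Matrix.toLin' (firstProj K M d) := by
    apply LinearMap.ext; intro v; funext i
    simp only [LinearMap.comp_apply, hext, firstProj, Matrix.toLin'_apply, Matrix.mulVec_diagonal]
    split_ifs with h
    · rw [one_mul]; rfl
    · rw [zero_mul]
  have hfC : ∀ c : C, f.rangeRestrict (c : Fin M → K) = c := by
    rintro ⟨_, v, rfl⟩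
    exact Subtype.ext (LinearMap.congr_fun hf v)
  refine ⟨d, hdM, C.subtype ∘ₗ ψ.symm.toLinearMap ∘ₗ res, ext ∘ₗ ψ.toLinearMap ∘ₗ f.rangeRestrict,
    ?_, ?_, ?_, ?_, ?_⟩
  · apply LinearMap.ext; intro v
    have := LinearMap.congr_fun hre (ψ (f.rangeRestrict v))
    simp only [LinearMap.comp_apply, LinearMap.id_apply, LinearEquiv.coe_coe] at this ⊢
    rw [this, ψ.symm_apply_apply]; rfl
  · rw [← her]
    apply LinearMap.ext; intro v
    simp only [LinearMap.comp_apply, LinearEquiv.coe_coe, Submodule.subtype_apply]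
    rw [hfC, ψ.apply_symm_apply]
  · rw [← her, LinearMap.comp_assoc, LinearMap.comp_assoc, ← LinearMap.comp_assoc res, hre,
      LinearMap.id_comp]
  · rintro _ ⟨v, rfl⟩
    exact (ψ.symm (res v)).2
  · intro v hv
    have : f.rangeRestrict v = 0 := Subtype.ext hv
    simp [this]

theorem exists_projection {V : Type*} [AddCommGroup V] [Module K V] (Z : Submodule K V) :
    ∃ π : V →ₗ[K] V, (∀ v, π v ∈ Z) ∧ ∀ v ∈ Z, π v = v := by
  obtain ⟨l, hl⟩ := LinearMap.exists_leftInverse_of_injective Z.subtype Z.ker_subtype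
  exact ⟨Z.subtype ∘ₗ l, fun v => (l v).2, fun v hv =>
    congrArg Subtype.val (LinearMap.congr_fun hl ⟨v, hv⟩)⟩

/-- `R` and `RB` are the relations of source and target, and `Z` consists of the vectors whose
boundary lies in `RB`; thus `Z / R` is the cuspidal space. The identity splits as `(1 - πR) πZ + πR
πZ + (1 - πZ)`: a part that carries the basis, a part in the relations, and a part that factors
through the boundary. -/
theorem exists_certificate_end {M : ℕ} (s t : Module.End K (Fin M → K))
    (hst : t * s * (t * s) * (t * s) = s * s) :
    ∃ d ≤ M, ∃ o φ e₁ e₂ u₁ u₂ w : Module.End K (Fin M → K),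
      certDefect s t o φ e₁ e₂ u₁ u₂ w 1 (Matrix.toLin' (firstProj K M d)) = 0 := by
  set R := LinearMap.range (1 + s) ⊔ LinearMap.range (1 + t * s + t * s * (t * s)) with hR
  set RB := LinearMap.range (1 - t) ⊔ LinearMap.range (1 - s * s) with hRB
  set Z := RB.comap (s - 1) with hZ
  have hRZ : R ≤ Z := by
    refine sup_le ?_ ?_
    · rintro _ ⟨v, rfl⟩
      rw [hZ, Submodule.mem_comap, ← Module.End.mul_apply, sub_one_mul_two_term]
      exact Submodule.mem_sup_right ⟨_, rfl⟩
    · rintro _ ⟨v, rfl⟩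
      rw [hZ, Submodule.mem_comap, ← Module.End.mul_apply, sub_one_mul_three_term hst,
        LinearMap.add_apply]
      exact Submodule.add_mem_sup ⟨_, rfl⟩ ⟨_, rfl⟩
  obtain ⟨πR, hπR, hπR'⟩ := exists_projection R
  obtain ⟨πZ, hπZ, hπZ'⟩ := exists_projection Z
  -- An idempotent which vanishes on `R` and whose image is a complement of `R` in `Z`.
  let f : Module.End K (Fin M → K) := (1 - πR) * πZ
  have hfv : ∀ v, f v = πZ v - πR (πZ v) := fun v => rfl
  have hfZ : ∀ v, f v ∈ Z := fun v => by
    rw [hfv]; exact Z.sub_mem (hπZ v) (hRZ (hπR _))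
  have hfR : ∀ v ∈ R, f v = 0 := fun v hv => by
    rw [hfv, hπZ' v (hRZ hv), hπR' v hv, sub_self]
  have hff : f ∘ₗ f = f := by
    apply LinearMap.ext; intro v
    rw [LinearMap.comp_apply, hfv (f v), hπZ' _ (hfZ v)]
    conv_lhs => rw [hfv]
    rw [map_sub, hπR' _ (hπR _), sub_self, sub_zero, hfv]
  obtain ⟨d, hd, o, φ, h1, h2, h3, h4, h5⟩ := exists_factorization f hff
  have hoZ : ∀ v, o v ∈ Z := fun v => by
    obtain ⟨x, hx⟩ := h4 ⟨v, rfl⟩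
    rw [← hx]; exact hfZ x
  obtain ⟨e₁, e₂, he⟩ := exists_lift_of_range_le_sup (1 - t) (1 - s * s) ((s - 1) * o) (by
    rintro _ ⟨v, rfl⟩; exact hoZ v)
  obtain ⟨u₁, u₂, hu⟩ := exists_lift_of_range_le_sup (1 + s) (1 + t * s + t * s * (t * s))
    (πR * πZ) (by rintro _ ⟨v, rfl⟩; exact hπR _)
  -- `1 - πZ` vanishes on `Z`, the kernel of `s - 1` modulo `RB`, so it factors through that map;
  -- the factor gives `w`.
  obtain ⟨l, hl⟩ := exists_extend_of_ker_le (RB.mkQ ∘ₗ (s - 1)) (1 - πZ) (by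
    intro v hv
    have : v ∈ Z := (Submodule.Quotient.mk_eq_zero RB).mp hv
    rw [LinearMap.mem_ker, LinearMap.sub_apply, hπZ' v this]
    exact sub_self v)
  have hφR : ∀ v ∈ R, φ v = 0 := fun v hv => h5 (hfR v hv)
  have hlR : ∀ v ∈ RB, (l ∘ₗ RB.mkQ) v = 0 := fun v hv => by
    rw [LinearMap.comp_apply, Submodule.mkQ_apply, (Submodule.Quotient.mk_eq_zero RB).mpr hv,
      map_zero]
  have hl' : (l ∘ₗ RB.mkQ) * (s - 1) = 1 - πZ := hl
  refine ⟨d, hd, o, φ, e₁, e₂, u₁, u₂, l ∘ₗ RB.mkQ, ?_⟩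
  funext i
  fin_cases i
  · exact sub_eq_zero.mpr he
  · exact LinearMap.ext fun v => hφR _ (Submodule.mem_sup_left ⟨v, rfl⟩)
  · exact LinearMap.ext fun v => hφR _ (Submodule.mem_sup_right ⟨v, rfl⟩)
  · change φ * o - 1 * _ = 0
    rw [one_mul, sub_eq_zero]; exact h2
  · change 1 - (o * φ + (1 + s) * u₁ + (1 + t * s + t * s * (t * s)) * u₂ +
      (l ∘ₗ RB.mkQ) * (s - 1)) = 0
    have hu' : πR * πZ = (1 + s) * u₁ + (1 + t * s + t * s * (t * s)) * u₂ := hu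
    have h1' : o * φ = (1 - πR) * πZ := h1
    rw [add_assoc (o * φ), ← hu', hl', h1']
    exact decomposition_sub πR πZ
  · exact LinearMap.ext fun v => hlR _ (Submodule.mem_sup_left ⟨v, rfl⟩)
  · exact LinearMap.ext fun v => hlR _ (Submodule.mem_sup_right ⟨v, rfl⟩)
  · exact sub_eq_zero.mpr h3

theorem exists_certificate {M : ℕ} (s t : Matrix (Fin M) (Fin M) K)
    (hst : t * s * (t * s) * (t * s) = s * s) :
    ∃ d ≤ M, ∃ o φ e₁ e₂ u₁ u₂ w : Matrix (Fin M) (Fin M) K,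
      certDefect s t o φ e₁ e₂ u₁ u₂ w 1 (firstProj K M d) = 0 := by
  let f : Matrix (Fin M) (Fin M) K ≃ₐ[K] Module.End K (Fin M → K) := Matrix.toLinAlgEquiv'
  obtain ⟨d, hd, o, φ, e₁, e₂, u₁, u₂, w, h⟩ := exists_certificate_end (f s) (f t)
    (by simp only [← map_mul, hst])
  refine ⟨d, hd, f.symm o, f.symm φ, f.symm e₁, f.symm e₂, f.symm u₁, f.symm u₂, f.symm w, ?_⟩
  funext i
  apply f.injective
  rw [map_certDefect]
  simp only [AlgEquiv.apply_symm_apply, map_one, Pi.zero_apply, map_zero]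
  exact congrFun h i

end Certificate

/-! ### Soundness of certificates -/

section Soundness

variable {K : Type} [Field K] {O : Subalgebra ℤ K} {𝓜 𝓑 : Type}
  [AddCommGroup 𝓜] [Module O 𝓜] [AddCommGroup 𝓑] [Module O 𝓑] {M : ℕ}

theorem sum_smul_rowMul (x : Fin M → 𝓜) (a : Matrix (Fin M) (Fin M) O) (v : Fin M → O) :
    ∑ p, v p • rowMul x a p = ∑ q, a.mulVec v q • x q := by
  simp only [rowMul, Finset.smul_sum, Matrix.mulVec, dotProduct, Finset.sum_smul, ← mul_smul]
  rw [Finset.sum_comm]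
  simp only [mul_comm]

theorem rowMul_coe (a b : Matrix (Fin M) (Fin M) O) (i p : Fin M) :
    rowMul (fun q => (a i q : K)) b p = ((a * b) i p : K) := by
  rw [rowMul, Matrix.mul_apply, AddSubmonoidClass.coe_finsetSum]
  refine Finset.sum_congr rfl fun q _ => ?_
  rw [Algebra.smul_def, mul_comm]
  rfl

/-- Independence: by `φ o = c p`, the first `d` rows of `φ` give functionals that are `c` times dual
to the first `d` columns of `o`. Spanning: in `c = o φ + relations + w (s - 1)`, applied to the
coordinates `v` of a cycle, the relations vanish in `𝓜` and `w (s - 1) v = 0`. Finally `c` is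
invertible in `K`. -/
theorem exists_basis_of_certificate [CharZero K] (f : 𝓜 →ₗ[O] 𝓑) {x : Fin M → 𝓜} {y : Fin M → 𝓑}
    {s t : Matrix (Fin M) (Fin M) O} (hspan : Submodule.span O (Set.range x) = ⊤)
    (hfx : ∀ p, f (x p) = rowMul y (s - 1) p)
    (hx₁ : rowMul x (1 + s) = 0) (hx₂ : rowMul x (1 + t * s + t * s * (t * s)) = 0)
    (hy₁ : rowMul y (1 - t) = 0) (hy₂ : rowMul y (1 - s * s) = 0)
    (hL : ∀ φ : Fin M → K, rowMul φ (1 + s) = 0 → rowMul φ (1 + t * s + t * s * (t * s)) = 0 →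
      ∃ L : 𝓜 →ₗ[O] K, ∀ p, L (x p) = φ p)
    (hL' : ∀ φ : Fin M → K, rowMul φ (1 - t) = 0 → rowMul φ (1 - s * s) = 0 →
      ∃ L : 𝓑 →ₗ[O] K, ∀ p, L (y p) = φ p)
    {d : ℕ} (hd : d ≤ M) {o φ e₁ e₂ u₁ u₂ w : Matrix (Fin M) (Fin M) O} {c : ℤ} (hc : c ≠ 0)
    (h : certDefect s t o φ e₁ e₂ u₁ u₂ w (c : Matrix (Fin M) (Fin M) O) (firstProj O M d) = 0) :
    ∃ b : Module.Basis (Fin d) K (K ⊗[O] LinearMap.ker f), ∀ i, ∃ z : LinearMap.ker f,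
      b i = (1 : K) ⊗ₜ[O] z ∧ (z : 𝓜) = rowMul x o (Fin.castLE hd i) := by
  have h0 : (s - 1) * o = (1 - t) * e₁ + (1 - s * s) * e₂ := sub_eq_zero.mp (congrFun h 0)
  have h1 : φ * (1 + s) = 0 := congrFun h 1
  have h2 : φ * (1 + t * s + t * s * (t * s)) = 0 := congrFun h 2
  have h3 : φ * o = c * firstProj O M d := sub_eq_zero.mp (congrFun h 3)
  have h4 : (c : Matrix (Fin M) (Fin M) O) = o * φ + (1 + s) * u₁ +
    (1 + t * s + t * s * (t * s)) * u₂ + w * (s - 1) := sub_eq_zero.mp (congrFun h 4)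
  have h5 : w * (1 - t) = 0 := congrFun h 5
  have h6 : w * (1 - s * s) = 0 := congrFun h 6
  have h7 : o * firstProj O M d = o := sub_eq_zero.mp (congrFun h 7)
  have hcK : (c : K) ≠ 0 := by exact_mod_cast hc
  have hfx' : (fun p => f (x p)) = rowMul y (s - 1) := funext hfx
  have hfz : ∀ i, f (rowMul x o i) = 0 := fun i => by
    rw [map_rowMul, hfx', ← rowMul_mul, h0, rowMul_add, rowMul_mul, rowMul_mul, hy₁, hy₂,
      zero_rowMul, zero_rowMul, add_zero]
    rfl
  let z : Fin M → LinearMap.ker f := fun i => ⟨rowMul x o i, hfz i⟩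
  have hz0 : ∀ i : Fin M, ¬ (i : ℕ) < d → z i = 0 := fun i hi => by
    apply Subtype.ext
    change rowMul x o i = 0
    rw [rowMul]
    refine Finset.sum_eq_zero fun q _ => ?_
    have : o q i = 0 := by
      rw [← h7, firstProj, Matrix.mul_diagonal, if_neg hi, mul_zero]
    rw [this, zero_smul]
  have hφ : ∀ i : Fin M, ∃ L : 𝓜 →ₗ[O] K, ∀ p, L (x p) = φ i p := fun i =>
    hL _ (by funext p; rw [rowMul_coe, h1]; rfl) (by funext p; rw [rowMul_coe, h2]; rfl)
  have hw : ∀ i : Fin M, ∃ L : 𝓑 →ₗ[O] K, ∀ p, L (y p) = w i p := fun i =>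
    hL' _ (by funext p; rw [rowMul_coe, h5]; rfl) (by funext p; rw [rowMul_coe, h6]; rfl)
  choose Lφ hLφ using hφ
  choose Lw hLw using hw
  let b : Fin d → K ⊗[O] LinearMap.ker f := fun i => (1 : K) ⊗ₜ[O] z (Fin.castLE hd i)
  let Λ : Fin d → (K ⊗[O] LinearMap.ker f →ₗ[K] K) := fun i =>
    ((Lφ (Fin.castLE hd i)) ∘ₗ (LinearMap.ker f).subtype).liftBaseChange K
  have hΛ : ∀ i j, Λ i (b j) = if i = j then (c : K) else 0 := fun i j => by
    simp only [Λ, b, LinearMap.liftBaseChange_tmul, one_smul, LinearMap.comp_apply,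
      Submodule.subtype_apply, z]
    rw [map_rowMul, show (fun q => Lφ (Fin.castLE hd i) (x q)) =
      fun q => (φ (Fin.castLE hd i) q : K) from funext (hLφ _), rowMul_coe, h3, firstProj,
      ← Matrix.diagonal_intCast, Matrix.diagonal_mul_diagonal, Matrix.diagonal_apply]
    simp only [Fin.castLE_inj]
    split_ifs with hij h'
    · simp
    · exact absurd (i.2) h'
    · rfl
  have hli : LinearIndependent K b := by
    rw [Fintype.linearIndependent_iff]
    intro g hg i
    have := congrArg (Λ i) hg
    rw [map_sum, map_zero] at this
    simp only [map_smul, hΛ, smul_eq_mul, mul_ite, mul_zero, Finset.sum_ite_eq, Finset.mem_univ,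
      if_true] at this
    exact (mul_eq_zero.mp this).resolve_right hcK
  have hcz : ∀ m : LinearMap.ker f, ∃ v : Fin M → O, (c : O) • m = ∑ i, v i • z i := by
    rintro ⟨m, hm⟩
    obtain ⟨v, hv⟩ := (Submodule.mem_span_range_iff_exists_fun O).mp
      (show m ∈ Submodule.span O (Set.range x) by rw [hspan]; trivial)
    refine ⟨φ.mulVec v, Subtype.ext ?_⟩
    have hsum : ((∑ i, φ.mulVec v i • z i : LinearMap.ker f) : 𝓜) =
        ∑ i, φ.mulVec v i • rowMul x o i := by
      rw [Submodule.coe_sum]; rfl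
    have hcv : (c : O) • m = ∑ p, v p • rowMul x (c : Matrix (Fin M) (Fin M) O) p := by
      rw [← hv, Finset.smul_sum, sum_smul_rowMul]
      refine Finset.sum_congr rfl fun p _ => ?_
      rw [← Matrix.diagonal_intCast, Matrix.mulVec_diagonal, mul_smul]
    -- The rows of `w` kill the relations of `𝓑` and so define functionals there; `(s - 1) v`
    -- represents the boundary of `m`, which is zero.
    have hs : (s - 1).mulVec v ∈ {u : Fin M → O | w.mulVec u = 0} := by
      have h8 : ∑ q, (s - 1).mulVec v q • y q = 0 := by
        rw [← sum_smul_rowMul, ← (LinearMap.mem_ker.mp hm), ← hv, map_sum]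
        simp only [map_smul, hfx]
      funext i
      have h9 := congrArg (Lw i) h8
      rw [map_sum, map_zero] at h9
      simp only [map_smul, hLw] at h9
      apply Subtype.ext
      rw [Matrix.mulVec, dotProduct, AddSubmonoidClass.coe_finsetSum]
      refine Eq.trans (Finset.sum_congr rfl fun q _ => ?_) h9
      rw [Algebra.smul_def, mul_comm]
      rfl
    change (c : O) • m = _
    rw [hsum, hcv, h4, rowMul_add, rowMul_add, rowMul_add, rowMul_mul x (1 + s), hx₁, zero_rowMul,
      rowMul_mul x (1 + t * s + t * s * (t * s)), hx₂, zero_rowMul, add_zero, add_zero]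
    simp only [Pi.add_apply, smul_add, Finset.sum_add_distrib]
    rw [sum_smul_rowMul x (w * (s - 1)), ← Matrix.mulVec_mulVec, hs,
      sum_smul_rowMul x (o * φ), sum_smul_rowMul x o, Matrix.mulVec_mulVec]
    simp
  have hsp : ⊤ ≤ Submodule.span K (Set.range b) := by
    rintro τ -
    induction τ using TensorProduct.induction_on with
    | zero => exact Submodule.zero_mem _
    | add a b ha hb => exact Submodule.add_mem _ ha hb
    | tmul k m =>
      obtain ⟨v, hv⟩ := hcz m
      have hk : k ⊗ₜ[O] m = ∑ i, (k / c * v i) • ((1 : K) ⊗ₜ[O] z i) := by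
        have : k = (c : O) • (k / c) := by
          rw [Algebra.smul_def, map_intCast, mul_div_cancel₀ _ hcK]
        conv_lhs => rw [this, TensorProduct.smul_tmul, hv, TensorProduct.tmul_sum]
        refine Finset.sum_congr rfl fun i _ => ?_
        rw [← TensorProduct.smul_tmul, TensorProduct.smul_tmul', smul_eq_mul, mul_one,
          Algebra.smul_def, mul_comm]
        rfl
      rw [hk]
      refine Submodule.sum_mem _ fun i _ => Submodule.smul_mem _ _ ?_
      by_cases hi : (i : ℕ) < d
      · exact Submodule.subset_span ⟨⟨i, hi⟩, rfl⟩
      · rw [hz0 i hi, TensorProduct.tmul_zero]; exact Submodule.zero_mem _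
  exact ⟨Module.Basis.mk hli hsp, fun i => ⟨z (Fin.castLE hd i), by
    rw [Module.Basis.mk_apply], rfl⟩⟩

end Soundness

end ModSym

namespace ModSym

/-! ### Vanishing at a primitive root of unity -/

section Vanishing

open Polynomial

/-- A polynomial which vanishes at all `n`-th roots of unity except at the primitive ones. -/
noncomputable def imprimitivePoly (n : ℕ) : ℤ[X] := ∏ i ∈ Finset.range (n - 1), (1 - X ^ (i + 1))

variable {K : Type*} [Field K] {ζ : K} {n : ℕ}

theorem aeval_imprimitivePoly_ne_zero (hζ : IsPrimitiveRoot ζ n) :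
    aeval ζ (imprimitivePoly n) ≠ 0 := by
  rw [imprimitivePoly, map_prod, Finset.prod_ne_zero_iff]
  intro i hi
  have hi' : i + 1 < n := by have := Finset.mem_range.mp hi; omega
  rw [map_sub, map_one, map_pow, aeval_X, sub_ne_zero]
  exact (hζ.pow_ne_one_of_pos_of_lt (Nat.succ_ne_zero i) hi').symm

/-- `X^n - 1` is the product of the cyclotomic polynomials of the divisors of `n`. For a proper
divisor `i`, the `i`-th one divides the factor `1 - X^i` of `imprimitivePoly n`. -/
theorem X_pow_sub_one_dvd_cyclotomic_mul (hn : 0 < n) :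
    (X ^ n - 1 : ℤ[X]) ∣ imprimitivePoly n * cyclotomic n ℤ := by
  rw [← prod_cyclotomic_eq_X_pow_sub_one hn, ← Nat.cons_self_properDivisors hn.ne',
    Finset.prod_cons, mul_comm]
  refine mul_dvd_mul_right ?_ _
  have h1 : ∏ i ∈ n.properDivisors, cyclotomic i ℤ ∣ ∏ i ∈ n.properDivisors, (1 - X ^ i : ℤ[X]) :=
    Finset.prod_dvd_prod_of_dvd _ _ fun i _ => by
      rw [← neg_sub, dvd_neg]; exact cyclotomic.dvd_X_pow_sub_one i ℤ
  refine h1.trans ?_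
  have h2 : imprimitivePoly n = ∏ i ∈ Finset.Ico 1 n, (1 - X ^ i : ℤ[X]) := by
    rw [Finset.prod_Ico_eq_prod_range, imprimitivePoly]
    simp only [add_comm]
  rw [h2]
  refine Finset.prod_dvd_prod_of_subset _ _ _ fun i hi => ?_
  rw [Nat.mem_properDivisors] at hi
  exact Finset.mem_Ico.mpr ⟨Nat.pos_of_dvd_of_pos hi.1 hn, hi.2⟩

/-- The factor `imprimitivePoly n` does not vanish at `ζ` and supplies all other cyclotomic factors
of `X^n - 1`. The test therefore never mentions the cyclotomic polynomial itself. -/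
theorem aeval_eq_zero_iff [CharZero K] (hn : 0 < n) (hζ : IsPrimitiveRoot ζ n) (p : ℤ[X]) :
    aeval ζ p = 0 ↔ (X ^ n - 1 : ℤ[X]) ∣ imprimitivePoly n * p := by
  constructor
  · intro h
    have h1 : cyclotomic n ℤ ∣ p := by
      rw [cyclotomic_eq_minpoly hζ hn]
      exact minpoly.isIntegrallyClosed_dvd (hζ.isIntegral hn) h
    exact (X_pow_sub_one_dvd_cyclotomic_mul hn).trans (mul_dvd_mul_left _ h1)
  · rintro ⟨q, hq⟩
    have h := congrArg (aeval ζ) hq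
    rw [map_mul, map_mul, map_sub, map_pow, aeval_X, map_one, hζ.pow_eq_one, sub_self,
      zero_mul] at h
    exact (mul_eq_zero.mp h).resolve_left (aeval_imprimitivePoly_ne_zero hζ)

theorem natDegree_imprimitivePoly_le (n : ℕ) : (imprimitivePoly n).natDegree ≤ n * n := by
  refine (natDegree_prod_le _ _).trans ?_
  have h : ∀ i ∈ Finset.range (n - 1), (1 - X ^ (i + 1) : ℤ[X]).natDegree ≤ n := fun i hi => by
    have hi' : i + 1 < n := by have := Finset.mem_range.mp hi; omega
    refine (natDegree_sub_le _ _).trans ?_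
    simp only [natDegree_one, natDegree_X_pow]
    omega
  refine (Finset.sum_le_card_nsmul _ _ _ h).trans ?_
  rw [Finset.card_range, smul_eq_mul]
  exact Nat.mul_le_mul_right _ (Nat.sub_le _ _)

theorem eval_imprimitivePoly (n : ℕ) (t : ℤ) :
    (imprimitivePoly n).eval t = ∏ i ∈ Finset.range (n - 1), (1 - t ^ (i + 1)) := by
  simp [imprimitivePoly, eval_prod]

end Vanishing

/-! ### Polynomial matrices -/

section PolyMatrix

open Polynomial

variable {M : ℕ}

/-- All entries of `A` have degree at most `b`. -/
def DegLE (b : ℕ) (A : Matrix (Fin M) (Fin M) ℤ[X]) : Prop := ∀ i j, (A i j).natDegree ≤ b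

variable {a b : ℕ} {A B : Matrix (Fin M) (Fin M) ℤ[X]}

theorem DegLE.mono (h : DegLE a A) (hab : a ≤ b) : DegLE b A := fun i j => (h i j).trans hab

theorem DegLE.add (hA : DegLE a A) (hB : DegLE b B) : DegLE (max a b) (A + B) := fun i j =>
  (natDegree_add_le _ _).trans (max_le_max (hA i j) (hB i j))

theorem DegLE.sub (hA : DegLE a A) (hB : DegLE b B) : DegLE (max a b) (A - B) := fun i j =>
  (natDegree_sub_le _ _).trans (max_le_max (hA i j) (hB i j))

theorem DegLE.mul (hA : DegLE a A) (hB : DegLE b B) : DegLE (a + b) (A * B) := fun i j => by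
  rw [Matrix.mul_apply]
  exact natDegree_sum_le_of_forall_le _ _ fun l _ =>
    natDegree_mul_le.trans (add_le_add (hA i l) (hB l j))

theorem DegLE.diagonal (f : Fin M → ℤ) : DegLE 0 (Matrix.diagonal fun i => (C (f i) : ℤ[X])) := by
  intro i j
  rw [Matrix.diagonal_apply]
  split_ifs <;> simp

theorem DegLE.one : DegLE 0 (1 : Matrix (Fin M) (Fin M) ℤ[X]) := by
  simpa using DegLE.diagonal (M := M) fun _ => 1

theorem DegLE.intCast (c : ℤ) : DegLE 0 (c : Matrix (Fin M) (Fin M) ℤ[X]) := by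
  have := DegLE.diagonal (M := M) fun _ => c
  simpa [← Matrix.diagonal_intCast] using this

theorem DegLE.firstProj (d : ℕ) : DegLE 0 (firstProj ℤ[X] M d) := by
  have := DegLE.diagonal (M := M) fun i => if (i : ℕ) < d then 1 else 0
  simpa [ModSym.firstProj, apply_ite] using this

/-- The largest terms are `(ts)² u₂`, of degree at most `4n + L`, and products such as `o φ`, of
degree at most `2L`. -/
theorem DegLE.certDefect {n L d : ℕ} {s t o φ e₁ e₂ u₁ u₂ w : Matrix (Fin M) (Fin M) ℤ[X]} {c : ℤ}
    (hs : DegLE n s) (ht : DegLE n t) (ho : DegLE L o) (hφ : DegLE L φ) (h₁ : DegLE L e₁)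
    (h₂ : DegLE L e₂) (h₃ : DegLE L u₁) (h₄ : DegLE L u₂) (hw : DegLE L w) (i : Fin 8) :
    DegLE (4 * n + 2 * L) (certDefect s t o φ e₁ e₂ u₁ u₂ w (c : Matrix (Fin M) (Fin M) ℤ[X])
      (ModSym.firstProj ℤ[X] M d) i) := by
  have hp := DegLE.firstProj (M := M) d
  have hc := DegLE.intCast (M := M) c
  have h1 := DegLE.one (M := M)
  have hu := (h1.add (ht.mul hs)).add ((ht.mul hs).mul (ht.mul hs))
  fin_cases i
  · exact (((hs.sub h1).mul ho).sub
      (((h1.sub ht).mul h₁).add ((h1.sub (hs.mul hs)).mul h₂))).mono (by omega)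
  · exact (hφ.mul (h1.add hs)).mono (by omega)
  · exact (hφ.mul hu).mono (by omega)
  · exact ((hφ.mul ho).sub (hc.mul hp)).mono (by omega)
  · exact (hc.sub ((((ho.mul hφ).add ((h1.add hs).mul h₃)).add (hu.mul h₄)).add
      (hw.mul (hs.sub h1)))).mono (by omega)
  · exact (hw.mul (h1.sub ht)).mono (by omega)
  · exact (hw.mul (h1.sub (hs.mul hs))).mono (by omega)
  · exact ((ho.mul hp).sub ho).mono (by omega)

variable {K : Type*} [Field K]

/-- The evaluation of polynomial matrices at an element of a ring. -/
noncomputable def evalMat {R : Type*} [CommRing R] (M : ℕ) (z : R) :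
    Matrix (Fin M) (Fin M) ℤ[X] →+* Matrix (Fin M) (Fin M) R :=
  (aeval z : ℤ[X] →ₐ[ℤ] R).toRingHom.mapMatrix

theorem evalMat_apply {R : Type*} [CommRing R] (z : R) (A : Matrix (Fin M) (Fin M) ℤ[X])
    (i j : Fin M) : evalMat M z A i j = aeval z (A i j) := rfl

theorem map_firstProj {R S F : Type*} [Ring R] [Ring S] [FunLike F R S] [RingHomClass F R S] (f : F)
    (M d : ℕ) : (firstProj R M d).map f = firstProj S M d := by
  rw [firstProj, Matrix.diagonal_map (map_zero f), firstProj]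
  congr 1
  funext i
  simp [apply_ite f]

theorem evalMat_firstProj {R : Type*} [CommRing R] (z : R) (d : ℕ) :
    evalMat M z (firstProj ℤ[X] M d) = firstProj R M d :=
  map_firstProj (aeval z : ℤ[X] →ₐ[ℤ] R).toRingHom M d

/-- All eight expressions are homogeneous if `o, φ, e₁, e₂` have weight one and `u₁, u₂, w, c` have
weight two, so denominators can be cleared. -/
theorem certDefect_scale {A : Type*} [Ring A] {s t o φ e₁ e₂ u₁ u₂ w p : A} (N : ℤ)
    (h : certDefect s t o φ e₁ e₂ u₁ u₂ w 1 p = 0) :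
    certDefect s t (N * o) (N * φ) (N * e₁) (N * e₂) (N * (N * u₁)) (N * (N * u₂)) (N * (N * w))
      ((N * N : ℤ) : A) p = 0 := by
  have hcomm : ∀ x y : A, x * (N * y) = N * (x * y) := fun x y => by
    rw [← mul_assoc, ← (Int.cast_commute N x).eq, mul_assoc]
  have e : certDefect s t (N * o) (N * φ) (N * e₁) (N * e₂) (N * (N * u₁)) (N * (N * u₂))
      (N * (N * w)) ((N * N : ℤ) : A) p = fun i : Fin 8 =>
      (![(N : A), N, N, N * N, N * N, N * N, N * N, N] i) *
        certDefect s t o φ e₁ e₂ u₁ u₂ w 1 p i := by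
    funext i
    fin_cases i <;>
      simp [certDefect, hcomm, mul_assoc, mul_sub, mul_add]
  rw [e, h]
  funext i
  simp

theorem exists_clear_denominators [CharZero K] {ζ : K} (hζ : Algebra.adjoin ℚ {ζ} = ⊤) {ι : Type*}
    [Finite ι] (x : ι → K) : ∃ N : ℤ, N ≠ 0 ∧ ∃ p : ι → ℤ[X], ∀ i, aeval ζ (p i) = N * x i := by
  have := Fintype.ofFinite ι
  have h1 : ∀ i, ∃ N : ℤ, N ≠ 0 ∧ ∃ p : ℤ[X], aeval ζ p = N * x i := by
    intro i
    have hx : x i ∈ Algebra.adjoin ℚ {ζ} := by rw [hζ]; trivial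
    rw [Algebra.adjoin_singleton_eq_range_aeval] at hx
    obtain ⟨f, hf⟩ := hx
    obtain ⟨b, hb₀, hb⟩ := IsLocalization.integerNormalization_spec (nonZeroDivisors ℤ) f
    refine ⟨b, nonZeroDivisors.ne_zero hb₀,
      IsLocalization.integerNormalization (nonZeroDivisors ℤ) f, ?_⟩
    have h2 := congrArg (aeval ζ) hb
    rw [aeval_map_algebraMap] at h2
    rw [h2, map_zsmul]
    change _ • aeval ζ f = _
    have hf' : aeval ζ f = x i := hf
    rw [hf', zsmul_eq_mul]
  choose N hN p hp using h1
  classical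
  refine ⟨∏ i, N i, Finset.prod_ne_zero_iff.mpr fun i _ => hN i,
    fun i => C (∏ j ∈ Finset.univ.erase i, N j) * p i, fun i => ?_⟩
  rw [map_mul, hp, aeval_C, ← Finset.mul_prod_erase _ _ (Finset.mem_univ i)]
  simp only [eq_intCast, Int.cast_mul]
  ring

theorem exists_poly_certificate [CharZero K] {ζ : K} {n : ℕ} (hn : 0 < n) (hζ : IsPrimitiveRoot ζ n)
    (htop : Algebra.adjoin ℚ {ζ} = ⊤) (s t : Matrix (Fin M) (Fin M) ℤ[X])
    (hst : evalMat M ζ (t * s * (t * s) * (t * s)) = evalMat M ζ (s * s)) :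
    ∃ d ≤ M, ∃ c : ℤ, c ≠ 0 ∧ ∃ (x : Fin 7 → Matrix (Fin M) (Fin M) ℤ[X])
      (q : Fin 8 → Matrix (Fin M) (Fin M) ℤ[X]),
      ∀ i, imprimitivePoly n • certDefect s t (x 0) (x 1) (x 2) (x 3) (x 4) (x 5) (x 6)
        (c : Matrix (Fin M) (Fin M) ℤ[X]) (firstProj ℤ[X] M d) i = (X ^ n - 1 : ℤ[X]) • q i := by
  obtain ⟨d, hd, o, φ, e₁, e₂, u₁, u₂, w, h⟩ := exists_certificate (evalMat M ζ s) (evalMat M ζ t)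
    (by simpa only [map_mul] using hst)
  obtain ⟨N, hN, p, hp⟩ := exists_clear_denominators htop
    (fun j : Fin 7 × Fin M × Fin M => ![o, φ, e₁, e₂, u₁, u₂, w] j.1 j.2.1 j.2.2)
  let y : Fin 7 → Matrix (Fin M) (Fin M) ℤ[X] := fun i => Matrix.of fun a b => p (i, a, b)
  have hy : ∀ i, evalMat M ζ (y i) =
      (N : Matrix (Fin M) (Fin M) K) * ![o, φ, e₁, e₂, u₁, u₂, w] i := fun i => by
    ext a b
    rw [evalMat_apply, ← Matrix.diagonal_intCast, Matrix.diagonal_mul]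
    exact hp (i, a, b)
  -- The matrices of weight two receive a second factor `N`; correspondingly `c = N²`.
  let x : Fin 7 → Matrix (Fin M) (Fin M) ℤ[X] :=
    ![y 0, y 1, y 2, y 3, N * y 4, N * y 5, N * y 6]
  have hx : ∀ i, evalMat M ζ (certDefect s t (x 0) (x 1) (x 2) (x 3) (x 4) (x 5) (x 6)
      ((N * N : ℤ) : Matrix (Fin M) (Fin M) ℤ[X]) (firstProj ℤ[X] M d) i) = 0 := by
    intro i
    rw [map_certDefect]
    have := congrFun (certDefect_scale N h) i
    simp only [x, Matrix.cons_val, map_mul, map_intCast, hy, evalMat_firstProj]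
    simpa using this
  have hq : ∀ i a b, ∃ r : ℤ[X], imprimitivePoly n * certDefect s t (x 0) (x 1) (x 2) (x 3) (x 4)
      (x 5) (x 6) ((N * N : ℤ) : Matrix (Fin M) (Fin M) ℤ[X]) (firstProj ℤ[X] M d) i a b =
        (X ^ n - 1 : ℤ[X]) * r := by
    intro i a b
    exact (aeval_eq_zero_iff hn hζ _).mp (congrFun (congrFun (hx i) a) b)
  choose q hq using hq
  exact ⟨d, hd, N * N, mul_ne_zero hN hN, x, fun i => Matrix.of (q i), fun i => by
    ext1 a b; exact hq i a b⟩

end PolyMatrix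

end ModSym

namespace ModSym

/-! ### Certificates for spaces of modular symbols -/

section Glue

open ModularGroup Polynomial

variable {K : Type} [Field K] {ζ : K}

/-- The generator of `ℤ[ζ]`. -/
def adjoinGen (ζ : K) : ZAdjoin ζ := ⟨ζ, Algebra.self_mem_adjoin_singleton ℤ ζ⟩

/-- The polynomial of degree less than `L` with given coefficients. -/
noncomputable def coeffPoly (L : ℕ) (c : ℕ → ℤ) : ℤ[X] := ∑ l ∈ Finset.range L, C (c l) * X ^ l

theorem aeval_coeffPoly_succ {A : Type*} [CommRing A] (z : A) (L : ℕ) (c : ℕ → ℤ) :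
    aeval z (coeffPoly (L + 1) c) = c 0 + z * aeval z (coeffPoly L fun l => c (l + 1)) := by
  simp only [coeffPoly, Finset.sum_range_succ', map_add, map_sum, map_mul, map_pow, aeval_X,
    pow_zero, mul_one, Finset.mul_sum, eq_intCast]
  rw [add_comm, map_intCast]
  refine congrArg (fun y => (c 0 : A) + y) (Finset.sum_congr rfl fun l _ => ?_)
  rw [pow_succ]; ring

theorem evalCoeff_map_range (L : ℕ) (c : ℕ → ℤ) :
    evalCoeff ζ ((List.range L).map c) = aeval (adjoinGen ζ) (coeffPoly L c) := by
  induction L generalizing c with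
  | zero => simp [evalCoeff, coeffPoly]
  | succ L ih =>
    rw [aeval_coeffPoly_succ, ← ih, List.range_succ_eq_map, List.map_cons, List.map_map]
    rfl

theorem evalMat_actMat {A : Type*} [CommRing A] (z : A) (N d : ℕ) (coef : ℕ → ℕ → ℤ)
    (j e : ℕ → ℕ) : evalMat _ z (actMat N d coef j e (X : ℤ[X])) = actMat N d coef j e z := by
  ext q p
  rw [evalMat_apply]
  simp only [actMat, Matrix.of_apply]
  split_ifs <;> simp

theorem eq_of_rowMul_eq {O : Subalgebra ℤ K} {M : ℕ} {a b : Matrix (Fin M) (Fin M) O}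
    (h : ∀ φ : Fin M → K, rowMul φ a = rowMul φ b) : a = b := by
  have h1 : ∀ (a : Matrix (Fin M) (Fin M) O) q p,
      rowMul (Pi.single q (1 : K)) a p = (a q p : K) := fun a q p => by
    rw [rowMul, Finset.sum_eq_single q]
    · rw [Pi.single_eq_same, Algebra.smul_def, mul_one]; rfl
    · intro q' _ hq; rw [Pi.single_eq_of_ne hq, smul_zero]
    · intro h; exact absurd (Finset.mem_univ _) h
  ext q p
  rw [← h1, ← h1, h]

theorem evalMat_coe {M : ℕ} (A : Matrix (Fin M) (Fin M) ℤ[X]) :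
    evalMat M ζ A = (evalMat M (adjoinGen ζ) A).map (fun x => (x : K)) := by
  ext i j
  rw [evalMat_apply, Matrix.map_apply, evalMat_apply]
  exact (aeval_subalgebra_coe (A i j) (ZAdjoin ζ) (adjoinGen ζ)).symm

variable {Γ Γ' : Subgroup SL(2, ℤ)} [(Γ.subgroupOf Γ').Normal] {ε : Γ' ⧸ Γ.subgroupOf Γ' →* Kˣ}

/-- Right multiplication by `X` maps the coset of `r i` to that of `r (j i)`, with factor
`ζ ^ e i`. -/
def IsCosetAction (ζ : K) (ε : Γ' ⧸ Γ.subgroupOf Γ' →* Kˣ) (N : ℕ) (r : ℕ → SL(2, ℤ))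
    (X : SL(2, ℤ)) (j e : ℕ → ℕ) : Prop :=
  ∀ i < N, j i < N ∧ ∃ γ : Γ', r i * X = γ * r (j i) ∧
    (ε (γ : Γ' ⧸ Γ.subgroupOf Γ') : K) = ζ ^ e i

variable {N d : ℕ} {r : ℕ → SL(2, ℤ)} {jS eS jT eT : ℕ → ℕ} {𝓜 : Type} [AddCommGroup 𝓜]
  [Module (ZAdjoin ζ) 𝓜]

theorem rowMul_row_S {m : SL(2, ℤ) → Sym d →ₗ[ℤ] 𝓜} (hm : IsEquivariant (ZAdjoin ζ) ε m)
    (hS : IsCosetAction ζ ε N r S jS eS) :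
    rowMul (row N r m) (actMat N d (coefS d) jS eS (adjoinGen ζ)) = row N r (translate S m) :=
  rowMul_row hm (fun _ h => symRep_S_inv h) hS

theorem rowMul_row_T {m : SL(2, ℤ) → Sym d →ₗ[ℤ] 𝓜} (hm : IsEquivariant (ZAdjoin ζ) ε m)
    (hT : IsCosetAction ζ ε N r T jT eT) :
    rowMul (row N r m) (actMat N d coefT jT eT (adjoinGen ζ)) = row N r (translate T m) :=
  rowMul_row hm (fun _ h => symRep_T_inv h) hT

theorem rowMul_row_ST {m : SL(2, ℤ) → Sym d →ₗ[ℤ] 𝓜} (hm : IsEquivariant (ZAdjoin ζ) ε m)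
    (hS : IsCosetAction ζ ε N r S jS eS) (hT : IsCosetAction ζ ε N r T jT eT) :
    rowMul (row N r m) (actMat N d coefT jT eT (adjoinGen ζ) *
      actMat N d (coefS d) jS eS (adjoinGen ζ)) = row N r (translate (S * T) m) := by
  rw [rowMul_mul, rowMul_row_T hm hT, rowMul_row_S (hm.translate T) hS, translate_translate]

theorem rowMul_row_ST_ST {m : SL(2, ℤ) → Sym d →ₗ[ℤ] 𝓜} (hm : IsEquivariant (ZAdjoin ζ) ε m)
    (hS : IsCosetAction ζ ε N r S jS eS) (hT : IsCosetAction ζ ε N r T jT eT) :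
    rowMul (row N r m) (actMat N d coefT jT eT (adjoinGen ζ) *
      actMat N d (coefS d) jS eS (adjoinGen ζ) * (actMat N d coefT jT eT (adjoinGen ζ) *
      actMat N d (coefS d) jS eS (adjoinGen ζ))) =
        row N r (translate (S * T) (translate (S * T) m)) := by
  rw [rowMul_mul _ (_ * _), rowMul_row_ST hm hS hT, rowMul_row_ST (hm.translate _) hS hT]

/-- Every row over `K` is the row of an equivariant family, and on families the identity is `(ST)³ =
-1 = S²`. -/
theorem actMat_relation (hr : ∀ g, ∃! i, i < N ∧ g * (r i)⁻¹ ∈ Γ')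
    (hS : IsCosetAction ζ ε N r S jS eS) (hT : IsCosetAction ζ ε N r T jT eT) :
    let s := actMat N d (coefS d) jS eS (X : ℤ[X])
    let t := actMat N d coefT jT eT (X : ℤ[X])
    evalMat _ ζ (t * s * (t * s) * (t * s)) = evalMat _ ζ (s * s) := by
  intro s t
  rw [evalMat_coe, evalMat_coe]
  congr 1
  simp only [map_mul, s, t, evalMat_actMat]
  apply eq_of_rowMul_eq
  intro φ
  obtain ⟨m, hm, rfl⟩ := exists_family (O := ZAdjoin ζ) (ε := ε) hr φ
  rw [rowMul_mul _ (_ * _ * (_ * _)), rowMul_row_ST_ST hm hS hT,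
    rowMul_row_ST ((hm.translate _).translate _) hS hT,
    rowMul_mul, rowMul_row_S hm hS, rowMul_row_S (hm.translate _) hS]
  simp only [translate_translate]
  rw [← mul_assoc (S * T), ST_cubed, S_mul_S]

variable {k : ℕ}

theorem row_add (m m' : SL(2, ℤ) → Sym d →ₗ[ℤ] 𝓜) :
    row N r (m + m') = row N r m + row N r m' := rfl

theorem row_sub (m m' : SL(2, ℤ) → Sym d →ₗ[ℤ] 𝓜) :
    row N r (m - m') = row N r m - row N r m' := rfl

theorem row_zero : row N r (0 : SL(2, ℤ) → Sym d →ₗ[ℤ] 𝓜) = 0 := rfl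

theorem IsEquivariant.add {m m' : SL(2, ℤ) → Sym d →ₗ[ℤ] 𝓜} (h : IsEquivariant (ZAdjoin ζ) ε m)
    (h' : IsEquivariant (ZAdjoin ζ) ε m') : IsEquivariant (ZAdjoin ζ) ε (m + m') :=
  fun γ c hc g P => by
    simp only [Pi.add_apply, LinearMap.add_apply, h γ c hc g P, h' γ c hc g P, smul_add]

theorem IsEquivariant.sub {m m' : SL(2, ℤ) → Sym d →ₗ[ℤ] 𝓜} (h : IsEquivariant (ZAdjoin ζ) ε m)
    (h' : IsEquivariant (ZAdjoin ζ) ε m') : IsEquivariant (ZAdjoin ζ) ε (m - m') :=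
  fun γ c hc g P => by
    simp only [Pi.sub_apply, LinearMap.sub_apply, h γ c hc g P, h' γ c hc g P, smul_sub]

theorem IsEquivariant.eq_zero_of_row {m : SL(2, ℤ) → Sym d →ₗ[ℤ] 𝓜}
    (hm : IsEquivariant (ZAdjoin ζ) ε m)
    (hε : ∀ γ : Γ', ∃ c : ZAdjoin ζ, (c : K) = (ε (γ : Γ' ⧸ Γ.subgroupOf Γ') : K))
    (hr : ∀ g, ∃! i, i < N ∧ g * (r i)⁻¹ ∈ Γ') (h : row N r m = 0) : m = 0 :=
  funext fun g => LinearMap.ext fun P => hm.eq_zero hε hr h g P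

/-- An equivariant family is determined by its row, so matrix relations for a row `φ` are relations
for the family that extends it; the two existence theorems for functionals then apply. -/
theorem exists_cuspidal_basis [CharZero K] (hΓ : Γ ≤ Γ')
    (hε : ∀ γ : Γ', ∃ c : ZAdjoin ζ, (c : K) = (ε (γ : Γ' ⧸ Γ.subgroupOf Γ') : K))
    (hr : ∀ g, ∃! i, i < N ∧ g * (r i)⁻¹ ∈ Γ')
    (hS : IsCosetAction ζ ε N r S jS eS) (hT : IsCosetAction ζ ε N r T jT eT)
    {d : ℕ} (hd : d ≤ N * (k - 2 + 1))
    {o φ e₁ e₂ u₁ u₂ w : Matrix (Fin (N * (k - 2 + 1))) (Fin (N * (k - 2 + 1))) (ZAdjoin ζ)}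
    {c : ℤ} (hc : c ≠ 0)
    (h : certDefect (actMat N (k - 2) (coefS (k - 2)) jS eS (adjoinGen ζ))
      (actMat N (k - 2) coefT jT eT (adjoinGen ζ)) o φ e₁ e₂ u₁ u₂ w
      (c : Matrix (Fin (N * (k - 2 + 1))) (Fin (N * (k - 2 + 1))) (ZAdjoin ζ))
      (firstProj (ZAdjoin ζ) _ d) = 0) :
    ∃ b : Module.Basis (Fin d) K (K ⊗[ZAdjoin ζ] cuspidal ζ ε k), ∀ i, ∃ z : cuspidal ζ ε k,
      b i = (1 : K) ⊗ₜ[ZAdjoin ζ] z ∧ (z : ModularSymbols ζ ε k) =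
        rowMul (row N r (maninFamily (ZAdjoin ζ) ε k)) o (Fin.castLE hd i) := by
  have hM := maninFamily_equivariant (O := ZAdjoin ζ) (ε := ε) (k := k)
  have hB := cuspFamily_equivariant (O := ZAdjoin ζ) (ε := ε) (k := k)
  refine exists_basis_of_certificate (boundary ζ ε k)
    (y := row N r (cuspFamily (ZAdjoin ζ) ε k)) (span_row_maninFamily hε hr) ?_ ?_ ?_ ?_ ?_ ?_ ?_
    hd hc h
  · intro p
    rw [rowMul_sub, rowMul_one, rowMul_row_S hB hS]
    exact boundary_maninFamily _ _
  · rw [rowMul_add, rowMul_one, rowMul_row_S hM hS, ← row_add, maninFamily_S, row_zero]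
  · rw [rowMul_add, rowMul_add, rowMul_one, rowMul_row_ST hM hS hT,
      rowMul_row_ST_ST hM hS hT, ← row_add, ← row_add, maninFamily_ST, row_zero]
  · rw [rowMul_sub, rowMul_one, rowMul_row_T hB hT, cuspFamily_T, sub_self]
  · rw [rowMul_sub, rowMul_one, rowMul_mul, rowMul_row_S hB hS, rowMul_row_S (hB.translate _) hS,
      cuspFamily_S_S, sub_self]
  · intro φ h1 h2
    obtain ⟨m, hm, rfl⟩ := exists_family (O := ZAdjoin ζ) (ε := ε) hr φ
    rw [rowMul_add, rowMul_one, rowMul_row_S hm hS, ← row_add] at h1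
    rw [rowMul_add, rowMul_add, rowMul_one, rowMul_row_ST hm hS hT,
      rowMul_row_ST_ST hm hS hT, ← row_add, ← row_add] at h2
    obtain ⟨L, hL⟩ := exists_hom_of_manin_relations hΓ hε hm
      ((hm.add (hm.translate _)).eq_zero_of_row hε hr h1)
      (((hm.add (hm.translate _)).add ((hm.translate _).translate _)).eq_zero_of_row hε hr h2)
    exact ⟨L, fun p => hL _ _⟩
  · intro φ h1 h2
    obtain ⟨m, hm, rfl⟩ := exists_family (O := ZAdjoin ζ) (ε := ε) hr φ
    rw [rowMul_sub, rowMul_one, rowMul_row_T hm hT, ← row_sub] at h1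
    rw [rowMul_sub, rowMul_one, rowMul_mul, rowMul_row_S hm hS, rowMul_row_S (hm.translate _) hS,
      ← row_sub] at h2
    obtain ⟨L, hL⟩ := exists_hom_of_cusp_relations hΓ hε hm
      (sub_eq_zero.mp ((hm.sub (hm.translate _)).eq_zero_of_row hε hr h1)).symm
      (sub_eq_zero.mp ((hm.sub ((hm.translate _).translate _)).eq_zero_of_row hε hr h2)).symm
    exact ⟨L, fun p => hL _ _⟩

/-- The output listing the first `d` columns of the matrix of polynomials with coefficients `cf`. -/
def outputList (M m d L : ℕ) (cf : ℕ → ℕ → ℕ → ℤ) : Output :=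
  (List.range d).map fun i => (List.range M).map fun p =>
    ((List.range L).map (cf p i), p % (m + 1), p / (m + 1))

theorem evalCombination_outputList {R' : List SL(2, ℤ)} (L i : ℕ) (cf : ℕ → ℕ → ℕ → ℤ)
    (o : Matrix (Fin (N * (k - 2 + 1))) (Fin (N * (k - 2 + 1))) (ZAdjoin ζ))
    (hi : i < N * (k - 2 + 1))
    (ho : ∀ p, o p ⟨i, hi⟩ = aeval (adjoinGen ζ) (coeffPoly L (cf p i))) :
    evalCombination ζ ε k R' ((List.range (N * (k - 2 + 1))).map fun p =>
        ((List.range L).map (cf p i), p % (k - 2 + 1), p / (k - 2 + 1))) =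
      rowMul (row N (fun j => R'.getD j 1) (maninFamily (ZAdjoin ζ) ε k)) o ⟨i, hi⟩ := by
  rw [evalCombination, List.map_map, rowMul]
  have h : ∀ f : ℕ → ModularSymbols ζ ε k, ((List.range (N * (k - 2 + 1))).map f).sum =
      ∑ p : Fin (N * (k - 2 + 1)), f p := fun f => by
    rw [← Finset.sum_range]; rfl
  rw [h]
  refine Finset.sum_congr rfl fun p _ => ?_
  simp only [Function.comp_apply]
  rw [evalCoeff_map_range, ho]
  rfl

theorem isCuspidalBasis_of_poly_certificate [CharZero K] {n : ℕ} (hn : 0 < n) (hζ : IsPrimitiveRoot ζ n)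
    (hΓ : Γ ≤ Γ')
    (hε : ∀ γ : Γ', ∃ c : ZAdjoin ζ, (c : K) = (ε (γ : Γ' ⧸ Γ.subgroupOf Γ') : K))
    {R' : List SL(2, ℤ)} (hr : ∀ g, ∃! i, i < N ∧ g * (R'.getD i 1)⁻¹ ∈ Γ')
    (hS : IsCosetAction ζ ε N (fun j => R'.getD j 1) S jS eS)
    (hT : IsCosetAction ζ ε N (fun j => R'.getD j 1) T jT eT)
    {d L : ℕ} (hd : d ≤ N * (k - 2 + 1)) {c : ℤ} (hc : c ≠ 0) (cf : ℕ → ℕ → ℕ → ℤ)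
    (x : Fin 7 → Matrix (Fin (N * (k - 2 + 1))) (Fin (N * (k - 2 + 1))) ℤ[X])
    (q : Fin 8 → Matrix (Fin (N * (k - 2 + 1))) (Fin (N * (k - 2 + 1))) ℤ[X])
    (hx : ∀ p i, x 0 p i = coeffPoly L (cf p i))
    (h : ∀ i, imprimitivePoly n • certDefect (actMat N (k - 2) (coefS (k - 2)) jS eS (X : ℤ[X]))
      (actMat N (k - 2) coefT jT eT (X : ℤ[X])) (x 0) (x 1) (x 2) (x 3) (x 4) (x 5) (x 6)
        (c : Matrix (Fin (N * (k - 2 + 1))) (Fin (N * (k - 2 + 1))) ℤ[X])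
        (firstProj ℤ[X] _ d) i = (X ^ n - 1 : ℤ[X]) • q i) :
    IsCuspidalBasis ζ ε k R' (outputList (N * (k - 2 + 1)) (k - 2) d L cf) := by
  obtain ⟨b, hb⟩ := exists_cuspidal_basis (k := k) hΓ hε hr hS hT hd hc
    (o := evalMat _ (adjoinGen ζ) (x 0)) (φ := evalMat _ (adjoinGen ζ) (x 1))
    (e₁ := evalMat _ (adjoinGen ζ) (x 2)) (e₂ := evalMat _ (adjoinGen ζ) (x 3))
    (u₁ := evalMat _ (adjoinGen ζ) (x 4)) (u₂ := evalMat _ (adjoinGen ζ) (x 5))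
    (w := evalMat _ (adjoinGen ζ) (x 6)) (by
      funext i
      rw [← evalMat_actMat (adjoinGen ζ) _ _ coefT, ← evalMat_actMat (adjoinGen ζ) _ _ (coefS _),
        ← evalMat_firstProj (adjoinGen ζ),
        ← map_intCast (evalMat (N * (k - 2 + 1)) (adjoinGen ζ)), ← map_certDefect]
      ext p p'
      rw [Pi.zero_apply, Matrix.zero_apply, evalMat_apply]
      -- The certificate identity with quotient `q i` is the divisibility criterion for vanishing at
      -- `ζ`.
      refine (aeval_subalgebra_coe _ _ _).trans ((aeval_eq_zero_iff hn hζ _).mpr ⟨q i p p', ?_⟩)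
      exact congrFun (congrFun (h i) p) p')
  have hlen : (outputList (N * (k - 2 + 1)) (k - 2) d L cf).length = d := by simp [outputList]
  refine ⟨b.reindex (finCongr hlen.symm), fun i => ?_⟩
  obtain ⟨z, hz, hz'⟩ := hb (Fin.cast hlen i)
  refine ⟨z, ?_, ?_⟩
  · rw [Module.Basis.reindex_apply, ← hz]; rfl
  · rw [hz']
    have hi : (i : ℕ) < N * (k - 2 + 1) := (i.2.trans_eq hlen).trans_le hd
    have hget : (outputList (N * (k - 2 + 1)) (k - 2) d L cf).get i =
      (List.range (N * (k - 2 + 1))).map fun p =>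
        ((List.range L).map (cf p i), p % (k - 2 + 1), p / (k - 2 + 1)) := by
      rw [List.get_eq_getElem]; simp [outputList]
    rw [hget]
    exact (evalCombination_outputList L i cf (evalMat _ (adjoinGen ζ) (x 0)) hi
      fun p => by rw [evalMat_apply, hx]).symm

end Glue

end ModSym

namespace ModSym

/-! ### The integer check of a certificate -/

section Check

open Polynomial

/-- The square matrix of size `M` with the entries of `f`. -/
def toMat (M : ℕ) (f : ℕ → ℕ → ℤ) : Matrix (Fin M) (Fin M) ℤ := Matrix.of fun i j => f i j

theorem toMat_apply (M : ℕ) (f : ℕ → ℕ → ℤ) (i j : Fin M) : toMat M f i j = f i j := rfl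

theorem toMat_add (M : ℕ) (f g : ℕ → ℕ → ℤ) : toMat M (f + g) = toMat M f + toMat M g := rfl

theorem toMat_sub (M : ℕ) (f g : ℕ → ℕ → ℤ) : toMat M (f - g) = toMat M f - toMat M g := rfl

theorem toMat_matMul (M : ℕ) (f g : ℕ → ℕ → ℤ) :
    toMat M (matMul M f g) = toMat M f * toMat M g := by
  ext i j
  rw [Matrix.mul_apply, toMat_apply, matMul, Finset.sum_range]
  rfl

/-- The diagonal matrix with `d` entries `c`. -/
def diagFun (c : ℤ) (d i j : ℕ) : ℤ := if i = j ∧ i < d then c else 0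

theorem toMat_diagFun (M d : ℕ) (c : ℤ) : toMat M (diagFun c d) =
    Matrix.diagonal fun i : Fin M => if (i : ℕ) < d then c else 0 := by
  ext i j
  rw [toMat_apply, diagFun, Matrix.diagonal_apply]
  simp only [← Fin.ext_iff, ite_and]

theorem toMat_diagFun_firstProj (M d : ℕ) : toMat M (diagFun 1 d) = firstProj ℤ M d :=
  toMat_diagFun M d 1

theorem toMat_diagFun_scalar (M : ℕ) (c : ℤ) :
    toMat M (diagFun c M) = (c : Matrix (Fin M) (Fin M) ℤ) := by
  rw [toMat_diagFun, ← Matrix.diagonal_intCast]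
  simp

theorem toMat_diagFun_one (M : ℕ) : toMat M (diagFun 1 M) = 1 := by
  rw [toMat_diagFun_scalar, Int.cast_one]

/-- `certDefect` for matrices given by functions on `ℕ × ℕ`. -/
def defectFun (M : ℕ) (s t o φ e₁ e₂ u₁ u₂ w c p : ℕ → ℕ → ℤ) : Fin 8 → ℕ → ℕ → ℤ :=
  let I := diagFun 1 M
  let S := I - matMul M s s
  let U := I + matMul M t s + matMul M (matMul M t s) (matMul M t s)
  ![matMul M (s - I) o - (matMul M (I - t) e₁ + matMul M S e₂),
    matMul M φ (I + s),
    matMul M φ U,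
    matMul M φ o - matMul M c p,
    c - (matMul M o φ + matMul M (I + s) u₁ + matMul M U u₂ + matMul M w (s - I)),
    matMul M w (I - t),
    matMul M w S,
    matMul M o p - o]

theorem toMat_defectFun (M : ℕ) (s t o φ e₁ e₂ u₁ u₂ w c p : ℕ → ℕ → ℤ) (i : Fin 8) :
    toMat M (defectFun M s t o φ e₁ e₂ u₁ u₂ w c p i) =
      certDefect (toMat M s) (toMat M t) (toMat M o) (toMat M φ) (toMat M e₁) (toMat M e₂)
        (toMat M u₁) (toMat M u₂) (toMat M w) (toMat M c) (toMat M p) i := by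
  fin_cases i <;>
    simp [defectFun, certDefect, toMat_add, toMat_sub, toMat_matMul, toMat_diagFun_one]

/-- The value at `t` of the polynomial of degree less than `L` with given coefficients. -/
def coeffEval (L : ℕ) (c : ℕ → ℤ) (t : ℤ) : ℤ := ∑ l ∈ Finset.range L, c l * t ^ l

theorem aeval_coeffPoly (L : ℕ) (c : ℕ → ℤ) (t : ℤ) :
    aeval t (coeffPoly L c) = coeffEval L c t := by
  simp [coeffPoly, coeffEval]

/-- The matrix of polynomials with given coefficients. -/
noncomputable def polyMat (M L : ℕ) (f : ℕ → ℕ → ℕ → ℤ) : Matrix (Fin M) (Fin M) ℤ[X] :=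
  Matrix.of fun a b => coeffPoly L (f a b)

theorem evalMat_polyMat (M L : ℕ) (f : ℕ → ℕ → ℕ → ℤ) (t : ℤ) :
    evalMat M t (polyMat M L f) = toMat M fun a b => coeffEval L (f a b) t := by
  ext a b
  exact aeval_coeffPoly L _ t

theorem natDegree_coeffPoly_le (L : ℕ) (c : ℕ → ℤ) : (coeffPoly L c).natDegree ≤ L :=
  natDegree_sum_le_of_forall_le _ _ fun _ hl =>
    (natDegree_C_mul_X_pow_le _ _).trans (Finset.mem_range.mp hl).le

theorem DegLE.polyMat (M L : ℕ) (f : ℕ → ℕ → ℕ → ℤ) : DegLE L (polyMat M L f) := fun _ _ =>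
  natDegree_coeffPoly_le L _

/-- The entries of the matrix `actMat`. -/
def actFun (d : ℕ) (coef : ℕ → ℕ → ℤ) (j e : ℕ → ℕ) (t : ℤ) (q p : ℕ) : ℤ :=
  if q / (d + 1) = j (p / (d + 1)) then coef (p % (d + 1)) (q % (d + 1)) * t ^ e (p / (d + 1)) else 0

theorem evalMat_actMat_int (N d : ℕ) (coef : ℕ → ℕ → ℤ) (j e : ℕ → ℕ) (t : ℤ) :
    evalMat _ t (actMat N d coef j e (X : ℤ[X])) = toMat _ (actFun d coef j e t) := by
  rw [evalMat_actMat]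
  rfl

theorem DegLE.actMat {N d n : ℕ} {coef : ℕ → ℕ → ℤ} {j e : ℕ → ℕ} (he : ∀ i, e i ≤ n) :
    DegLE n (actMat N d coef j e (X : ℤ[X])) := by
  intro q p
  simp only [ModSym.actMat, Matrix.of_apply]
  split_ifs
  · exact (natDegree_C_mul_X_pow_le _ _).trans (he _)
  · simp

/-- The difference of the two sides of the certificate identity `i` at the integer `t`. -/
def checkEntry (n d : ℕ) (jS eS jT eT : ℕ → ℕ) (M r L : ℕ) (c : ℤ) (f : ℕ → ℕ → ℕ → ℕ → ℤ)
    (i : Fin 8) (t : ℤ) (a b : ℕ) : ℤ :=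
  (∏ i ∈ Finset.range (n - 1), (1 - t ^ (i + 1))) *
    defectFun M (actFun d (coefS d) jS eS t) (actFun d coefT jT eT t)
      (fun a b => coeffEval L (f 0 a b) t) (fun a b => coeffEval L (f 1 a b) t)
      (fun a b => coeffEval L (f 2 a b) t) (fun a b => coeffEval L (f 3 a b) t)
      (fun a b => coeffEval L (f 4 a b) t) (fun a b => coeffEval L (f 5 a b) t)
      (fun a b => coeffEval L (f 6 a b) t) (diagFun c M) (diagFun 1 r) i a b -
  (t ^ n - 1) * coeffEval L (f (7 + i) a b) t

/-- The sum of the squares of the differences in `checkEntry`, over enough values of `t`. -/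
def checkSum (n d : ℕ) (jS eS jT eT : ℕ → ℕ) (M r L : ℕ) (c : ℤ) (f : ℕ → ℕ → ℕ → ℕ → ℤ) : ℤ :=
  ∑ i : Fin 8, ∑ t ∈ Finset.range (n * n + 4 * n + 2 * L + 1), ∑ a ∈ Finset.range M,
    ∑ b ∈ Finset.range M, checkEntry n d jS eS jT eT M r L c f i t a b ^ 2

theorem checkSum_eq_zero_iff {n d : ℕ} {jS eS jT eT : ℕ → ℕ} {M r L : ℕ} {c : ℤ}
    {f : ℕ → ℕ → ℕ → ℕ → ℤ} : checkSum n d jS eS jT eT M r L c f = 0 ↔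
      ∀ i, ∀ t < n * n + 4 * n + 2 * L + 1, ∀ a b : Fin M,
        checkEntry n d jS eS jT eT M r L c f i (t : ℕ) a b = 0 := by
  rw [checkSum, Finset.sum_eq_zero_iff_of_nonneg fun i _ => Finset.sum_nonneg fun t _ =>
    Finset.sum_nonneg fun a _ => Finset.sum_nonneg fun b _ => sq_nonneg _]
  simp only [Finset.mem_univ, true_imp_iff]
  refine forall_congr' fun i => ?_
  rw [Finset.sum_eq_zero_iff_of_nonneg fun t _ =>
    Finset.sum_nonneg fun a _ => Finset.sum_nonneg fun b _ => sq_nonneg _]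
  simp only [Finset.mem_range]
  refine forall_congr' fun t => forall_congr' fun _ => ?_
  rw [Finset.sum_eq_zero_iff_of_nonneg fun a _ => Finset.sum_nonneg fun b _ => sq_nonneg _]
  constructor
  · intro h a b
    exact pow_eq_zero_iff two_ne_zero |>.mp
      ((Finset.sum_eq_zero_iff_of_nonneg fun b _ => sq_nonneg _).mp
        (h a (Finset.mem_range.mpr a.2)) b (Finset.mem_range.mpr b.2))
  · intro h a ha
    refine Finset.sum_eq_zero fun b hb => ?_
    rw [h ⟨a, Finset.mem_range.mp ha⟩ ⟨b, Finset.mem_range.mp hb⟩, zero_pow two_ne_zero]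

/-- The certificate identities for the polynomial matrices with coefficients `f`. -/
def IsPolyCertificate (n N d : ℕ) (jS eS jT eT : ℕ → ℕ) (r L : ℕ) (c : ℤ)
    (f : ℕ → ℕ → ℕ → ℕ → ℤ) : Prop :=
  ∀ i, imprimitivePoly n • certDefect (actMat N d (coefS d) jS eS (X : ℤ[X]))
    (actMat N d coefT jT eT (X : ℤ[X])) (polyMat _ L (f 0)) (polyMat _ L (f 1)) (polyMat _ L (f 2))
    (polyMat _ L (f 3)) (polyMat _ L (f 4)) (polyMat _ L (f 5)) (polyMat _ L (f 6))
    (c : Matrix (Fin (N * (d + 1))) (Fin (N * (d + 1))) ℤ[X]) (firstProj ℤ[X] _ r) i =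
      (X ^ n - 1 : ℤ[X]) • polyMat _ L (f (7 + i))

theorem eval_certificate_entry (n N d : ℕ) (jS eS jT eT : ℕ → ℕ) (r L : ℕ) (c : ℤ)
    (f : ℕ → ℕ → ℕ → ℕ → ℤ) (i : Fin 8) (t : ℤ) (a b : Fin (N * (d + 1))) :
    aeval t (imprimitivePoly n * certDefect (actMat N d (coefS d) jS eS (X : ℤ[X]))
      (actMat N d coefT jT eT (X : ℤ[X])) (polyMat _ L (f 0)) (polyMat _ L (f 1))
      (polyMat _ L (f 2)) (polyMat _ L (f 3)) (polyMat _ L (f 4)) (polyMat _ L (f 5))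
      (polyMat _ L (f 6)) (c : Matrix (Fin (N * (d + 1))) (Fin (N * (d + 1))) ℤ[X])
      (firstProj ℤ[X] _ r) i a b - (X ^ n - 1 : ℤ[X]) * polyMat _ L (f (7 + i)) a b) =
    checkEntry n d jS eS jT eT (N * (d + 1)) r L c f i t a b := by
  rw [map_sub, map_mul, map_mul, ← evalMat_apply, ← evalMat_apply, map_certDefect,
    evalMat_actMat_int, evalMat_actMat_int, evalMat_firstProj, map_intCast]
  simp only [evalMat_polyMat]
  rw [← toMat_diagFun_firstProj, ← toMat_diagFun_scalar, ← toMat_defectFun, toMat_apply,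
    toMat_apply, checkEntry, coe_aeval_eq_eval, eval_imprimitivePoly]
  simp

/-- The difference of the two sides has degree at most `n² + 4n + 2L`, by the bounds on the
exponents, so it vanishes once it does at one more integer than that. -/
theorem isPolyCertificate_iff {n N d : ℕ} {jS eS jT eT : ℕ → ℕ} {r L : ℕ} {c : ℤ}
    {f : ℕ → ℕ → ℕ → ℕ → ℤ} (heS : ∀ i, eS i ≤ n) (heT : ∀ i, eT i ≤ n) :
    IsPolyCertificate n N d jS eS jT eT r L c f ↔
      checkSum n d jS eS jT eT (N * (d + 1)) r L c f = 0 := by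
  rw [checkSum_eq_zero_iff]
  refine forall_congr' fun i => ?_
  simp only [← eval_certificate_entry]
  constructor
  · intro h t _ a b
    have := congrFun (congrFun h a) b
    simp only [Matrix.smul_apply, smul_eq_mul] at this
    rw [this, sub_self, map_zero]
  · intro h
    ext1 a b
    simp only [Matrix.smul_apply, smul_eq_mul]
    rw [← sub_eq_zero]
    have hdeg := (DegLE.certDefect (DegLE.actMat (N := N) (d := d) (coef := coefS d) (j := jS) heS)
      (DegLE.actMat (N := N) (d := d) (coef := coefT) (j := jT) heT)
      (DegLE.polyMat _ L (f 0)) (DegLE.polyMat _ L (f 1)) (DegLE.polyMat _ L (f 2))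
      (DegLE.polyMat _ L (f 3)) (DegLE.polyMat _ L (f 4)) (DegLE.polyMat _ L (f 5))
      (DegLE.polyMat _ L (f 6)) (c := c) (d := r) i) a b
    refine eq_zero_of_natDegree_lt_card_of_eval_eq_zero _
      (f := fun t : Fin (n * n + 4 * n + 2 * L + 1) => ((t : ℕ) : ℤ))
      (fun t t' htt => Fin.ext (Int.ofNat_inj.mp htt)) (fun t => h t t.2 a b) ?_
    rw [Fintype.card_fin, Nat.lt_succ_iff]
    refine (natDegree_sub_le _ _).trans (max_le ?_ ?_)
    · refine natDegree_mul_le.trans ((add_le_add (natDegree_imprimitivePoly_le n) hdeg).trans ?_)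
      omega
    · refine natDegree_mul_le.trans ((add_le_add (b := n) ?_ (natDegree_coeffPoly_le L _)).trans ?_)
      · exact (natDegree_sub_le _ _).trans (by simp)
      · omega

/-- The coefficients of the matrices of a certificate, listed by a pairing function. -/
def certCoeff (l : List ℤ) (tag a b i : ℕ) : ℤ :=
  l.getD (Nat.pair tag (Nat.pair a (Nat.pair b i))) 0

/-- Finitely many indices have bounded pairing codes, so a long enough list stores all their values.
-/
theorem exists_certCoeff (B M L : ℕ) (G : ℕ → ℕ → ℕ → ℕ → ℤ) :
    ∃ l, ∀ tag < B, ∀ a < M, ∀ b < M, ∀ i < L, certCoeff l tag a b i = G tag a b i := by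
  obtain ⟨U, hU⟩ := ((Finset.range B ×ˢ Finset.range M ×ˢ Finset.range M ×ˢ
    Finset.range L).image fun x => Nat.pair x.1 (Nat.pair x.2.1 (Nat.pair x.2.2.1 x.2.2.2))).bddAbove
  refine ⟨(List.range (U + 1)).map fun n => G n.unpair.1 n.unpair.2.unpair.1
    n.unpair.2.unpair.2.unpair.1 n.unpair.2.unpair.2.unpair.2, fun tag ht a ha b hb i hi => ?_⟩
  have h : Nat.pair tag (Nat.pair a (Nat.pair b i)) < U + 1 :=
    Nat.lt_succ_of_le (hU (Finset.mem_coe.mpr (Finset.mem_image.mpr ⟨(tag, a, b, i), by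
      simp only [Finset.mem_product, Finset.mem_range]; exact ⟨ht, ha, hb, hi⟩, rfl⟩)))
  rw [certCoeff, List.getD_eq_getElem _ _ (by simpa using h)]
  simp

theorem coeffPoly_coeff {L : ℕ} {p : ℤ[X]} (h : p.natDegree < L) : coeffPoly L p.coeff = p :=
  (as_sum_range_C_mul_X_pow' p h).symm

theorem exists_list_polyMat {ι : Type*} [Fintype ι] {M B : ℕ} (tag : ι → ℕ)
    (htag : Function.Injective tag) (hB : ∀ i, tag i < B) (x : ι → Matrix (Fin M) (Fin M) ℤ[X]) :
    ∃ L l, ∀ i, polyMat M L (certCoeff l (tag i)) = x i := by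
  classical
  obtain ⟨L, hL⟩ := (Finset.univ.image fun j : ι × Fin M × Fin M =>
    (x j.1 j.2.1 j.2.2).natDegree).bddAbove
  have hL' : ∀ i a b, (x i a b).natDegree < L + 1 := fun i a b => Nat.lt_succ_of_le
    (hL (Finset.mem_coe.mpr (Finset.mem_image.mpr ⟨(i, a, b), Finset.mem_univ _, rfl⟩)))
  obtain ⟨l, hl⟩ := exists_certCoeff B M (L + 1) fun t a b => if h : ∃ i, tag i = t then
    if ha : a < M then if hb : b < M then (x h.choose ⟨a, ha⟩ ⟨b, hb⟩).coeff else 0 else 0 else 0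
  refine ⟨L + 1, l, fun i => ?_⟩
  ext1 a b
  rw [polyMat, Matrix.of_apply, ← coeffPoly_coeff (hL' i a b)]
  refine Finset.sum_congr rfl fun e he => ?_
  have h : ∃ i', tag i' = tag i := ⟨i, rfl⟩
  rw [hl _ (hB i) a a.2 b b.2 e (Finset.mem_range.mp he), dif_pos h, dif_pos a.2, dif_pos b.2,
    htag h.choose_spec]

theorem exists_isPolyCertificate {K : Type*} [Field K] [CharZero K] {ζ : K} {n : ℕ} (hn : 0 < n)
    (hζ : IsPrimitiveRoot ζ n) (htop : Algebra.adjoin ℚ {ζ} = ⊤) {N d : ℕ} {jS eS jT eT : ℕ → ℕ}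
    (hst : let s := actMat N d (coefS d) jS eS (X : ℤ[X])
      let t := actMat N d coefT jT eT (X : ℤ[X])
      evalMat _ ζ (t * s * (t * s) * (t * s)) = evalMat _ ζ (s * s)) :
    ∃ r ≤ N * (d + 1), ∃ L, ∃ c ≠ 0, ∃ l,
      IsPolyCertificate n N d jS eS jT eT r L c (certCoeff l) := by
  obtain ⟨r, hr, c, hc, x, q, h⟩ := exists_poly_certificate hn hζ htop _ _ hst
  -- The seven matrices of the certificate have tags `0` to `6` and the eight quotients tags `7` to
  -- `14`, as `IsPolyCertificate` expects.
  obtain ⟨L, l, hl⟩ := exists_list_polyMat (B := 15) (fun i : Fin 15 => (i : ℕ))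
    Fin.val_injective (fun i => i.2) (Fin.append x q : Fin (7 + 8) → _)
  refine ⟨r, hr, L, c, hc, l, fun i => ?_⟩
  have hx : ∀ i : Fin 7, polyMat _ L (certCoeff l i) = x i := fun i => by
    rw [← Fin.append_left x q i, ← hl]; rfl
  have hq : polyMat _ L (certCoeff l (7 + i)) = q i := by
    rw [← Fin.append_right x q i, ← hl]; rfl
  rw [hq, ← h i, ← hx 0, ← hx 1, ← hx 2, ← hx 3, ← hx 4, ← hx 5, ← hx 6]
  rfl

end Check

end ModSym

namespace ModSym

/-! ### The check is primitive recursive -/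

section PrimrecCheck

variable {α : Type*} [Primcodable α]

theorem PrimrecMat.smul_sub_smul {c c' : α → ℤ} {f g : α → ℕ → ℕ → ℤ} (hc : Primrec c)
    (hf : PrimrecMat f) (hc' : Primrec c') (hg : PrimrecMat g) :
    PrimrecMat fun a i j => c a * f a i j - c' a * g a i j :=
  primrec_int_sub.comp (primrec_int_mul.comp (hc.comp Primrec.fst) hf)
    (primrec_int_mul.comp (hc'.comp Primrec.fst) hg)

theorem PrimrecMat.diagFun {c : α → ℤ} {d : α → ℕ} (hc : Primrec c) (hd : Primrec d) :
    PrimrecMat fun a => ModSym.diagFun (c a) (d a) := PrimrecMat.diagonal hc hd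

theorem PrimrecMat.defectFun {M : α → ℕ} {s t o φ e₁ e₂ u₁ u₂ w c p : α → ℕ → ℕ → ℤ}
    (hM : Primrec M) (hs : PrimrecMat s) (ht : PrimrecMat t) (ho : PrimrecMat o)
    (hφ : PrimrecMat φ) (h₁ : PrimrecMat e₁) (h₂ : PrimrecMat e₂) (h₃ : PrimrecMat u₁)
    (h₄ : PrimrecMat u₂) (hw : PrimrecMat w) (hc : PrimrecMat c) (hp : PrimrecMat p) (i : Fin 8) :
    PrimrecMat fun a => ModSym.defectFun (M a) (s a) (t a) (o a) (φ a) (e₁ a) (e₂ a) (u₁ a) (u₂ a)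
      (w a) (c a) (p a) i := by
  have hI : PrimrecMat fun a => ModSym.diagFun 1 (M a) := .diagFun (Primrec.const 1) hM
  have hS := hI.sub (.matMul hM hs hs)
  have hts := PrimrecMat.matMul hM ht hs
  have hU := (hI.add hts).add (.matMul hM hts hts)
  fin_cases i
  · exact (PrimrecMat.matMul hM (hs.sub hI) ho).sub
      ((PrimrecMat.matMul hM (hI.sub ht) h₁).add (.matMul hM hS h₂))
  · exact .matMul hM hφ (hI.add hs)
  · exact .matMul hM hφ hU
  · exact (PrimrecMat.matMul hM hφ ho).sub (.matMul hM hc hp)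
  · exact hc.sub ((((PrimrecMat.matMul hM ho hφ).add (.matMul hM (hI.add hs) h₃)).add
      (.matMul hM hU h₄)).add (.matMul hM hw (hs.sub hI)))
  · exact .matMul hM hw (hI.sub ht)
  · exact .matMul hM hw hS
  · exact (PrimrecMat.matMul hM ho hp).sub ho

theorem PrimrecMat.actFun {d : α → ℕ} {coef : α → ℕ → ℕ → ℤ} {j e : α → ℕ → ℕ} {t : α → ℤ}
    (hd : Primrec d) (hcoef : PrimrecMat coef) (hj : Primrec₂ j) (he : Primrec₂ e)
    (ht : Primrec t) : PrimrecMat fun a => ModSym.actFun (d a) (coef a) (j a) (e a) (t a) := by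
  have hd' : Primrec fun q : α × ℕ × ℕ => d q.1 + 1 := Primrec.succ.comp (hd.comp Primrec.fst)
  have hq : Primrec fun q : α × ℕ × ℕ => q.2.1 := Primrec.fst.comp Primrec.snd
  have hp : Primrec fun q : α × ℕ × ℕ => q.2.2 := Primrec.snd.comp Primrec.snd
  have hpd := Primrec.nat_div.comp hp hd'
  exact Primrec.ite (Primrec.eq.comp (Primrec.nat_div.comp hq hd') (hj.comp Primrec.fst hpd))
    (primrec_int_mul.comp
      (Primrec.comp hcoef (Primrec.fst.pair
        ((Primrec.nat_mod.comp hp hd').pair (Primrec.nat_mod.comp hq hd'))))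
      (Primrec.int_pow (ht.comp Primrec.fst) (he.comp Primrec.fst hpd))) (Primrec.const 0)

theorem PrimrecMat.coefS {d : α → ℕ} (hd : Primrec d) : PrimrecMat fun a => ModSym.coefS (d a) := by
  have hi : Primrec fun q : α × ℕ × ℕ => q.2.1 := Primrec.fst.comp Primrec.snd
  have hj : Primrec fun q : α × ℕ × ℕ => q.2.2 := Primrec.snd.comp Primrec.snd
  exact Primrec.ite (Primrec.eq.comp hj (Primrec.nat_sub.comp (hd.comp Primrec.fst) hi))
    (Primrec.int_pow (Primrec.const (-1)) hi) (Primrec.const 0)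

theorem PrimrecMat.coefT : PrimrecMat fun _ : α => ModSym.coefT :=
  primrec_int_ofNat.comp (primrec_choose.comp (Primrec.fst.comp Primrec.snd)
    (Primrec.snd.comp Primrec.snd))

/-- The four-index family `f` depends primitive recursively on its indices and on the parameter. -/
def PrimrecCoeff (f : α → ℕ → ℕ → ℕ → ℕ → ℤ) : Prop :=
  Primrec fun p : α × ℕ × ℕ × ℕ × ℕ => f p.1 p.2.1 p.2.2.1 p.2.2.2.1 p.2.2.2.2

theorem PrimrecCoeff.coeffEval {f : α → ℕ → ℕ → ℕ → ℕ → ℤ} {L : α → ℕ} {t : α → ℤ}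
    (hf : PrimrecCoeff f) (hL : Primrec L) (ht : Primrec t) (tag : ℕ) :
    PrimrecMat fun a i j => ModSym.coeffEval (L a) (f a tag i j) (t a) := by
  have h0 : Primrec fun q : (α × ℕ × ℕ) × ℕ => q.1.1 := Primrec.fst.comp Primrec.fst
  refine Primrec.int_sum (f := fun (p : α × ℕ × ℕ) l => f p.1 tag p.2.1 p.2.2 l * t p.1 ^ l) ?_
    (hL.comp Primrec.fst)
  refine primrec_int_mul.comp (Primrec.comp hf (h0.pair ((Primrec.const tag).pair
    ((Primrec.fst.comp (Primrec.snd.comp Primrec.fst)).pair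
      ((Primrec.snd.comp (Primrec.snd.comp Primrec.fst)).pair Primrec.snd)))))
    (Primrec.int_pow (ht.comp h0) Primrec.snd)

theorem PrimrecCoeff.apply_tag {f : α → ℕ → ℕ → ℕ → ℕ → ℤ} (hf : PrimrecCoeff f) (tag : ℕ) :
    Primrec fun p : α × ℕ × ℕ × ℕ => f p.1 tag p.2.1 p.2.2.1 p.2.2.2 :=
  Primrec.comp hf (Primrec.fst.pair ((Primrec.const tag).pair Primrec.snd))

theorem PrimrecCoeff.certCoeff {l : α → List ℤ} (hl : Primrec l) :
    PrimrecCoeff fun a => ModSym.certCoeff (l a) := by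
  have h1 : Primrec fun p : α × ℕ × ℕ × ℕ × ℕ => p.2.2 := Primrec.snd.comp Primrec.snd
  have h2 : Primrec fun p : α × ℕ × ℕ × ℕ × ℕ => p.2.2.2 := Primrec.snd.comp h1
  exact (Primrec.list_getD 0).comp (hl.comp Primrec.fst)
    (Primrec₂.natPair.comp (Primrec.fst.comp Primrec.snd) (Primrec₂.natPair.comp
      (Primrec.fst.comp h1) (Primrec₂.natPair.comp (Primrec.fst.comp h2) (Primrec.snd.comp h2))))

theorem PrimrecCoeff.comp {β : Type*} [Primcodable β] {f : β → ℕ → ℕ → ℕ → ℕ → ℤ}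
    (hf : PrimrecCoeff f) {g : α → β} (hg : Primrec g) : PrimrecCoeff fun a => f (g a) :=
  Primrec.comp hf ((hg.comp Primrec.fst).pair Primrec.snd)

theorem Primrec.int_sum_fin {k : ℕ} {f : α → Fin k → ℤ} (hf : ∀ i, Primrec fun a => f a i) :
    Primrec fun a => ∑ i, f a i := by
  induction k with
  | zero => exact (Primrec.const 0).of_eq fun a => by simp
  | succ k ih =>
    exact (primrec_int_add.comp (hf 0) (ih fun i => hf i.succ)).of_eq fun a =>
      (Fin.sum_univ_succ _).symm

variable {n d M r L : α → ℕ} {jS eS jT eT : α → ℕ → ℕ} {c : α → ℤ}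
  {f : α → ℕ → ℕ → ℕ → ℕ → ℤ}

theorem PrimrecMat.checkEntry {t : α → ℤ} (hn : Primrec n) (hd : Primrec d) (hjS : Primrec₂ jS)
    (heS : Primrec₂ eS) (hjT : Primrec₂ jT) (heT : Primrec₂ eT) (hM : Primrec M) (hr : Primrec r)
    (hL : Primrec L) (hc : Primrec c) (hf : PrimrecCoeff f) (ht : Primrec t) (i : Fin 8) :
    PrimrecMat fun a => ModSym.checkEntry (n a) (d a) (jS a) (eS a) (jT a) (eT a) (M a) (r a) (L a)
      (c a) (f a) i (t a) := by
  have hE : Primrec fun a => ∏ i ∈ Finset.range (n a - 1), (1 - t a ^ (i + 1)) :=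
    Primrec.int_prod (f := fun a i => 1 - t a ^ (i + 1))
      (primrec_int_sub.comp (Primrec.const 1)
        (Primrec.int_pow (ht.comp Primrec.fst) (Primrec.succ.comp Primrec.snd)))
      (Primrec.nat_sub.comp hn (Primrec.const 1))
  have hq : Primrec fun a => t a ^ n a - 1 :=
    primrec_int_sub.comp (Primrec.int_pow ht hn) (Primrec.const 1)
  have hs := PrimrecMat.actFun hd (.coefS hd) hjS heS ht
  have ht' := PrimrecMat.actFun hd .coefT hjT heT ht
  have hD := PrimrecMat.defectFun hM hs ht'
    (hf.coeffEval hL ht 0) (hf.coeffEval hL ht 1) (hf.coeffEval hL ht 2) (hf.coeffEval hL ht 3)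
    (hf.coeffEval hL ht 4) (hf.coeffEval hL ht 5) (hf.coeffEval hL ht 6)
    (.diagFun hc hM) (.diagFun (Primrec.const 1) hr) i
  exact PrimrecMat.smul_sub_smul hE hD hq (hf.coeffEval hL ht (7 + i))

theorem PrimrecMat.sum_sq {f : α → ℕ → ℕ → ℤ} (hf : PrimrecMat f) (hM : Primrec M) :
    Primrec fun a => ∑ i ∈ Finset.range (M a), ∑ j ∈ Finset.range (M a), f a i j ^ 2 := by
  have h : Primrec₂ fun (q : α × ℕ) (j : ℕ) => f q.1 q.2 j ^ 2 :=
    Primrec.int_pow (Primrec.comp hf ((Primrec.fst.comp Primrec.fst).pair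
      ((Primrec.snd.comp Primrec.fst).pair Primrec.snd))) (Primrec.const 2)
  exact Primrec.int_sum (Primrec.int_sum h (hM.comp Primrec.fst)).to₂ hM

theorem Primrec.checkSum (hn : Primrec n) (hd : Primrec d) (hjS : Primrec₂ jS)
    (heS : Primrec₂ eS) (hjT : Primrec₂ jT) (heT : Primrec₂ eT) (hM : Primrec M) (hr : Primrec r)
    (hL : Primrec L) (hc : Primrec c) (hf : PrimrecCoeff f) :
    Primrec fun a => ModSym.checkSum (n a) (d a) (jS a) (eS a) (jT a) (eT a) (M a) (r a) (L a)
      (c a) (f a) := by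
  have h1 : Primrec fun p : α × ℕ => p.1 := Primrec.fst
  have hj : ∀ {j : α → ℕ → ℕ}, Primrec₂ j → Primrec₂ fun (p : α × ℕ) i => j p.1 i := fun h =>
    h.comp (Primrec.fst.comp Primrec.fst) Primrec.snd
  refine Primrec.int_sum_fin fun i => ?_
  have he := PrimrecMat.checkEntry (hn.comp h1) (hd.comp h1) (hj hjS) (hj heS) (hj hjT) (hj heT)
    (hM.comp h1) (hr.comp h1) (hL.comp h1) (hc.comp h1) (hf.comp h1)
    (primrec_int_ofNat.comp Primrec.snd) i
  refine Primrec.int_sum (PrimrecMat.sum_sq he (hM.comp h1)).to₂ ?_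
  exact Primrec.nat_add.comp (Primrec.nat_add.comp (Primrec.nat_add.comp (Primrec.nat_mul.comp hn hn)
    (Primrec.nat_mul.comp (Primrec.const 4) hn)) (Primrec.nat_mul.comp (Primrec.const 2) hL))
    (Primrec.const 1)

theorem Primrec.outputList {f : α → ℕ → ℕ → ℕ → ℤ} {M m d L : α → ℕ}
    (hf : Primrec fun p : α × ℕ × ℕ × ℕ => f p.1 p.2.1 p.2.2.1 p.2.2.2)
    (hM : Primrec M) (hm : Primrec m) (hd : Primrec d) (hL : Primrec L) :
    Primrec fun a => ModSym.outputList (M a) (m a) (d a) (L a) (f a) := by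
  have h1 : Primrec fun q : (α × ℕ) × ℕ => q.1.1 := Primrec.fst.comp Primrec.fst
  have hm' := Primrec.succ.comp (hm.comp h1)
  have hc : Primrec₂ fun (q : (α × ℕ) × ℕ) (l : ℕ) => f q.1.1 q.2 q.1.2 l :=
    Primrec.comp hf ((h1.comp Primrec.fst).pair ((Primrec.snd.comp Primrec.fst).pair
      ((Primrec.snd.comp (Primrec.fst.comp Primrec.fst)).pair Primrec.snd)))
  have ht : Primrec₂ fun (q : α × ℕ) (p : ℕ) =>
      ((List.range (L q.1)).map (f q.1 p q.2), p % (m q.1 + 1), p / (m q.1 + 1)) :=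
    (Primrec.list_map (Primrec.list_range.comp (hL.comp h1)) hc).pair
      ((Primrec.nat_mod.comp Primrec.snd hm').pair (Primrec.nat_div.comp Primrec.snd hm'))
  exact Primrec.list_map (Primrec.list_range.comp hd)
    (Primrec.list_map (Primrec.list_range.comp (hM.comp Primrec.fst)) ht)

end PrimrecCheck

end ModSym

namespace ModSym

/-! ### The algorithm -/

section Algorithm

/-- The product of two matrices. -/
def mulMat (x y : Mat) : Mat :=
  (x.1 * y.1 + x.2.1 * y.2.2.1, x.1 * y.2.1 + x.2.1 * y.2.2.2,
    x.2.2.1 * y.1 + x.2.2.2 * y.2.2.1, x.2.2.1 * y.2.1 + x.2.2.2 * y.2.2.2)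

/-- The inverse of a matrix of determinant one. -/
def invMat (x : Mat) : Mat := (x.2.2.2, -x.2.1, -x.2.2.1, x.1)

/-- The entry `j` of a list of matrices, the unit matrix beyond its end. -/
def repAt (R : List Mat) (j : ℕ) : Mat := R.getD j (1, 0, 0, 1)

/-- The length of the character table. -/
def tableLength (a : Input × List ℕ) : ℕ := a.1.2.2.2.2.length

/-- The number of representatives for `Γ' \ SL₂(ℤ)`. -/
def repCount (a : Input × List ℕ) : ℕ := a.1.2.2.2.1.length

/-- The query number `4 j + b` after those for the table: for `b = 0, 2` the coset of `R'[j] X`, for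
`b = 1, 3` that of `R'[j] X R'[l]⁻¹` with the last answer `l`; here `X` is `S` or `T`. -/
def actionQuery (a : Input × List ℕ) (i : ℕ) : Query :=
  if i % 2 = 0 then
    (true, mulMat (repAt a.1.2.2.2.1 (i / 4)) (if i / 2 % 2 = 0 then (0, -1, 1, 0) else (1, 1, 0, 1)))
  else (false, mulMat (mulMat (repAt a.1.2.2.2.1 (i / 4))
    (if i / 2 % 2 = 0 then (0, -1, 1, 0) else (1, 1, 0, 1)))
      (invMat (repAt a.1.2.2.2.1 (a.2.getD (a.2.length - 1) 0))))

/-- The next query after the answers `a.2`. -/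
def nextQuery (a : Input × List ℕ) : Query :=
  if a.2.length < tableLength a then
    (false, (a.1.2.2.2.2.getD a.2.length ((1, 0, 0, 1), 0)).1)
  else actionQuery a (a.2.length - tableLength a)

/-- The index of the coset of `R'[i] X`, where `b = 0` for `X = S` and `b = 2` for `X = T`. -/
def actionIndex (b : ℕ) (a : Input × List ℕ) (i : ℕ) : ℕ := a.2.getD (tableLength a + (4 * i + b)) 0

/-- The exponent of the character at `R'[i] X R'[l]⁻¹`. -/
def actionExponent (b : ℕ) (a : Input × List ℕ) (i : ℕ) : ℕ :=
  (a.1.2.2.2.2.getD (a.2.idxOf (a.2.getD (tableLength a + (4 * i + b + 1)) 0))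
    ((1, 0, 0, 1), 0)).2 % a.1.2.1

/-- The data of a certificate: the dimension, a degree bound, the multiplier, and coefficients. -/
abbrev Certificate : Type := ℕ × ℕ × ℤ × List ℤ

/-- The rank of the module of Manin symbols. -/
def rowCount (a : Input × List ℕ) : ℕ := repCount a * (a.1.1 - 2 + 1)

/-- The certificate `C` is correct. -/
def Accepts (a : Input × List ℕ) (C : Certificate) : Prop :=
  C.1 ≤ rowCount a ∧ ¬ C.2.2.1 = 0 ∧
    checkSum a.1.2.1 (a.1.1 - 2) (actionIndex 0 a) (actionExponent 0 a) (actionIndex 2 a)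
      (actionExponent 2 a) (rowCount a) C.1 C.2.1 C.2.2.1 (certCoeff C.2.2.2) = 0

/-- The basis described by a certificate. -/
def certOutput (a : Input × List ℕ) (C : Certificate) : Output :=
  outputList (rowCount a) (a.1.1 - 2) C.1 C.2.1 (certCoeff C.2.2.2 0)

instance (a : Input × List ℕ) : DecidablePred (Accepts a) := fun _ => instDecidableAnd

/-- The next query if there is one, and otherwise the output of the certificate with the given code,
if it is correct. -/
def stepOption (a : Input × List ℕ) (code : ℕ) : Option (Query ⊕ Output) :=
  if a.2.length < tableLength a + 4 * repCount a then some (Sum.inl (nextQuery a)) else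
    (Encodable.decode code : Option Certificate).bind fun C =>
      if Accepts a C then some (Sum.inr (certOutput a C)) else none

theorem primrec_mulMat : Primrec₂ mulMat := by
  have h1 : Primrec fun p : Mat × Mat => p.1.1 := Primrec.fst.comp Primrec.fst
  have h2' : Primrec fun p : Mat × Mat => p.1.2 := Primrec.snd.comp Primrec.fst
  have h2 : Primrec fun p : Mat × Mat => p.1.2.1 := Primrec.fst.comp h2'
  have h3 : Primrec fun p : Mat × Mat => p.1.2.2.1 := Primrec.fst.comp (Primrec.snd.comp h2')
  have h4 : Primrec fun p : Mat × Mat => p.1.2.2.2 := Primrec.snd.comp (Primrec.snd.comp h2')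
  have k1 : Primrec fun p : Mat × Mat => p.2.1 := Primrec.fst.comp Primrec.snd
  have k2' : Primrec fun p : Mat × Mat => p.2.2 := Primrec.snd.comp Primrec.snd
  have k2 : Primrec fun p : Mat × Mat => p.2.2.1 := Primrec.fst.comp k2'
  have k3 : Primrec fun p : Mat × Mat => p.2.2.2.1 := Primrec.fst.comp (Primrec.snd.comp k2')
  have k4 : Primrec fun p : Mat × Mat => p.2.2.2.2 := Primrec.snd.comp (Primrec.snd.comp k2')
  have hf : ∀ {a b c d : Mat × Mat → ℤ}, Primrec a → Primrec b → Primrec c → Primrec d →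
      Primrec fun p => a p * b p + c p * d p := fun ha hb hc hd =>
    primrec_int_add.comp (primrec_int_mul.comp ha hb) (primrec_int_mul.comp hc hd)
  exact (hf h1 k1 h2 k3).pair ((hf h1 k2 h2 k4).pair ((hf h3 k1 h4 k3).pair (hf h3 k2 h4 k4)))

theorem primrec_invMat : Primrec invMat := by
  have h2' : Primrec fun p : Mat => p.2.2 := Primrec.snd.comp Primrec.snd
  exact (Primrec.snd.comp h2').pair ((primrec_int_neg.comp (Primrec.fst.comp Primrec.snd)).pair
    ((primrec_int_neg.comp (Primrec.fst.comp h2')).pair Primrec.fst))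

theorem primrec_repAt : Primrec₂ repAt := Primrec.list_getD _

theorem primrec_weight : Primrec fun a : Input × List ℕ => a.1.1 - 2 :=
  Primrec.nat_sub.comp (Primrec.fst.comp Primrec.fst) (Primrec.const 2)

theorem primrec_order : Primrec fun a : Input × List ℕ => a.1.2.1 :=
  Primrec.fst.comp (Primrec.snd.comp Primrec.fst)

theorem primrec_reps : Primrec fun a : Input × List ℕ => a.1.2.2.2.1 :=
  Primrec.fst.comp (Primrec.snd.comp (Primrec.snd.comp (Primrec.snd.comp Primrec.fst)))

theorem primrec_table : Primrec fun a : Input × List ℕ => a.1.2.2.2.2 :=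
  Primrec.snd.comp (Primrec.snd.comp (Primrec.snd.comp (Primrec.snd.comp Primrec.fst)))

theorem primrec_tableLength : Primrec tableLength := Primrec.list_length.comp primrec_table

theorem primrec_repCount : Primrec repCount := Primrec.list_length.comp primrec_reps

theorem primrec_actionQuery : Primrec₂ actionQuery := by
  have hX : Primrec fun p : (Input × List ℕ) × ℕ =>
      (if p.2 / 2 % 2 = 0 then (0, -1, 1, 0) else (1, 1, 0, 1) : Mat) :=
    Primrec.ite (Primrec.eq.comp (Primrec.nat_mod.comp
      (Primrec.nat_div.comp Primrec.snd (Primrec.const 2)) (Primrec.const 2)) (Primrec.const 0))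
      (Primrec.const _) (Primrec.const _)
  have hR : Primrec fun p : (Input × List ℕ) × ℕ => p.1.1.2.2.2.1 := primrec_reps.comp Primrec.fst
  have hy := primrec_mulMat.comp (primrec_repAt.comp hR
    (Primrec.nat_div.comp Primrec.snd (Primrec.const 4))) hX
  have hl : Primrec fun p : (Input × List ℕ) × ℕ => p.1.2.getD (p.1.2.length - 1) 0 := by
    have h2 : Primrec fun p : (Input × List ℕ) × ℕ => p.1.2 := Primrec.snd.comp Primrec.fst
    exact (Primrec.list_getD 0).comp h2
      (Primrec.nat_sub.comp (Primrec.list_length.comp h2) (Primrec.const 1))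
  exact Primrec.ite (Primrec.eq.comp (Primrec.nat_mod.comp Primrec.snd (Primrec.const 2))
      (Primrec.const 0))
    ((Primrec.const true).pair hy)
    ((Primrec.const false).pair (primrec_mulMat.comp hy
      (primrec_invMat.comp (primrec_repAt.comp hR hl))))

theorem primrec_nextQuery : Primrec nextQuery := by
  have hlen : Primrec fun a : Input × List ℕ => a.2.length := Primrec.list_length.comp Primrec.snd
  exact Primrec.ite (Primrec.nat_lt.comp hlen primrec_tableLength)
    ((Primrec.const false).pair (Primrec.fst.comp ((Primrec.list_getD _).comp primrec_table hlen)))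
    (primrec_actionQuery.comp Primrec.id (Primrec.nat_sub.comp hlen primrec_tableLength))

theorem primrec_answerAt (b : ℕ) :
    Primrec₂ fun (a : Input × List ℕ) i => a.2.getD (tableLength a + (4 * i + b)) 0 :=
  (Primrec.list_getD 0).comp (Primrec.snd.comp Primrec.fst)
    (Primrec.nat_add.comp (primrec_tableLength.comp Primrec.fst) (Primrec.nat_add.comp
      (Primrec.nat_mul.comp (Primrec.const 4) Primrec.snd) (Primrec.const b)))

theorem primrec_actionIndex (b : ℕ) : Primrec₂ (actionIndex b) := primrec_answerAt b

theorem primrec_actionExponent (b : ℕ) : Primrec₂ (actionExponent b) := by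
  have hidx : Primrec fun p : (Input × List ℕ) × ℕ =>
      p.1.2.idxOf (p.1.2.getD (tableLength p.1 + (4 * p.2 + (b + 1))) 0) :=
    Primrec.list_idxOf.comp (primrec_answerAt (b + 1)) (Primrec.snd.comp Primrec.fst)
  exact Primrec.nat_mod.comp (Primrec.snd.comp ((Primrec.list_getD _).comp
    (primrec_table.comp Primrec.fst) hidx)) (primrec_order.comp Primrec.fst)

theorem primrec_rowCount : Primrec rowCount :=
  Primrec.nat_mul.comp primrec_repCount (Primrec.succ.comp primrec_weight)

theorem primrec_accepts :
    PrimrecPred fun p : (Input × List ℕ) × Certificate => Accepts p.1 p.2 := by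
  have h1 : Primrec fun p : (Input × List ℕ) × Certificate => p.1 := Primrec.fst
  have hr : Primrec fun p : (Input × List ℕ) × Certificate => p.2.1 := Primrec.fst.comp Primrec.snd
  have h2 : Primrec fun p : (Input × List ℕ) × Certificate => p.2.2 := Primrec.snd.comp Primrec.snd
  have hL : Primrec fun p : (Input × List ℕ) × Certificate => p.2.2.1 := Primrec.fst.comp h2
  have hc : Primrec fun p : (Input × List ℕ) × Certificate => p.2.2.2.1 :=
    Primrec.fst.comp (Primrec.snd.comp h2)
  have hl : Primrec fun p : (Input × List ℕ) × Certificate => p.2.2.2.2 :=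
    Primrec.snd.comp (Primrec.snd.comp h2)
  have hj : ∀ {j : Input × List ℕ → ℕ → ℕ}, Primrec₂ j →
      Primrec₂ fun (p : (Input × List ℕ) × Certificate) i => j p.1 i := fun h =>
    h.comp (Primrec.fst.comp Primrec.fst) Primrec.snd
  refine (Primrec.nat_le.comp hr (primrec_rowCount.comp h1)).and
    ((Primrec.eq.comp hc (Primrec.const 0)).not.and (Primrec.eq.comp ?_ (Primrec.const 0)))
  exact Primrec.checkSum (primrec_order.comp h1) (primrec_weight.comp h1)
    (hj (primrec_actionIndex 0)) (hj (primrec_actionExponent 0)) (hj (primrec_actionIndex 2))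
    (hj (primrec_actionExponent 2)) (primrec_rowCount.comp h1) hr hL hc (.certCoeff hl)

theorem primrec_certOutput : Primrec₂ certOutput := by
  have h1 : Primrec fun p : (Input × List ℕ) × Certificate => p.1 := Primrec.fst
  have h2 : Primrec fun p : (Input × List ℕ) × Certificate => p.2.2 := Primrec.snd.comp Primrec.snd
  have hl : Primrec fun p : (Input × List ℕ) × Certificate => p.2.2.2.2 :=
    Primrec.snd.comp (Primrec.snd.comp h2)
  exact Primrec.outputList ((PrimrecCoeff.certCoeff hl).apply_tag 0) (primrec_rowCount.comp h1)
    (primrec_weight.comp h1) (Primrec.fst.comp Primrec.snd) (Primrec.fst.comp h2)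

/-- Only the test of a single code is primitive recursive; the unbounded search is left to
`Nat.rfindOpt`. -/
theorem primrec_stepOption : Primrec₂ stepOption := by
  have hlen : Primrec fun p : (Input × List ℕ) × ℕ => p.1.2.length :=
    Primrec.list_length.comp (Primrec.snd.comp Primrec.fst)
  have h0 : Primrec₂ fun (a : Input × List ℕ) (C : Certificate) =>
      if Accepts a C then some (Sum.inr (certOutput a C) : Query ⊕ Output) else none :=
    Primrec.ite primrec_accepts (Primrec.option_some.comp (Primrec.sumInr.comp primrec_certOutput))
      (Primrec.const none)
  have hC : Primrec₂ fun (p : (Input × List ℕ) × ℕ) (C : Certificate) =>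
      if Accepts p.1 C then some (Sum.inr (certOutput p.1 C) : Query ⊕ Output) else none :=
    h0.comp (Primrec.fst.comp Primrec.fst) Primrec.snd
  exact Primrec.ite (Primrec.nat_lt.comp hlen (Primrec.nat_add.comp
      (primrec_tableLength.comp Primrec.fst)
      (Primrec.nat_mul.comp (Primrec.const 4) (primrec_repCount.comp Primrec.fst))))
    (Primrec.option_some.comp (Primrec.sumInl.comp (primrec_nextQuery.comp Primrec.fst)))
    (Primrec.option_bind (Primrec.decode.comp Primrec.snd) hC)

/-- The algorithm asks for the action of `S` and `T` on the cosets, and for the values of the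
character which occur in it; then it searches for a certificate. -/
def cuspidalAlgorithm : CosetAlgorithm where
  step a := Nat.rfindOpt (stepOption a)
  partrec := Partrec.rfindOpt primrec_stepOption.to_comp

/-- Used while calls remain to be made: then the step does not depend on the code, and the search
returns the query. -/
theorem mem_rfindOpt_of_const {β : Type*} {f : ℕ → Option β} {b : β} (h : ∀ n, f n = some b) :
    b ∈ Nat.rfindOpt f := by
  obtain ⟨b', hb'⟩ := Part.dom_iff_mem.mp (Nat.rfindOpt_dom.mpr ⟨0, b, h 0⟩)
  obtain ⟨n, hn⟩ := Nat.rfindOpt_spec hb'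
  rw [Option.mem_def, h n, Option.some_inj] at hn
  rwa [hn]

theorem nextQuery_mem_step {a : Input × List ℕ}
    (h : a.2.length < tableLength a + 4 * repCount a) :
    Sum.inl (nextQuery a) ∈ cuspidalAlgorithm.step a :=
  mem_rfindOpt_of_const fun _ => if_pos h

/-- A known certificate forces the search to end, possibly at a different one. What matters is that
the one found is accepted. -/
theorem exists_output_mem_step {a : Input × List ℕ}
    (h : a.2.length = tableLength a + 4 * repCount a) (hex : ∃ C, Accepts a C) :
    ∃ C, Accepts a C ∧ Sum.inr (certOutput a C) ∈ cuspidalAlgorithm.step a := by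
  have hstep : ∀ code, stepOption a code = (Encodable.decode code : Option Certificate).bind fun C =>
      if Accepts a C then some (Sum.inr (certOutput a C)) else none :=
    fun code => if_neg h.not_lt
  obtain ⟨C, hC⟩ := hex
  obtain ⟨x, hx⟩ := Part.dom_iff_mem.mp (Nat.rfindOpt_dom (f := stepOption a).mpr
    ⟨Encodable.encode C, Sum.inr (certOutput a C), by
      rw [hstep, Encodable.encodek, Option.bind_some, if_pos hC]; rfl⟩)
  obtain ⟨code, hcode⟩ := Nat.rfindOpt_spec hx
  rw [Option.mem_def, hstep, Option.bind_eq_some_iff] at hcode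
  obtain ⟨C', -, hC'⟩ := hcode
  split_ifs at hC' with hacc
  refine ⟨C', hacc, ?_⟩
  rw [Option.some_inj] at hC'
  rw [hC']
  exact hx

end Algorithm

end ModSym

namespace ModSym

/-! ### Coset indices -/

section Cosets

theorem IsCosetReps.existsUnique {Γ : Subgroup SL(2, ℤ)} {R : List SL(2, ℤ)} (hR : IsCosetReps Γ R)
    (g : SL(2, ℤ)) : ∃! i, i < R.length ∧ g * (R.getD i 1)⁻¹ ∈ Γ := by
  obtain ⟨i, hi, huniq⟩ := hR g
  refine ⟨i, ⟨i.2, ?_⟩, ?_⟩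
  · rw [List.getD_eq_getElem _ _ i.2]; exact hi
  · rintro j ⟨hj, hj'⟩
    rw [List.getD_eq_getElem _ _ hj] at hj'
    exact congrArg Fin.val (huniq ⟨j, hj⟩ hj')

theorem IsCosetReps.cosetIndex_spec {Γ : Subgroup SL(2, ℤ)} {R : List SL(2, ℤ)}
    (hR : IsCosetReps Γ R) (x : SL(2, ℤ)) :
    cosetIndex Γ R x < R.length ∧ x * (R.getD (cosetIndex Γ R x) 1)⁻¹ ∈ Γ := by
  classical
  obtain ⟨i, hi, -⟩ := hR x
  have h : cosetIndex Γ R x < R.length := by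
    rw [cosetIndex, List.findIdx_lt_length]
    exact ⟨R.get i, List.get_mem _ _, by simpa using hi⟩
  refine ⟨h, ?_⟩
  rw [List.getD_eq_getElem _ _ h]
  have h1 := List.findIdx_getElem (w := h)
  exact of_decide_eq_true h1

/-- This allows the character to be read off the table: elements of `Γ'` with the same `Γ`-index
have the same class in `Γ' / Γ`. -/
theorem IsCosetReps.cosetIndex_eq_iff {Γ : Subgroup SL(2, ℤ)} {R : List SL(2, ℤ)}
    (hR : IsCosetReps Γ R) (x y : SL(2, ℤ)) :
    cosetIndex Γ R x = cosetIndex Γ R y ↔ x * y⁻¹ ∈ Γ := by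
  classical
  constructor
  · intro h
    have h1 := (hR.cosetIndex_spec x).2
    have h2 := (hR.cosetIndex_spec y).2
    rw [← h] at h2
    simpa [mul_assoc] using Γ.mul_mem h1 (Γ.inv_mem h2)
  · intro h
    rw [cosetIndex, cosetIndex]
    congr 1
    funext r
    rw [decide_eq_decide]
    constructor
    · intro h'
      simpa [mul_assoc] using Γ.mul_mem (Γ.inv_mem h) h'
    · intro h'
      simpa [mul_assoc] using Γ.mul_mem h h'

theorem entries_injective : Function.Injective entries := by
  intro x y h
  simp only [entries, Prod.mk.injEq] at h
  ext i j
  fin_cases i <;> fin_cases j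
  · exact h.1
  · exact h.2.1
  · exact h.2.2.1
  · exact h.2.2.2

theorem mulMat_entries (x y : SL(2, ℤ)) : mulMat (entries x) (entries y) = entries (x * y) := by
  simp [mulMat, entries, Matrix.SpecialLinearGroup.coe_mul, Matrix.mul_apply, Fin.sum_univ_two]

theorem invMat_entries (x : SL(2, ℤ)) : invMat (entries x) = entries x⁻¹ := by
  simp [invMat, entries, Matrix.SpecialLinearGroup.SL2_inv_expl]

theorem repAt_map_entries (R : List SL(2, ℤ)) (j : ℕ) :
    repAt (R.map entries) j = entries (R.getD j 1) := by
  rcases lt_or_ge j R.length with h | h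
  · rw [repAt, List.getD_eq_getElem _ _ (by simpa using h), List.getD_eq_getElem _ _ h]
    simp
  · rw [repAt, List.getD_eq_default _ _ (by simpa using h), List.getD_eq_default _ _ h]
    simp [entries]

/-- Inversion turns the right cosets of the list into the left cosets that the index counts. -/
theorem IsCosetReps.length_le_index {Γ : Subgroup SL(2, ℤ)} [Γ.FiniteIndex] {R : List SL(2, ℤ)}
    (hR : IsCosetReps Γ R) : R.length ≤ Γ.index := by
  have h : Function.Injective fun i : Fin R.length => (((R.get i)⁻¹ : SL(2, ℤ)) : SL(2, ℤ) ⧸ Γ) := by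
    intro i j hij
    have hij' := QuotientGroup.eq.mp hij
    rw [inv_inv] at hij'
    exact (hR (R.get i)).unique (by simp) hij'
  have := Nat.card_le_card_of_injective _ h
  rwa [Nat.card_fin] at this

end Cosets

/-! ### The answers to the queries -/

section Run

open ModularGroup

variable {Γ Γ' : Subgroup SL(2, ℤ)} {R R' : List SL(2, ℤ)} {s : List (Γ' × ℕ)} {k n : ℕ}

theorem isAnswer_iff {q : Query} {x : SL(2, ℤ)} {i : ℕ} (h : q.2 = entries x) :
    IsAnswer Γ Γ' R R' q i ↔ i = if q.1 then cosetIndex Γ' R' x else cosetIndex Γ R x := by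
  constructor
  · rintro ⟨y, hy, hi⟩
    rw [h] at hy
    rwa [entries_injective hy] at hi
  · exact fun hi => ⟨x, h.symm, hi⟩

/-- The matrix of the query number `i` for the action of `S` and `T`. -/
def actionElement (i : ℕ) : SL(2, ℤ) := if i / 2 % 2 = 0 then S else T

theorem entries_actionElement (i : ℕ) : (if i / 2 % 2 = 0 then (0, -1, 1, 0) else (1, 1, 0, 1) : Mat) =
    entries (actionElement i) := by
  rw [actionElement]
  split_ifs <;> simp [entries, coe_S, coe_T]

theorem actionQuery_snd (h : List ℕ) (i : ℕ) :
    (actionQuery (encodeInput k n R R' s, h) i).2 = entries (if i % 2 = 0 then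
      R'.getD (i / 4) 1 * actionElement i else
      R'.getD (i / 4) 1 * actionElement i * (R'.getD (h.getD (h.length - 1) 0) 1)⁻¹) := by
  simp only [actionQuery, encodeInput, repAt_map_entries, entries_actionElement]
  split_ifs
  · exact mulMat_entries _ _
  · simp only [invMat_entries, mulMat_entries]

theorem actionQuery_fst (a : Input × List ℕ) (i : ℕ) :
    (actionQuery a i).1 = decide (i % 2 = 0) := by
  rw [actionQuery]
  split_ifs with h <;> simp [h]

theorem tableLength_encodeInput (h : List ℕ) :
    tableLength (encodeInput k n R R' s, h) = s.length := by simp [tableLength, encodeInput]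

theorem repCount_encodeInput (h : List ℕ) :
    repCount (encodeInput k n R R' s, h) = R'.length := by simp [repCount, encodeInput]

theorem table_getD (i : ℕ) (hi : i < s.length) (x : Mat × ℕ) :
    (s.map fun p => (entries p.1, p.2)).getD i x = (entries s[i].1, s[i].2) := by
  rw [List.getD_eq_getElem _ _ (by simpa using hi)]
  simp

theorem nextQuery_of_lt {h : List ℕ} (hi : h.length < s.length) :
    nextQuery (encodeInput k n R R' s, h) = (false, entries s[h.length].1) := by
  rw [nextQuery, if_pos (by rwa [tableLength_encodeInput])]
  change (false, ((s.map fun p : Γ' × ℕ => (entries p.1, p.2)).getD h.length _).1) = _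
  rw [table_getD _ hi]

theorem nextQuery_of_le {h : List ℕ} (hi : s.length ≤ h.length) :
    nextQuery (encodeInput k n R R' s, h) =
      actionQuery (encodeInput k n R R' s, h) (h.length - s.length) := by
  rw [nextQuery, if_neg (by rw [tableLength_encodeInput]; exact Nat.not_lt.mpr hi), tableLength_encodeInput]

theorem exists_answer (h : List ℕ) :
    ∃ i, IsAnswer Γ Γ' R R' (nextQuery (encodeInput k n R R' s, h)) i := by
  rcases lt_or_ge h.length s.length with hi | hi
  · rw [nextQuery_of_lt hi]; exact ⟨_, _, rfl, rfl⟩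
  · rw [nextQuery_of_le hi]; exact ⟨_, _, (actionQuery_snd h _).symm, rfl⟩

/-- `h` consists of the correct answers to the first queries of the algorithm. -/
def IsHistory (Γ : Subgroup SL(2, ℤ)) (R R' : List SL(2, ℤ)) (s : List (Γ' × ℕ)) (k n : ℕ)
    (h : List ℕ) : Prop :=
  ∀ i (hi : i < h.length),
    IsAnswer Γ Γ' R R' (nextQuery (encodeInput k n R R' s, h.take i)) h[i]

theorem exists_isHistory (Γ : Subgroup SL(2, ℤ)) (R R' : List SL(2, ℤ)) (s : List (Γ' × ℕ))
    (k n t : ℕ) : ∃ h : List ℕ, h.length = t ∧ IsHistory Γ R R' s k n h := by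
  induction t with
  | zero => exact ⟨[], rfl, fun i hi => absurd hi (Nat.not_lt_zero _)⟩
  | succ t ih =>
    obtain ⟨h, hlen, hh⟩ := ih
    obtain ⟨x, hx⟩ := exists_answer (Γ := Γ) (R := R) (R' := R') (s := s) (k := k) (n := n) h
    refine ⟨h ++ [x], by simp [hlen], fun i hi => ?_⟩
    rcases Nat.lt_succ_iff_lt_or_eq.mp (by simpa using hi) with hi' | rfl
    · rw [List.take_append_of_le_length hi'.le, List.getElem_append_left hi']
      exact hh i hi'
    · simpa using hx

variable {h : List ℕ}

theorem IsHistory.table (hh : IsHistory Γ R R' s k n h) (hlen : s.length ≤ h.length) (i : ℕ)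
    (hi : i < s.length) : h.getD i 0 = cosetIndex Γ R s[i].1 := by
  have hi' : i < h.length := hi.trans_le hlen
  have h1 := hh i hi'
  have hl : (h.take i).length = i := by simpa using hi'.le
  rw [nextQuery_of_lt (by rwa [hl]), isAnswer_iff rfl] at h1
  rw [List.getD_eq_getElem _ _ hi', h1]
  simp only [hl]
  rfl

theorem IsHistory.action (hh : IsHistory Γ R R' s k n h)
    (hlen : h.length = s.length + 4 * R'.length) (i : ℕ) (hi : i < 4 * R'.length) :
    h.getD (s.length + i) 0 = if i % 2 = 0 then
      cosetIndex Γ' R' (R'.getD (i / 4) 1 * actionElement i) else cosetIndex Γ R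
        (R'.getD (i / 4) 1 * actionElement i * (R'.getD (h.getD (s.length + i - 1) 0) 1)⁻¹) := by
  have hi' : s.length + i < h.length := by omega
  have h1 := hh _ hi'
  have hl : (h.take (s.length + i)).length = s.length + i := by simpa using hi'.le
  rw [nextQuery_of_le (by rw [hl]; omega), isAnswer_iff (actionQuery_snd _ _), hl,
    Nat.add_sub_cancel_left, actionQuery_fst] at h1
  rw [List.getD_eq_getElem _ _ hi', h1]
  by_cases hi2 : i % 2 = 0
  · simp [hi2]
  -- For odd `i`, the last answer available at this query is the one to query `i - 1`, namely the
  -- `Γ'`-index `l` of the same product.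
  · have hlt : s.length + i - 1 < s.length + i := by omega
    have htake : (h.take (s.length + i)).getD (s.length + i - 1) 0 =
        h.getD (s.length + i - 1) 0 := by
      rw [List.getD_eq_getElem _ _ (by rwa [hl]), List.getElem_take,
        List.getD_eq_getElem _ _ (hlt.trans hi')]
    simp only [hi2, decide_false, if_false, Bool.false_eq_true, htake]

theorem actionElement_four_mul_add (i b : ℕ) : actionElement (4 * i + b) = actionElement b := by
  rw [actionElement, actionElement, show (4 * i + b) / 2 % 2 = b / 2 % 2 by omega]

variable {K : Type} [Field K] {ζ : K} [(Γ.subgroupOf Γ').Normal]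
  {ε : Γ' ⧸ Γ.subgroupOf Γ' →* Kˣ}

theorem IsHistory.isCosetAction (hh : IsHistory Γ R R' s k n h)
    (hlen : h.length = s.length + 4 * R'.length) (hζ : IsPrimitiveRoot ζ n)
    (hR : IsCosetReps Γ R) (hR' : IsCosetReps Γ' R') (hs : IsCharTable ζ ε s) {b : ℕ}
    (hb : b = 0 ∨ b = 2) :
    IsCosetAction ζ ε R'.length (fun j => R'.getD j 1) (actionElement b)
      (actionIndex b (encodeInput k n R R' s, h)) (actionExponent b (encodeInput k n R R' s, h)) := by
  intro i hi
  have hl : actionIndex b (encodeInput k n R R' s, h) i =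
      cosetIndex Γ' R' (R'.getD i 1 * actionElement b) := by
    rw [actionIndex, tableLength_encodeInput]
    change h.getD _ 0 = _
    rw [hh.action hlen _ (by omega), if_pos (by omega), actionElement_four_mul_add,
      show (4 * i + b) / 4 = i by omega]
  obtain ⟨hlt, hmem⟩ := hR'.cosetIndex_spec (R'.getD i 1 * actionElement b)
  rw [← hl] at hlt hmem
  set γ : Γ' := ⟨_, hmem⟩ with hγ
  refine ⟨hlt, γ, by simp [hγ], ?_⟩
  have hv : h.getD (s.length + (4 * i + b + 1)) 0 = cosetIndex Γ R γ := by
    rw [hh.action hlen _ (by omega), if_neg (by omega), show (4 * i + b + 1) / 4 = i by omega,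
      add_assoc (4 * i), actionElement_four_mul_add,
      show actionElement (b + 1) = actionElement b by
        rw [actionElement, actionElement, show (b + 1) / 2 % 2 = b / 2 % 2 by omega], hγ]
    simp only [actionIndex, tableLength_encodeInput]
    rfl
  obtain ⟨q, hq, -⟩ := hs.1 γ
  have hq' : h.getD q 0 = cosetIndex Γ R γ := by
    rw [hh.table (by omega) q q.2, hR.cosetIndex_eq_iff]
    have := QuotientGroup.eq_iff_div_mem.mp hq
    rw [div_eq_mul_inv] at this
    exact this
  -- The search runs over the whole history, where later answers may be indices for `Γ'`. Some table
  -- element lies in the coset of `γ`, so the first occurrence already falls in the table part.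
  set idx := h.idxOf (cosetIndex Γ R (γ : SL(2, ℤ))) with hidx
  have hidx_lt : idx < s.length := by
    have hqh : (q : ℕ) < h.length := by have := q.2; omega
    rw [List.getD_eq_getElem _ _ hqh] at hq'
    refine lt_of_le_of_lt (not_lt.mp fun hlt' => ?_) q.2
    have := List.not_of_lt_findIdx hlt'
    simp [hq'] at this
  have hval : h.getD idx 0 = cosetIndex Γ R γ := by
    have hlt' : idx < h.length := by omega
    rw [List.getD_eq_getElem _ _ hlt']
    exact List.getElem_idxOf hlt'
  rw [hh.table (by omega) idx hidx_lt, hR.cosetIndex_eq_iff] at hval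
  have heq : ((s[idx].1 : Γ') : Γ' ⧸ Γ.subgroupOf Γ') = γ := by
    rw [QuotientGroup.eq_iff_div_mem, div_eq_mul_inv]
    exact hval
  rw [← heq, hs.2 _ (List.getElem_mem _), actionExponent, tableLength_encodeInput]
  change _ = ζ ^ (((s.map fun p : Γ' × ℕ => (entries p.1, p.2)).getD
    (h.idxOf (h.getD (s.length + (4 * i + b + 1)) 0)) _).2 % n)
  rw [hv, ← hidx, table_getD _ hidx_lt]
  -- Exponents are reduced modulo `n` so that they are bounded by `n`, as the degree estimates
  -- require; `ζ^n = 1` makes this harmless.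
  exact pow_eq_pow_mod _ hζ.pow_eq_one

end Run

end ModSym

namespace ModSym

/-! ### Correctness of the algorithm -/

section Correctness

open ModularGroup

variable {Γ Γ' : Subgroup SL(2, ℤ)} [(Γ.subgroupOf Γ').Normal] {R R' : List SL(2, ℤ)}
  {s : List (Γ' × ℕ)} {k n : ℕ} {K : Type} [Field K] {ζ : K}
  {ε : Γ' ⧸ Γ.subgroupOf Γ' →* Kˣ}

theorem IsCharTable.length_eq_relIndex (hs : IsCharTable ζ ε s) : s.length = Γ.relIndex Γ' := by
  have h : Function.Bijective fun i : Fin s.length => ((s.get i).1 : Γ' ⧸ Γ.subgroupOf Γ') :=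
    (Function.bijective_iff_existsUnique _).mpr hs.1
  have := Nat.card_congr (Equiv.ofBijective _ h)
  rwa [Nat.card_fin] at this

theorem IsCharTable.exists_coe_eq (hs : IsCharTable ζ ε s) (γ : Γ') :
    ∃ c : ZAdjoin ζ, (c : K) = (ε (γ : Γ' ⧸ Γ.subgroupOf Γ') : K) := by
  obtain ⟨i, hi, -⟩ := hs.1 γ
  refine ⟨adjoinGen ζ ^ (s.get i).2, ?_⟩
  rw [← hi, hs.2 _ (List.get_mem _ _), SubmonoidClass.coe_pow]
  rfl

/-- The table has `[Γ' : Γ]` entries and `R'` has at most `[SL₂(ℤ) : Γ']`; both indices divide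
`[SL₂(ℤ) : Γ]`, whence the constant `1 + 4`. -/
theorem query_count_le [Γ.FiniteIndex] (hΓ : Γ ≤ Γ') (hR' : IsCosetReps Γ' R')
    (hs : IsCharTable ζ ε s) : s.length + 4 * R'.length ≤ 5 * Γ.index := by
  have : Γ'.FiniteIndex := Subgroup.finiteIndex_of_le hΓ
  have h1 := Subgroup.relIndex_mul_index hΓ
  have h2 : s.length ≤ Γ.index := by
    rw [hs.length_eq_relIndex, ← h1]
    exact Nat.le_mul_of_pos_right _ (Nat.pos_of_ne_zero Subgroup.FiniteIndex.index_ne_zero)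
  have h3 : R'.length ≤ Γ.index := by
    refine hR'.length_le_index.trans ?_
    rw [← h1]
    exact Nat.le_mul_of_pos_left _ (Nat.pos_of_ne_zero fun h0 =>
      (Subgroup.FiniteIndex.index_ne_zero (H := Γ)) (by rw [← h1, h0, zero_mul]))
  omega

theorem orderOf_pos_of_finiteIndex [Γ.FiniteIndex] (ε : Γ' ⧸ Γ.subgroupOf Γ' →* Kˣ) :
    0 < orderOf ε := by
  have : Finite (Γ' ⧸ Γ.subgroupOf Γ') := Subgroup.finite_quotient_of_finiteIndex
  rw [orderOf_pos_iff, isOfFinOrder_iff_pow_eq_one]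
  refine ⟨Nat.card (Γ' ⧸ Γ.subgroupOf Γ'), Nat.card_pos, ?_⟩
  refine DFunLike.ext _ _ fun q => ?_
  rw [MonoidHom.pow_apply, ← map_pow, pow_card_eq_one', map_one, MonoidHom.one_apply]

/-- Acceptance is equivalent to the certificate identities for the true coset action. Existence of a
certificate then gives halting, and soundness applies to whichever certificate is found. -/
theorem halts_with_basis [CharZero K] (hΓ : Γ ≤ Γ') (hn : 0 < n) (hζ : IsPrimitiveRoot ζ n)
    (htop : Algebra.adjoin ℚ {ζ} = ⊤) (hR : IsCosetReps Γ R) (hR' : IsCosetReps Γ' R')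
    (hs : IsCharTable ζ ε s) :
    ∃ out, cuspidalAlgorithm.HaltsWith (IsAnswer Γ Γ' R R') (encodeInput k n R R' s) out
      (s.length + 4 * R'.length) ∧ IsCuspidalBasis ζ ε k R' out := by
  obtain ⟨h, hlen, hh⟩ := exists_isHistory Γ R R' s k n (s.length + 4 * R'.length)
  have hS := hh.isCosetAction hlen hζ hR hR' hs (Or.inl rfl)
  have hT := hh.isCosetAction hlen hζ hR hR' hs (Or.inr rfl)
  have heS : ∀ i, actionExponent 0 (encodeInput k n R R' s, h) i ≤ n := fun i =>
    (Nat.mod_lt _ hn).le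
  have heT : ∀ i, actionExponent 2 (encodeInput k n R R' s, h) i ≤ n := fun i =>
    (Nat.mod_lt _ hn).le
  have hrow : rowCount (encodeInput k n R R' s, h) = R'.length * (k - 2 + 1) := by
    rw [rowCount, repCount_encodeInput]; rfl
  have hiff : ∀ C, Accepts (encodeInput k n R R' s, h) C ↔ C.1 ≤ R'.length * (k - 2 + 1) ∧
      C.2.2.1 ≠ 0 ∧ IsPolyCertificate n R'.length (k - 2)
        (actionIndex 0 (encodeInput k n R R' s, h)) (actionExponent 0 (encodeInput k n R R' s, h))
        (actionIndex 2 (encodeInput k n R R' s, h)) (actionExponent 2 (encodeInput k n R R' s, h))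
        C.1 C.2.1 C.2.2.1 (certCoeff C.2.2.2) := fun C => by
    rw [isPolyCertificate_iff heS heT, Accepts, hrow]; rfl
  obtain ⟨r, hr, L, c, hc, l, hl⟩ := exists_isPolyCertificate (d := k - 2) hn hζ htop
    (actMat_relation hR'.existsUnique hS hT)
  obtain ⟨C, hC, hout⟩ := exists_output_mem_step (a := (encodeInput k n R R' s, h))
    (by rw [tableLength_encodeInput, repCount_encodeInput]; exact hlen)
    ⟨(r, L, c, l), (hiff _).mpr ⟨hr, hc, hl⟩⟩
  obtain ⟨hr', hc', hl'⟩ := (hiff C).mp hC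
  refine ⟨_, ⟨h, hlen, fun i => ⟨_, nextQuery_mem_step ?_, hh i i.2⟩, hout⟩, ?_⟩
  · rw [tableLength_encodeInput, repCount_encodeInput]
    change (h.take i).length < _
    rw [List.length_take_of_le i.2.le, ← hlen]
    exact i.2
  · rw [certOutput, hrow]
    exact isCuspidalBasis_of_poly_certificate hn hζ hΓ hs.exists_coe_eq hR'.existsUnique hS hT
      hr' hc' _ (fun i => polyMat _ C.2.1 (certCoeff C.2.2.2 i))
      (fun i => polyMat _ C.2.1 (certCoeff C.2.2.2 (7 + i))) (fun _ _ => rfl) hl'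

end Correctness

end ModSym

theorem mainTheorem5 :
    ∃ (A : ModSym.CosetAlgorithm) (C : ℕ),
      ∀ (Γ Γ' : Subgroup SL(2, ℤ)) [Γ.FiniteIndex], Γ ≤ Γ' →
      ∀ [(Γ.subgroupOf Γ').Normal] (n : ℕ) (ζ : CyclotomicField n ℚ), IsPrimitiveRoot ζ n →
      ∀ (ε : Γ' ⧸ Γ.subgroupOf Γ' →* (CyclotomicField n ℚ)ˣ), orderOf ε = n →
      ∀ (k : ℕ), 2 ≤ k →
      ∀ (R R' : List SL(2, ℤ)) (s : List (Γ' × ℕ)),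
        ModSym.IsCosetReps Γ R → ModSym.IsCosetReps Γ' R' → ModSym.IsCharTable ζ ε s →
        ∃ (out : ModSym.Output) (t : ℕ),
          A.HaltsWith (ModSym.IsAnswer Γ Γ' R R') (ModSym.encodeInput k n R R' s) out t ∧
          t ≤ C * (Γ'.index * ModSym.epsCuspCount ζ ε + Γ.index) ∧
          ModSym.IsCuspidalBasis ζ ε k R' out := by
  refine ⟨ModSym.cuspidalAlgorithm, 5, ?_⟩
  intro Γ Γ' _ hΓ _ n ζ hζ ε hε k _ R R' s hR hR' hs
  -- `Γ' / Γ` is finite, so the order of `ε` is not the value `0` reserved for infinite order.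
  have hn : 0 < n := hε ▸ ModSym.orderOf_pos_of_finiteIndex ε
  have : NeZero n := ⟨hn.ne'⟩
  have : IsCyclotomicExtension {n} ℚ (CyclotomicField n ℚ) :=
    CyclotomicField.isCyclotomicExtension n ℚ
  obtain ⟨out, hhalt, hbasis⟩ := ModSym.halts_with_basis (k := k) hΓ hn hζ
    (IsCyclotomicExtension.adjoin_primitive_root_eq_top hζ) hR hR' hs
  -- The calls are already bounded by five times the index of `Γ`; adding the term with
  -- `epsCuspCount` only weakens the bound.
  exact ⟨out, _, hhalt, (ModSym.query_count_le hΓ hR' hs).trans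
    (Nat.mul_le_mul_left 5 (Nat.le_add_left _ _)), hbasis⟩
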